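/- **Efficient correction of $\varepsilon$-twisted embeddable unitaries.** Let $\sigma_x,\sigma_z$ be the Pauli matrices and $\|\cdot\|$ the operator norm. For $\theta\in[0,\pi]$ and $\varphi\in[-\pi,\pi]$ put $U'_{\varphi,\theta}=e^{i\varphi\sigma_z/2}e^{i\theta\sigma_x}e^{-i\varphi\sigma_z/2}$; a unitary $U\in U(2)$ is $\nu$-close to $U'_{\varphi,\theta}$ if $\|U-U'_{\varphi,\theta}\|\le\nu$. A *circuit with $\zeta$ calls to $U$ and $a$ ancillas* acts on one system qubit and $a$ ancilla qubits. It consists of $\zeta$ calls to $U$ (each applying $U$ to some qubit; or, in the controlled model, applying controlled-$U$ to some ordered pair of distinct qubits), interleaved with fixed unitaries of the register that do not depend on $U$; the inverse of $U$ is not called. The ancillas start in $|0\cdots0\rangle$ and are measured at the end in the computational basis; the outcome $0\cdots0$ is success. Let $K=(I\otimes\langle0\cdots0|)\,\mathcal C\,(I\otimes|0\cdots0\rangle)$ be the resulting operator on the system qubit, where $\mathcal C$ is the unitary of the circuit. We say that the circuit *implements* a unitary $W$ up to error $\eta$ with success probability at least $(1-\eta)^2$ if $\|K-W\|\le\eta$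 and, in case $\eta\le1$, for every unit vector $\psi$ the success probability $\|K\psi\|^2$ is at least $(1-\eta)^2$ and the normalized output state on success satisfies $\big\|K\psi/\|K\psi\|-W\psi\big\|\le\eta$. There is an absolute constant $C>0$ such that the following hold for all $\delta,\gamma,\varepsilon>0$. 1. *(Controlled access, one ancilla.)* There is a circuit with one ancilla and $$\zeta\le C\,\delta^{-1}\max\{1,\log(\varepsilon^{-2}\delta^{-1/2})\}$$ calls to controlled-$U$, depending only on $\delta,\varepsilon$, such that for every $\nu$, every $\theta\in[0,\pi]$ with $\cos\theta\in[-1+\delta,1-\delta]$, every $\varphi\in[-\pi,\pi]$ and every unitary $U$ that is $\nu$-close to $U'_{\varphi,\theta}$, the circuit implements $e^{i\theta\sigma_x}$ up to error $\zeta\nu+\varepsilon$ with success probability at least $(1-(\zeta\nu+\varepsilon))^2$. 2. *(Uncontrolled access, two ancillas.)* There is a circuit with two ancillas and $\zeta\le C\,\delta^{-1}\max\{1,\log(\varepsilon^{-2}\delta^{-1/2})\}$ calls to (uncontrolled) $U$, depending only on $\delta,\varepsilon$, for which the same conclusion holds whenever $\cos\theta\in[\delta,1-\delta]$. 3. *(Uncontrolled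 access, no ancilla, deterministic.)* There is a single-qubit circuit without ancillas with $$\zeta'\le C\,\delta^{-1}\gamma^{-2}\big(\max\{1,\log(\gamma^{-4}\varepsilon^{-2}\delta^{-1/2})\}\big)^2$$ calls to $U$, depending only on $\delta,\gamma,\varepsilon$, such that for every $\nu$, every $\theta\in[0,\pi]$ with $\cos\theta\in[-1+\delta,1-\delta]$, every $\varphi\in[-\pi/2,\pi/2]$ with $\cos\varphi\in[\gamma,\sqrt{1-\gamma^2}]$ or $\varphi\in[-\pi/2+2\gamma,-2\gamma]\cup[2\gamma,\pi/2-2\gamma]$, and every unitary $U$ that is $\nu$-close to $U'_{\varphi,\theta}$, the circuit applies (with certainty) a unitary $V$ with $\|V-e^{i\theta\sigma_x}\|\le\zeta'\nu+\varepsilon$. In all cases $\zeta$ (respectively $\zeta'$) is the exact number of calls that the circuit makes. -/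

import Mathlib

open scoped Matrix.Norms.L2Operator

namespace Correction

noncomputable section

/-- The Pauli matrix `σ_x`. -/
def sigmaX : Matrix (Fin 2) (Fin 2) ℂ := !![0, 1; 1, 0]

/-- The Pauli matrix `σ_z`. -/
def sigmaZ : Matrix (Fin 2) (Fin 2) ℂ := !![1, 0; 0, -1]

/-- `e^{i t σ_x}`; for `t ∈ [0, π]` these are the embeddable unitaries. -/
def rotX (t : ℝ) : Matrix (Fin 2) (Fin 2) ℂ := NormedSpace.exp ((Complex.I * (t : ℂ)) • sigmaX)

/-- `e^{i t σ_z}`. -/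
def rotZ (t : ℝ) : Matrix (Fin 2) (Fin 2) ℂ := NormedSpace.exp ((Complex.I * (t : ℂ)) • sigmaZ)

/-- `e^{i φ σ_z / 2} e^{i θ σ_x} e^{-i φ σ_z / 2}`. -/
def twisted (φ θ : ℝ) : Matrix (Fin 2) (Fin 2) ℂ := rotZ (φ / 2) * rotX θ * rotZ (-(φ / 2))

/-- Computational basis labels of a register of `n` qubits. -/
abbrev Register (n : ℕ) : Type := Fin n → Fin 2

/-- A place where an uncontrolled call to `U` can act: the target qubit. -/
abbrev PlainCall (n : ℕ) : Type := Fin n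

/-- A place where a call to controlled-`U` can act: a control qubit and a different
target qubit. -/
abbrev ControlledCall (n : ℕ) : Type := {p : Fin n × Fin n // p.1 ≠ p.2}

/-- The operator of the register that applies `U` to the qubit `t`. -/
def plainCall {n : ℕ} (U : Matrix (Fin 2) (Fin 2) ℂ) (t : PlainCall n) :
    Matrix (Register n) (Register n) ℂ :=
  Matrix.of fun x y => if ∀ k, k ≠ t → x k = y k then U (x t) (y t) else 0

/-- The operator of the register that applies `U` to the target qubit `q.1.2` if the control
qubit `q.1.1` is `1`, and the identity if it is `0`. -/
def controlledCall {n : ℕ} (U : Matrix (Fin 2) (Fin 2) ℂ) (q : ControlledCall n) :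
    Matrix (Register n) (Register n) ℂ :=
  Matrix.of fun x y =>
    if ∀ k, k ≠ q.1.2 → x k = y k then
      (if x q.1.1 = 1 then U else 1) (x q.1.2) (y q.1.2)
    else 0

/-- A quantum circuit on `n` qubits making black-box calls, whose places are described by `Q`:
a fixed unitary of the register, followed by rounds that consist of one call and one fixed
unitary of the register. The fixed unitaries do not depend on the black box. -/
structure QueryCircuit (n : ℕ) (Q : Type) where
  init : Matrix.unitaryGroup (Register n) ℂ
  rounds : List (Q × Matrix.unitaryGroup (Register n) ℂ)

namespace QueryCircuit

/-- The number of black-box calls. -/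
def calls {n : ℕ} {Q : Type} (c : QueryCircuit n Q) : ℕ := c.rounds.length

/-- The operator of the register that the circuit applies, if a call at place `q` applies
`call q`. -/
def run {n : ℕ} {Q : Type} (c : QueryCircuit n Q) (call : Q → Matrix (Register n) (Register n) ℂ) :
    Matrix (Register n) (Register n) ℂ :=
  c.rounds.foldl
    (fun M r => (r.2 : Matrix (Register n) (Register n) ℂ) * call r.1 * M)
    (c.init : Matrix (Register n) (Register n) ℂ)

/-- For a circuit on one system qubit (qubit `0`) and `a` ancilla qubits, the operator
`(I ⊗ ⟨0…0|) C (I ⊗ |0…0⟩)` on the system qubit, where `C` is the operator of the circuit: the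
ancillas start in `|0…0⟩`, are measured in the computational basis at the end, and the outcome
`0…0` means success. For `a = 0` this is the unitary of the circuit itself. -/
def output {a : ℕ} {Q : Type} (c : QueryCircuit (a + 1) Q)
    (call : Q → Matrix (Register (a + 1)) (Register (a + 1)) ℂ) : Matrix (Fin 2) (Fin 2) ℂ :=
  Matrix.of fun i j =>
    c.run call (Fin.cons (α := fun _ => Fin 2) i fun _ => 0)
      (Fin.cons (α := fun _ => Fin 2) j fun _ => 0)

end QueryCircuit

/-- The (unnormalized) state of the system qubit after success on the input state `ψ`. -/
def branch (K : Matrix (Fin 2) (Fin 2) ℂ) (ψ : EuclideanSpace ℂ (Fin 2)) :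
    EuclideanSpace ℂ (Fin 2) :=
  Matrix.toEuclideanCLM (𝕜 := ℂ) K ψ

/-- The probability of success on the input state `ψ`, by the Born rule. -/
def successProb (K : Matrix (Fin 2) (Fin 2) ℂ) (ψ : EuclideanSpace ℂ (Fin 2)) : ℝ :=
  ‖branch K ψ‖ ^ 2

/-- The (normalized) state of the system qubit after success on the input state `ψ`. -/
def outputState (K : Matrix (Fin 2) (Fin 2) ℂ) (ψ : EuclideanSpace ℂ (Fin 2)) :
    EuclideanSpace ℂ (Fin 2) :=
  ((‖branch K ψ‖⁻¹ : ℝ) : ℂ) • branch K ψ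

/-- The success branch `K` implements the unitary `W` up to the error `η` (in operator norm, and
also for the normalized output state on every input state), with success probability at least
`(1 - η)²` on every input state. The two claims on states are void for `η > 1`, where the bound
`(1 - η)²` has no meaning as a probability of success. -/
def Implements (K W : Matrix (Fin 2) (Fin 2) ℂ) (η : ℝ) : Prop :=
  ‖K - W‖ ≤ η ∧
    (η ≤ 1 → ∀ ψ : EuclideanSpace ℂ (Fin 2), ‖ψ‖ = 1 →
      (1 - η) ^ 2 ≤ successProb K ψ ∧ ‖outputState K ψ - branch W ψ‖ ≤ η)

end

end Correction

namespace Correction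

open Complex

set_option linter.unusedSimpArgs false

noncomputable section

/-! ### Two-by-two matrices -/

/-! Write n for `axis φ`, so that the twisted unitary is cos θ + i sin θ n. The unknown angle φ
enters only through the reflection n, so it suffices to manufacture n from calls to U and to use it
to undo the twist.

Manufacturing n is quantum signal processing. In the quaternion coordinates `su2 φ A B`, the twisted
unitary multiplies (A, B) by (e^{iθ}, e^{-iθ}), and a z-rotation turns the pair by a real plane
rotation; neither rule involves φ. Hence one word of calls and z-rotations serves all φ at once.
`exists_qspWord` peels rotations off a pair of real polynomials with |a|² + |b|² = 1 on the unit
circle, and the Fejér–Riesz factorization `isNormSq_of_nonneg`, through `exists_complement`,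
supplies b for every admissible a. Unitarity makes the distance from the word to `su2 φ u 0` depend
only on Re(A ū) (`exists_qspWord_norm_sub`). Letting A be i times an odd polynomial approximation of
the sign, evaluated at sin θ, gives a word near i n; the same polynomial at cos θ gives a word near
1. The sign is approximated by a primitive of a power of a Dirichlet kernel (`exists_sign_approx`),
which accounts for the factor δ⁻¹ log.

With an ancilla, `select_axis_conj` gives an exact identity: conjugating the twisted unitary on the
ancilla by a fixed parity gate and by controlled n yields e^{iθσ_x} on the system. Controlled n is
replaced by a selected word. With controlled calls the other branch is the identity; with plain
calls it is a word of equal length near 1, which is why cos θ must then be bounded below.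

Without ancillas, σ_x n = e^{-iφσ_z}. A Hadamard conjugation makes this an x-rotation about a known
axis, and a second word halves its angle (`exists_half_angle_word`). The results e^{∓iφσ_z/2} undo
the twist directly; nesting the words multiplies their lengths.

Imprecision of U costs ν per call (`QueryCircuit.norm_run_sub_le`). Closeness of the whole register
operator, which is stronger than closeness of its success branch, controls the normalized output
(`implements_of_norm_sub_le`). -/

/-- The reflection with off-diagonal entries `e^{±iφ}`. -/
def axis (φ : ℝ) : Matrix (Fin 2) (Fin 2) ℂ := !![0, exp (φ * I); exp (-(φ * I)), 0]

/-- The matrix `Re A + i Im A axis φ + i B'`, where `B'` collects the components of `B` along the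
two remaining directions. -/
def su2 (φ : ℝ) (A B : ℂ) : Matrix (Fin 2) (Fin 2) ℂ :=
  !![A.re + I * B.re, (I * A.im - B.im) * exp (φ * I);
    (I * A.im + B.im) * exp (-(φ * I)), A.re - I * B.re]

theorem rotZ_eq (t : ℝ) : rotZ t = !![exp (t * I), 0; 0, exp (-(t * I))] := by
  have h : (I * (t : ℂ)) • sigmaZ = Matrix.diagonal ![t * I, -(t * I)] := by
    ext i j
    fin_cases i <;> fin_cases j <;> simp [sigmaZ, mul_comm]
  rw [rotZ, h, Matrix.exp_diagonal]
  ext i j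
  fin_cases i <;> fin_cases j <;> simp [Pi.exp_def, ← Complex.exp_eq_exp_ℂ]

/-- The Hadamard gate. -/
def hadamard : Matrix (Fin 2) (Fin 2) ℂ := ((√2 : ℝ) : ℂ)⁻¹ • !![1, 1; 1, -1]

theorem sqrt_two_inv_mul_self : (((√2 : ℝ) : ℂ)⁻¹) * (((√2 : ℝ) : ℂ)⁻¹) = 1 / 2 := by
  rw [← mul_inv, ← ofReal_mul, Real.mul_self_sqrt (by norm_num)]
  norm_num

theorem hadamard_mul_self : hadamard * hadamard = 1 := by
  rw [hadamard, Matrix.smul_mul, Matrix.mul_smul, smul_smul, sqrt_two_inv_mul_self]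
  ext i j
  fin_cases i <;> fin_cases j <;> norm_num [Matrix.mul_apply, Fin.sum_univ_two]

theorem hadamard_mul_mul_hadamard (a b c d : ℂ) :
    hadamard * !![a, b; c, d] * hadamard =
      (1 / 2 : ℂ) • !![a + b + c + d, a - b + c - d; a + b - c - d, a - b - c + d] := by
  rw [hadamard, Matrix.smul_mul, Matrix.mul_smul, Matrix.smul_mul, smul_smul,
    sqrt_two_inv_mul_self]
  congr 1
  ext i j
  fin_cases i <;> fin_cases j <;> simp [Matrix.mul_apply, Fin.sum_univ_two] <;> ring

theorem hadamard_sigmaZ_hadamard : hadamard * sigmaZ * hadamard = sigmaX := by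
  rw [sigmaZ, hadamard_mul_mul_hadamard, sigmaX]
  ext i j
  fin_cases i <;> fin_cases j <;> norm_num

theorem isUnit_hadamard : IsUnit hadamard :=
  IsUnit.of_mul_eq_one _ hadamard_mul_self

theorem hadamard_rotZ_hadamard (t : ℝ) : hadamard * rotZ t * hadamard = rotX t := by
  have h1 : hadamard⁻¹ = hadamard := Matrix.inv_eq_right_inv hadamard_mul_self
  have h2 := Matrix.exp_conj hadamard ((I * (t : ℂ)) • sigmaZ) isUnit_hadamard
  rw [h1, Matrix.mul_smul, Matrix.smul_mul, hadamard_sigmaZ_hadamard] at h2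
  rw [rotX, rotZ, h2]

theorem exp_ofReal_mul_I_eq (t : ℝ) : exp (t * I) = Real.cos t + Real.sin t * I := by
  rw [exp_mul_I, ofReal_cos, ofReal_sin]

theorem exp_neg_ofReal_mul_I_eq (t : ℝ) : exp (-(t * I)) = Real.cos t - Real.sin t * I := by
  rw [← neg_mul, exp_mul_I, ofReal_cos, ofReal_sin, Complex.cos_neg, Complex.sin_neg]
  ring

theorem rotX_eq (t : ℝ) :
    rotX t = !![(Real.cos t : ℂ), I * Real.sin t; I * Real.sin t, Real.cos t] := by
  rw [← hadamard_rotZ_hadamard, rotZ_eq, hadamard_mul_mul_hadamard, exp_ofReal_mul_I_eq,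
    exp_neg_ofReal_mul_I_eq]
  ext i j
  fin_cases i <;> fin_cases j <;> simp <;> ring

theorem exp_mul_exp_neg (t : ℂ) : exp t * exp (-t) = 1 := by
  rw [← Complex.exp_add]; simp

theorem exp_half_mul_self (t : ℝ) :
    exp (((t / 2 : ℝ) : ℂ) * I) * exp (((t / 2 : ℝ) : ℂ) * I) = exp (t * I) := by
  rw [← Complex.exp_add]; congr 1; push_cast; ring

theorem exp_neg_half_mul_self (t : ℝ) :
    exp (-(((t / 2 : ℝ) : ℂ) * I)) * exp (-(((t / 2 : ℝ) : ℂ) * I)) = exp (-(t * I)) := by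
  rw [← Complex.exp_add]; congr 1; push_cast; ring

theorem twisted_eq_su2 (φ θ : ℝ) : twisted φ θ = su2 φ (exp (θ * I)) 0 := by
  have h1 := exp_mul_exp_neg (((φ / 2 : ℝ) : ℂ) * I)
  rw [twisted, rotX_eq, rotZ_eq, rotZ_eq, su2, ← exp_half_mul_self φ, ← exp_neg_half_mul_self φ,
    exp_ofReal_mul_I_eq θ]
  generalize hu : exp (((φ / 2 : ℝ) : ℂ) * I) = u at *
  generalize hv : exp (-(((φ / 2 : ℝ) : ℂ) * I)) = v at *
  have e1 : exp (((-(φ / 2) : ℝ) : ℂ) * I) = v := by rw [← hv]; congr 1; push_cast; ring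
  have e2 : exp (-(((-(φ / 2) : ℝ) : ℂ) * I)) = u := by rw [← hu]; congr 1; push_cast; ring
  rw [e1, e2]
  ext i j
  fin_cases i <;> fin_cases j <;>
    simp [Matrix.mul_apply, Fin.sum_univ_two, -ofReal_cos, -ofReal_sin, Complex.cos_ofReal_re,
      Complex.sin_ofReal_re]
  · linear_combination ((Real.cos θ : ℝ) : ℂ) * h1
  · ring
  · ring
  · linear_combination ((Real.cos θ : ℝ) : ℂ) * h1

theorem su2_sub (φ : ℝ) (A B A' B' : ℂ) :
    su2 φ A B - su2 φ A' B' = su2 φ (A - A') (B - B') := by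
  ext i j
  fin_cases i <;> fin_cases j <;> simp [su2] <;> ring

theorem conj_exp_ofReal_mul_I (t : ℝ) : (starRingEnd ℂ) (exp (t * I)) = exp (-(t * I)) := by
  rw [← exp_conj]; simp

theorem conj_exp_neg_ofReal_mul_I (t : ℝ) : (starRingEnd ℂ) (exp (-(t * I))) = exp (t * I) := by
  rw [← exp_conj]; simp

/-- The matrices 1, i n, i σ_z and n σ_z, with n = `axis φ`, are quaternion units up to sign, and Re
A, Im A, Re B, Im B are the coordinates along them. The operator norm is therefore exactly the
Euclidean norm of (A, B). -/
theorem star_su2_mul_su2 (φ : ℝ) (A B : ℂ) :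
    star (su2 φ A B) * su2 φ A B = ((‖A‖ ^ 2 + ‖B‖ ^ 2 : ℝ) : ℂ) • 1 := by
  have h := exp_mul_exp_neg (φ * I)
  rw [Complex.sq_norm, Complex.sq_norm, normSq_apply, normSq_apply]
  ext i j
  fin_cases i <;> fin_cases j <;>
    simp [su2, Matrix.mul_apply, Fin.sum_univ_two, Matrix.star_eq_conjTranspose,
      conj_exp_ofReal_mul_I, conj_exp_neg_ofReal_mul_I]
  · linear_combination ((A.im : ℂ) ^ 2 + B.im ^ 2) * h + (- (B.re:ℂ) ^ 2 - (A.im:ℂ)^2 * exp (φ * I) * exp (-(φ * I))) * I_sq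
  · ring
  · ring
  · linear_combination ((A.im : ℂ) ^ 2 + B.im ^ 2) * h + (- (B.re:ℂ) ^ 2 - (A.im:ℂ)^2 * exp (φ * I) * exp (-(φ * I))) * I_sq

theorem norm_su2_sq (φ : ℝ) (A B : ℂ) : ‖su2 φ A B‖ ^ 2 = ‖A‖ ^ 2 + ‖B‖ ^ 2 := by
  rw [sq, ← CStarRing.norm_star_mul_self, star_su2_mul_su2, norm_smul, norm_one, mul_one,
    norm_real, Real.norm_eq_abs, abs_of_nonneg (by positivity)]

theorem su2_mem_unitaryGroup (φ : ℝ) {A B : ℂ} (h : ‖A‖ ^ 2 + ‖B‖ ^ 2 = 1) :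
    su2 φ A B ∈ Matrix.unitaryGroup (Fin 2) ℂ := by
  rw [Matrix.mem_unitaryGroup_iff', star_su2_mul_su2, h]
  simp

theorem twisted_mem_unitaryGroup (φ θ : ℝ) : twisted φ θ ∈ Matrix.unitaryGroup (Fin 2) ℂ := by
  rw [twisted_eq_su2]
  exact su2_mem_unitaryGroup φ (by simp [norm_exp_ofReal_mul_I])

theorem rotZ_eq_su2 (α : ℝ) : rotZ α = su2 0 (Real.cos α) (Real.sin α) := by
  rw [rotZ_eq, su2, exp_ofReal_mul_I_eq, exp_neg_ofReal_mul_I_eq]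
  ext i j
  fin_cases i <;> fin_cases j <;>
    simp [-ofReal_cos, -ofReal_sin, Complex.cos_ofReal_re, Complex.sin_ofReal_re] <;> ring

theorem rotZ_mem_unitaryGroup (α : ℝ) : rotZ α ∈ Matrix.unitaryGroup (Fin 2) ℂ := by
  rw [rotZ_eq_su2]
  refine su2_mem_unitaryGroup 0 ?_
  rw [norm_real, norm_real]
  simp

theorem rotZ_eq_su2' (φ α : ℝ) : rotZ α = su2 φ (Real.cos α) (Real.sin α) := by
  rw [rotZ_eq, su2, exp_ofReal_mul_I_eq, exp_neg_ofReal_mul_I_eq]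
  ext i j
  fin_cases i <;> fin_cases j <;>
    simp [-ofReal_cos, -ofReal_sin, Complex.cos_ofReal_re, Complex.sin_ofReal_re] <;> ring

/-- The action on (A, B) is a real plane rotation, the same in every frame φ; this keeps polynomial
coefficients real and words independent of φ. -/
theorem rotZ_mul_su2 (α φ : ℝ) (A B : ℂ) :
    rotZ α * su2 φ A B =
      su2 φ (Real.cos α * A - Real.sin α * B) (Real.sin α * A + Real.cos α * B) := by
  rw [rotZ_eq, su2, su2, exp_ofReal_mul_I_eq, exp_neg_ofReal_mul_I_eq]
  ext i j
  fin_cases i <;> fin_cases j <;>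
    simp [Matrix.mul_apply, Fin.sum_univ_two, -ofReal_cos, -ofReal_sin, Complex.cos_ofReal_re,
      Complex.sin_ofReal_re]
  · linear_combination ((Real.sin α : ℂ) * B.re) * I_sq
  · linear_combination ((Real.sin α : ℂ) * A.im * exp (φ * I)) * I_sq
  · linear_combination (-(Real.sin α : ℂ) * A.im * exp (-(φ * I))) * I_sq
  · linear_combination ((Real.sin α : ℂ) * B.re) * I_sq

/-- In the frame of its own axis the call is diagonal: the B-directions anticommute with the axis
and so pick up the conjugate phase. -/
theorem twisted_mul_su2 (φ θ : ℝ) (A B : ℂ) :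
    twisted φ θ * su2 φ A B = su2 φ (exp (θ * I) * A) (exp (-(θ * I)) * B) := by
  have h := exp_mul_exp_neg (φ * I)
  rw [twisted_eq_su2, su2, su2, su2, exp_ofReal_mul_I_eq θ, exp_neg_ofReal_mul_I_eq θ]
  ext i j
  fin_cases i <;> fin_cases j <;>
    simp [Matrix.mul_apply, Fin.sum_univ_two, -ofReal_cos, -ofReal_sin, Complex.cos_ofReal_re,
      Complex.sin_ofReal_re]
  · linear_combination ((Real.sin θ : ℂ) * I * (I * A.im + B.im)) * h + ((Real.sin θ : ℂ) * A.im) * I_sq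
  · linear_combination (-(Real.sin θ : ℂ) * B.re * exp (φ * I)) * I_sq
  · linear_combination ((Real.sin θ : ℂ) * B.re * exp (-(φ * I))) * I_sq
  · linear_combination ((Real.sin θ : ℂ) * I * (I * A.im - B.im)) * h + ((Real.sin θ : ℂ) * A.im) * I_sq

theorem axis_eq_su2 (φ : ℝ) : axis φ = (-I) • su2 φ I 0 := by
  ext i j
  fin_cases i <;> fin_cases j <;> simp [axis, su2, ← mul_assoc]

theorem axis_mul_self (φ : ℝ) : axis φ * axis φ = 1 := by
  have h := exp_mul_exp_neg (φ * I)
  ext i j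
  fin_cases i <;> fin_cases j <;> simp [axis, Matrix.mul_apply, Fin.sum_univ_two]
  · exact h
  · rw [mul_comm]
    exact h

theorem twisted_eq (φ θ : ℝ) :
    twisted φ θ = (Real.cos θ : ℂ) • (1 : Matrix (Fin 2) (Fin 2) ℂ) +
      (I * Real.sin θ) • axis φ := by
  rw [twisted_eq_su2, su2, exp_ofReal_mul_I_eq θ, axis]
  ext i j
  fin_cases i <;> fin_cases j <;>
    simp [-ofReal_cos, -ofReal_sin, Complex.cos_ofReal_re, Complex.sin_ofReal_re]

theorem rotX_eq_smul (θ : ℝ) :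
    rotX θ = (Real.cos θ : ℂ) • (1 : Matrix (Fin 2) (Fin 2) ℂ) +
      (I * Real.sin θ) • sigmaX := by
  rw [rotX_eq, sigmaX]
  ext i j
  fin_cases i <;> fin_cases j <;> simp [-ofReal_cos, -ofReal_sin]

theorem sigmaZ_mul_axis (φ : ℝ) : sigmaZ * axis φ = -(axis φ * sigmaZ) := by
  ext i j
  fin_cases i <;> fin_cases j <;> simp [axis, sigmaZ, Matrix.mul_apply, Fin.sum_univ_two]

theorem sigmaZ_mul_self : sigmaZ * sigmaZ = 1 := by
  ext i j
  fin_cases i <;> fin_cases j <;> simp [sigmaZ, Matrix.mul_apply, Fin.sum_univ_two]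

theorem sigmaX_mul_self : sigmaX * sigmaX = 1 := by
  ext i j
  fin_cases i <;> fin_cases j <;> simp [sigmaX, Matrix.mul_apply, Fin.sum_univ_two]

theorem star_sigmaX : star sigmaX = sigmaX := by
  ext i j
  fin_cases i <;> fin_cases j <;> simp [sigmaX, Matrix.star_eq_conjTranspose]

theorem star_sigmaZ : star sigmaZ = sigmaZ := by
  ext i j
  fin_cases i <;> fin_cases j <;> simp [sigmaZ, Matrix.star_eq_conjTranspose]

theorem star_hadamard : star hadamard = hadamard := by
  ext i j
  fin_cases i <;> fin_cases j <;> simp [hadamard, Matrix.star_eq_conjTranspose]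

theorem star_axis (φ : ℝ) : star (axis φ) = axis φ := by
  ext i j
  fin_cases i <;> fin_cases j <;> simp [axis, Matrix.star_eq_conjTranspose,
    conj_exp_ofReal_mul_I, conj_exp_neg_ofReal_mul_I]

theorem mem_unitary_of_star_eq_of_mul_self {R : Type*} [Monoid R] [StarMul R] {a : R}
    (h1 : star a = a) (h2 : a * a = 1) : a ∈ unitary R := by
  rw [Unitary.mem_iff, h1]
  exact ⟨h2, h2⟩

end

end Correction

namespace Correction

open Polynomial

set_option linter.unusedSimpArgs false

noncomputable section

/-! ### The Fejér–Riesz theorem with real coefficients -/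

/-- The trigonometric polynomial `t (cos ψ)` is the squared modulus on the unit circle of a real
polynomial, whose degree is not larger. -/
def IsNormSq (t : ℝ[X]) : Prop :=
  ∃ b : ℝ[X], b.natDegree ≤ t.natDegree ∧
    ∀ ψ : ℝ, t.eval (Real.cos ψ) = ‖aeval (Complex.exp (ψ * Complex.I)) b‖ ^ 2

theorem IsNormSq.mul {s t : ℝ[X]} (hs : IsNormSq s) (ht : IsNormSq t) (hs0 : s ≠ 0)
    (ht0 : t ≠ 0) : IsNormSq (s * t) := by
  obtain ⟨b, hb, hb'⟩ := hs
  obtain ⟨c, hc, hc'⟩ := ht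
  refine ⟨b * c, ?_, fun ψ => ?_⟩
  · rw [natDegree_mul hs0 ht0]
    exact natDegree_mul_le.trans (add_le_add hb hc)
  · rw [eval_mul, hb', hc', map_mul, norm_mul, mul_pow]

theorem isNormSq_C {c : ℝ} (hc : 0 ≤ c) : IsNormSq (C c) := by
  refine ⟨C √c, by simp, fun ψ => ?_⟩
  rw [aeval_C, eval_C, Complex.coe_algebraMap, Complex.norm_real, Real.norm_eq_abs, sq_abs,
    Real.sq_sqrt hc]

/-- The Joukowski substitution ζ = (ρ + ρ⁻¹)/2, which turns factors in cos ψ into factors in e^{iψ}.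
-/
theorem exists_add_inv_eq (ζ : ℂ) : ∃ ρ : ℂ, ρ ≠ 0 ∧ ρ ^ 2 + 1 = 2 * ζ * ρ := by
  obtain ⟨s, hs⟩ := IsAlgClosed.exists_pow_nat_eq (ζ ^ 2 - 1) (n := 2) (by norm_num)
  have h : (ζ + s) ^ 2 + 1 = 2 * ζ * (ζ + s) := by linear_combination hs
  refine ⟨ζ + s, fun h0 => ?_, h⟩
  rw [h0] at h
  norm_num at h

theorem natDegree_quadratic_monic (b c : ℝ) : (X ^ 2 - C b * X + C c : ℝ[X]).natDegree = 2 := by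
  compute_degree!

theorem norm_one_sub_mul_conj (ρ : ℂ) (ψ : ℝ) :
    ‖1 - (starRingEnd ℂ) ρ * Complex.exp (ψ * Complex.I)‖ =
      ‖1 - ρ * Complex.exp (-(ψ * Complex.I))‖ := by
  rw [← Complex.norm_conj, map_sub, map_mul, Complex.conj_conj, conj_exp_ofReal_mul_I, map_one]

/-- With ζ = (ρ + ρ⁻¹)/2 and w = e^{iψ}, the factor cos ψ - ζ equals -(1 - ρw)(1 - ρw̄)/(2ρ).
Replacing 1 - ρw̄ by 1 - ρ̄w keeps the modulus and makes the product a polynomial in w with real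
coefficients. -/
theorem isNormSq_quadratic (ζ : ℂ) :
    IsNormSq (X ^ 2 - C (2 * ζ.re) * X + C (‖ζ‖ ^ 2)) := by
  obtain ⟨ρ, h0, hρ⟩ := exists_add_inv_eq ζ
  have hn : ‖ρ‖ ≠ 0 := norm_ne_zero_iff.2 h0
  refine ⟨C (2 * ‖ρ‖)⁻¹ * (C 1 - C (2 * ρ.re) * X + C (‖ρ‖ ^ 2) * X ^ 2), ?_, fun ψ => ?_⟩
  · rw [natDegree_quadratic_monic]
    compute_degree
  · set w := Complex.exp (ψ * Complex.I) with hw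
    have hww : w * Complex.exp (-(ψ * Complex.I)) = 1 := exp_mul_exp_neg _
    have hcos : 2 * (Real.cos ψ : ℂ) = w + Complex.exp (-(ψ * Complex.I)) := by
      rw [hw, exp_ofReal_mul_I_eq, exp_neg_ofReal_mul_I_eq]
      ring
    have e1 : (X ^ 2 - C (2 * ζ.re) * X + C (‖ζ‖ ^ 2)).eval (Real.cos ψ) =
        ‖(Real.cos ψ : ℂ) - ζ‖ ^ 2 := by
      rw [Complex.sq_norm, Complex.normSq_apply]
      simp only [eval_add, eval_sub, eval_pow, eval_X, eval_mul, eval_C, Complex.sub_re,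
        Complex.sub_im, Complex.ofReal_re, Complex.ofReal_im, Complex.sq_norm,
        Complex.normSq_apply]
      ring
    have e2 : (1 - ρ * w) * (1 - ρ * Complex.exp (-(ψ * Complex.I))) =
        -2 * ρ * ((Real.cos ψ : ℂ) - ζ) := by
      linear_combination ρ ^ 2 * hww + ρ * hcos + hρ
    have e3 : aeval w (C (2 * ‖ρ‖)⁻¹ * (C 1 - C (2 * ρ.re) * X + C (‖ρ‖ ^ 2) * X ^ 2)) =
        (((2 * ‖ρ‖)⁻¹ : ℝ) : ℂ) * ((1 - ρ * w) * (1 - (starRingEnd ℂ) ρ * w)) := by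
      simp only [map_mul, map_add, map_sub, map_pow, aeval_C, aeval_X, Complex.coe_algebraMap]
      have r1 := Complex.add_conj ρ
      have r2 : ρ * (starRingEnd ℂ) ρ = ((‖ρ‖ : ℝ) : ℂ) ^ 2 := Complex.mul_conj' ρ
      push_cast at r1 ⊢
      linear_combination (((2 * (‖ρ‖ : ℂ))⁻¹ : ℂ)) * w * r1 - (((2 * (‖ρ‖ : ℂ))⁻¹ : ℂ)) * w ^ 2 * r2
    have e4 : ‖aeval w (C (2 * ‖ρ‖)⁻¹ * (C 1 - C (2 * ρ.re) * X + C (‖ρ‖ ^ 2) * X ^ 2))‖ =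
        ‖(Real.cos ψ : ℂ) - ζ‖ := by
      rw [e3, norm_mul, norm_mul, norm_one_sub_mul_conj, ← norm_mul, e2, norm_mul, norm_mul,
        Complex.norm_real, Real.norm_eq_abs, abs_of_nonneg (by positivity)]
      norm_num
      field_simp
    rw [e1, e4]

/-- For r = (ρ + ρ⁻¹)/2 and s = ±1, the squared modulus of 1 - sρe^{iψ} is 2ρ(r - s cos ψ). -/
theorem isNormSq_linear {r : ℝ} (hr : 1 ≤ r) (s : ℝ) (hs : s ^ 2 = 1) :
    IsNormSq (C r - C s * X) := by
  have h1 : 0 ≤ r ^ 2 - 1 := by nlinarith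
  set ρ := r + √(r ^ 2 - 1) with hρ
  have hpos : 0 < ρ := by positivity
  have hs2 : ρ ^ 2 + 1 = 2 * r * ρ := by
    rw [hρ]
    linear_combination Real.sq_sqrt h1
  have hs0 : s ≠ 0 := by
    rintro rfl
    norm_num at hs
  refine ⟨C (√(2 * ρ))⁻¹ * (C 1 - C (s * ρ) * X), ?_, fun ψ => ?_⟩
  · have : (C r - C s * X).natDegree = 1 := by
      have : C r - C s * X = C (-s) * X + C r := by simp; ring
      rw [this]
      exact natDegree_linear (neg_ne_zero.2 hs0)
    rw [this]
    compute_degree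
  · have hm : ‖(1 : ℂ) - ((s * ρ : ℝ) : ℂ) * Complex.exp (ψ * Complex.I)‖ ^ 2 =
        2 * ρ * (r - s * Real.cos ψ) := by
      rw [exp_ofReal_mul_I_eq, Complex.sq_norm, Complex.normSq_apply]
      simp [-Complex.ofReal_cos, -Complex.ofReal_sin, Complex.cos_ofReal_re,
        Complex.sin_ofReal_re]
      linear_combination s ^ 2 * ρ ^ 2 * Real.sin_sq_add_cos_sq ψ + ρ ^ 2 * hs + hs2
    simp only [map_mul, map_sub, aeval_C, aeval_X, Complex.coe_algebraMap, eval_sub, eval_mul,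
      eval_C, eval_X, norm_mul, mul_pow, Complex.norm_real, Real.norm_eq_abs, sq_abs, inv_pow,
      Complex.ofReal_one, map_one] at hm ⊢
    rw [Real.sq_sqrt (by positivity)]
    rw [Complex.ofReal_mul] at hm
    rw [hm]
    field_simp

/-- Continuity recovers the sign at r; this is needed for a cofactor, whose sign is known only where
the factor split off does not vanish. -/
theorem eval_nonneg_of_ne {p : ℝ[X]} {r : ℝ}
    (h : ∀ x ∈ Set.Icc (-1 : ℝ) 1, x ≠ r → 0 ≤ p.eval x) :
    ∀ x ∈ Set.Icc (-1 : ℝ) 1, 0 ≤ p.eval x := by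
  intro x hx
  by_contra! hneg
  have hopen : IsOpen {y : ℝ | p.eval y < 0} := isOpen_lt p.continuous continuous_const
  obtain ⟨e, he, hball⟩ := Metric.isOpen_iff.1 hopen x hneg
  have hinf : (Set.Icc (max (-1) (x - e / 2)) (min 1 (x + e / 2))).Infinite := by
    apply Set.Icc_infinite
    obtain ⟨h1, h2⟩ := hx
    apply max_lt <;> apply lt_min <;> linarith
  obtain ⟨y, hy, hyr⟩ := hinf.exists_notMem_finset {r}
  rw [Finset.mem_singleton] at hyr
  obtain ⟨hy1, hy2⟩ := hy
  rw [max_le_iff] at hy1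
  rw [le_min_iff] at hy2
  have h3 : y ∈ Metric.ball x e := by
    rw [Metric.mem_ball, Real.dist_eq, abs_lt]
    constructor <;> linarith
  have h4 : p.eval y < 0 := hball h3
  exact absurd (h y ⟨hy1.1, hy2.1⟩ hyr) (not_le.2 h4)

theorem natDegree_factor_lt {s t u : ℝ[X]} (h : t = s * u) (ht : t ≠ 0) (hs : 0 < s.natDegree) :
    u.natDegree < t.natDegree := by
  subst h
  rw [natDegree_mul (left_ne_zero_of_mul ht) (right_ne_zero_of_mul ht)]
  omega

/-- Strong induction on the degree, splitting off the factor of one complex root: a conjugate pair,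
a real root outside (-1, 1), or a root inside (-1, 1), which must be at least double. Each factor is
nonnegative on [-1, 1], hence so is the cofactor. -/
theorem isNormSq_of_nonneg (t : ℝ[X]) (ht : ∀ x ∈ Set.Icc (-1 : ℝ) 1, 0 ≤ t.eval x) :
    IsNormSq t := by
  induction hn : t.natDegree using Nat.strong_induction_on generalizing t with
  | _ n ih =>
  have key : ∀ s u : ℝ[X], t = s * u → t ≠ 0 → 0 < s.natDegree → IsNormSq s →
      (∀ x ∈ Set.Icc (-1 : ℝ) 1, 0 ≤ u.eval x) → IsNormSq t := by
    intro s u hsu ht0 hs hsn hu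
    have hlt := natDegree_factor_lt hsu ht0 hs
    have hun := ih _ (hn ▸ hlt) u hu rfl
    rw [hsu] at ht0 ⊢
    exact hsn.mul hun (left_ne_zero_of_mul ht0) (right_ne_zero_of_mul ht0)
  rcases Nat.eq_zero_or_pos n with h0 | hpos
  · rw [h0] at hn
    rw [eq_C_of_natDegree_eq_zero hn] at ht ⊢
    refine isNormSq_C ?_
    simpa using ht 0 (by norm_num)
  have ht0 : t ≠ 0 := by
    rintro rfl
    simp at hn
    omega
  obtain ⟨ζ, hζ⟩ : ∃ ζ : ℂ, aeval ζ t = 0 := by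
    apply IsAlgClosed.exists_aeval_eq_zero
    rw [degree_eq_natDegree ht0, hn]
    exact_mod_cast hpos.ne'
  have quad : (X ^ 2 - C (2 * ζ.re) * X + C (‖ζ‖ ^ 2)) ∣ t → IsNormSq t := by
    rintro ⟨u, hu⟩
    have hq : ∀ x : ℝ, (X ^ 2 - C (2 * ζ.re) * X + C (‖ζ‖ ^ 2)).eval x =
        (x - ζ.re) ^ 2 + ζ.im ^ 2 := by
      intro x
      simp [Complex.sq_norm, Complex.normSq_apply]
      ring
    refine key _ u hu ht0 (by rw [natDegree_quadratic_monic]; norm_num) (isNormSq_quadratic ζ) ?_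
    refine eval_nonneg_of_ne (r := ζ.re) fun x hx hne => ?_
    have h1 := ht x hx
    rw [hu, eval_mul, hq] at h1
    refine nonneg_of_mul_nonneg_right h1 ?_
    have := pow_pos (abs_pos.2 (sub_ne_zero.2 hne)) 2
    rw [sq_abs] at this
    positivity
  by_cases him : ζ.im = 0
  · obtain ⟨r, rfl⟩ : ∃ r : ℝ, ζ = r := ⟨ζ.re, by apply Complex.ext <;> simp [him]⟩
    have hr : t.eval r = 0 := by
      rw [← Complex.coe_algebraMap, aeval_algebraMap_apply] at hζ
      simpa using hζ
    obtain ⟨u, hu⟩ := dvd_iff_isRoot.2 hr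
    have hev : ∀ x, t.eval x = (x - r) * u.eval x := by
      intro x
      conv_lhs => rw [hu]
      simp
    rcases le_or_gt 1 r with h1 | h1
    · refine key (C r - C 1 * X) (-u) ?_ ht0 ?_ (isNormSq_linear h1 1 (by norm_num)) ?_
      · rw [hu, C_1]
        ring
      · have : (C r - C 1 * X : ℝ[X]) = C (-1) * X + C r := by simp; ring
        rw [this, natDegree_linear (by norm_num)]
        norm_num
      · refine eval_nonneg_of_ne (r := 1) fun x hx hne => ?_
        have h2 := ht x hx
        rw [hev] at h2
        have h3 : x - r < 0 := by
          have := lt_of_le_of_ne hx.2 hne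
          linarith
        rw [eval_neg]
        nlinarith
    rcases le_or_gt r (-1) with h2 | h2
    · refine key (C (-r) - C (-1) * X) u ?_ ht0 ?_
        (isNormSq_linear (by linarith) (-1) (by norm_num)) ?_
      · rw [hu]
        simp
        left
        ring
      · have : (C (-r) - C (-1) * X : ℝ[X]) = C 1 * X + C (-r) := by simp; ring
        rw [this, natDegree_linear (by norm_num)]
        norm_num
      · refine eval_nonneg_of_ne (r := -1) fun x hx hne => ?_
        have h3 := ht x hx
        rw [hev] at h3
        have h4 : 0 < x - r := by
          have := lt_of_le_of_ne hx.1 (Ne.symm hne)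
          linarith
        exact nonneg_of_mul_nonneg_right h3 h4
    · apply quad
      -- If the cofactor did not vanish at the interior root r, then t would change sign there.
      have hur : u.eval r = 0 := by
        have hc : ContinuousAt (fun x => u.eval x) r := u.continuous.continuousAt
        by_contra hne
        rcases lt_or_gt_of_ne hne with hlt | hgt
        · have hev1 : ∀ᶠ x in nhds r, u.eval x < 0 := hc.eventually_lt continuousAt_const hlt
          have hev2 : ∀ᶠ x in nhdsWithin r (Set.Ioi r), u.eval x < 0 ∧ x < 1 :=
            (hev1.and (eventually_lt_nhds h1)).filter_mono nhdsWithin_le_nhds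
          obtain ⟨x, ⟨hx1, hx2⟩, hx3⟩ := (hev2.and self_mem_nhdsWithin).exists
          have := ht x ⟨by linarith [hx3], hx2.le⟩
          rw [hev] at this
          nlinarith [hx3]
        · have hev1 : ∀ᶠ x in nhds r, 0 < u.eval x := continuousAt_const.eventually_lt hc hgt
          have hev2 : ∀ᶠ x in nhdsWithin r (Set.Iio r), 0 < u.eval x ∧ -1 < x :=
            (hev1.and (eventually_gt_nhds h2)).filter_mono nhdsWithin_le_nhds
          obtain ⟨x, ⟨hx1, hx2⟩, hx3⟩ := (hev2.and self_mem_nhdsWithin).exists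
          have := ht x ⟨hx2.le, by linarith [hx3]⟩
          rw [hev] at this
          nlinarith [hx3]
      obtain ⟨v, hv⟩ := dvd_iff_isRoot.2 hur
      refine ⟨v, ?_⟩
      rw [hu, hv]
      simp only [Complex.ofReal_re, Complex.norm_real, Real.norm_eq_abs, sq_abs, C_mul, C_pow]
      have : (C (2 : ℝ) : ℝ[X]) = 2 := map_ofNat C 2
      rw [this]
      ring
  · exact quad (quadratic_dvd_of_aeval_eq_zero_im_ne_zero t hζ him)

/-- The squared modulus of a real polynomial on the unit circle is a polynomial in `cos ψ`. -/
theorem exists_eval_cos_eq_norm_sq (a : ℝ[X]) :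
    ∃ t : ℝ[X], t.natDegree ≤ a.natDegree ∧
      ∀ ψ : ℝ, t.eval (Real.cos ψ) = ‖aeval (Complex.exp (ψ * Complex.I)) a‖ ^ 2 := by
  set d := a.natDegree with hd
  refine ⟨∑ j ∈ Finset.range (d + 1), ∑ k ∈ Finset.range (d + 1),
    C (a.coeff j * a.coeff k) * Chebyshev.T ℝ ((j : ℤ) - k), ?_, fun ψ => ?_⟩
  · refine natDegree_sum_le_of_forall_le _ _ fun j hj => ?_
    refine natDegree_sum_le_of_forall_le _ _ fun k hk => ?_
    refine (natDegree_C_mul_le _ _).trans ?_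
    rw [Chebyshev.natDegree_T]
    simp only [Finset.mem_range] at hj hk
    omega
  · have h1 : aeval (Complex.exp (ψ * Complex.I)) a =
        ∑ j ∈ Finset.range (d + 1), (a.coeff j : ℂ) * Complex.exp (((j * ψ : ℝ) : ℂ) * Complex.I) := by
      rw [aeval_eq_sum_range]
      refine Finset.sum_congr rfl fun j _ => ?_
      rw [← Complex.exp_nat_mul, Complex.real_smul]
      congr 2
      push_cast
      ring
    have hre : (aeval (Complex.exp (ψ * Complex.I)) a).re =
        ∑ j ∈ Finset.range (d + 1), a.coeff j * Real.cos (j * ψ) := by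
      rw [h1, Complex.re_sum]
      refine Finset.sum_congr rfl fun j _ => ?_
      rw [Complex.re_ofReal_mul, Complex.exp_ofReal_mul_I_re]
    have him : (aeval (Complex.exp (ψ * Complex.I)) a).im =
        ∑ j ∈ Finset.range (d + 1), a.coeff j * Real.sin (j * ψ) := by
      rw [h1, Complex.im_sum]
      refine Finset.sum_congr rfl fun j _ => ?_
      rw [Complex.im_ofReal_mul, Complex.exp_ofReal_mul_I_im]
    rw [Complex.sq_norm, Complex.normSq_apply, hre, him, Finset.sum_mul_sum, Finset.sum_mul_sum,
      ← Finset.sum_add_distrib, eval_finsetSum]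
    refine Finset.sum_congr rfl fun j _ => ?_
    rw [← Finset.sum_add_distrib, eval_finsetSum]
    refine Finset.sum_congr rfl fun k _ => ?_
    rw [eval_mul, eval_C, Chebyshev.T_real_cos]
    have : (((j : ℤ) - k : ℤ) : ℝ) * ψ = j * ψ - k * ψ := by push_cast; ring
    rw [this, Real.cos_sub]
    ring

/-- A real polynomial that is bounded by `1` on the unit circle has a complement there. -/
theorem exists_complement (a : ℝ[X])
    (ha : ∀ ψ : ℝ, ‖aeval (Complex.exp (ψ * Complex.I)) a‖ ≤ 1) :
    ∃ b : ℝ[X], b.natDegree ≤ a.natDegree ∧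
      ∀ ψ : ℝ, ‖aeval (Complex.exp (ψ * Complex.I)) a‖ ^ 2 +
        ‖aeval (Complex.exp (ψ * Complex.I)) b‖ ^ 2 = 1 := by
  obtain ⟨t, ht, hta⟩ := exists_eval_cos_eq_norm_sq a
  obtain ⟨b, hb, hbt⟩ := isNormSq_of_nonneg (1 - t) fun x hx => by
    have h1 : Real.cos (Real.arccos x) = x := Real.cos_arccos hx.1 hx.2
    rw [eval_sub, eval_one, ← h1, hta, sub_nonneg]
    exact pow_le_one₀ (norm_nonneg _) (ha _)
  refine ⟨b, hb.trans ((natDegree_sub_le _ _).trans (by simpa using ht)), fun ψ => ?_⟩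
  rw [← hbt, ← hta, eval_sub, eval_one]
  ring

end

end Correction

namespace Correction

open Polynomial

set_option linter.unusedSimpArgs false

noncomputable section

/-! ### Quantum signal processing -/

/-- Calls to `M`, interleaved with `z`-rotations by the given angles. -/
def qspWord (α : ℝ) (l : List ℝ) (M : Matrix (Fin 2) (Fin 2) ℂ) : Matrix (Fin 2) (Fin 2) ℂ :=
  l.foldl (fun N β => rotZ β * M * N) (rotZ α)

theorem qspWord_append_singleton (α : ℝ) (l : List ℝ) (β : ℝ) (M : Matrix (Fin 2) (Fin 2) ℂ) :
    qspWord α (l ++ [β]) M = rotZ β * M * qspWord α l M := by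
  simp [qspWord]

/-- On the circle the conjugate of w is w⁻¹, so conjugating a real polynomial and multiplying by w^d
reverses its coefficients. -/
theorem aeval_reflect_circle {a : ℝ[X]} {d : ℕ} (ha : a.natDegree ≤ d) (ψ : ℝ) :
    aeval (Complex.exp (ψ * Complex.I)) (reflect d a) =
      Complex.exp (ψ * Complex.I) ^ d *
        (starRingEnd ℂ) (aeval (Complex.exp (ψ * Complex.I)) a) := by
  have h1 := exp_mul_exp_neg (ψ * Complex.I)
  let _ : Invertible (Complex.exp (-(ψ * Complex.I))) := ⟨Complex.exp (ψ * Complex.I), h1, by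
    rw [mul_comm]
    exact h1⟩
  have h2 := eval₂_reflect_mul_pow (algebraMap ℝ ℂ) (Complex.exp (-(ψ * Complex.I))) d a ha
  have h3 : ⅟(Complex.exp (-(ψ * Complex.I))) = Complex.exp (ψ * Complex.I) := rfl
  rw [h3, ← aeval_def, ← aeval_def] at h2
  have h4 : (starRingEnd ℂ) (aeval (Complex.exp (ψ * Complex.I)) a) =
      aeval (Complex.exp (-(ψ * Complex.I))) a := by
    rw [← conj_exp_ofReal_mul_I, aeval_conj]
  rw [h4, ← h2]
  have h5 : Complex.exp (ψ * Complex.I) ^ d * Complex.exp (-(ψ * Complex.I)) ^ d = 1 := by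
    rw [← mul_pow, h1, one_pow]
  linear_combination (-aeval (Complex.exp (ψ * Complex.I)) (reflect d a)) * h5

theorem eq_zero_of_aeval_circle {p : ℝ[X]}
    (h : ∀ ψ : ℝ, aeval (Complex.exp (ψ * Complex.I)) p = 0) : p = 0 := by
  have hmap : p.map (algebraMap ℝ ℂ) = 0 := by
    refine eq_zero_of_infinite_isRoot _ ?_
    have hinj : Set.InjOn (fun ψ : ℝ => Complex.exp (ψ * Complex.I)) (Set.Icc 0 Real.pi) := by
      intro x hx y hy hxy
      refine Real.injOn_cos hx hy ?_
      have := congrArg Complex.re hxy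
      simpa [Complex.exp_ofReal_mul_I_re] using this
    refine ((Set.Icc_infinite Real.pi_pos).image hinj).mono ?_
    rintro _ ⟨ψ, -, rfl⟩
    change IsRoot _ _
    rw [IsRoot, eval_map_algebraMap]
    exact h ψ
  exact (Polynomial.map_eq_zero_iff (algebraMap ℝ ℂ).injective).1 hmap

/-- Multiplied by w^d, the normalization becomes the polynomial identity a a* + b b* = X^d, with *
the coefficient reversal; its constant coefficient vanishes for d ≠ 0. -/
theorem coeff_mul_add_eq_zero {a b : ℝ[X]} {d : ℕ} (hd : d ≠ 0) (ha : a.natDegree ≤ d)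
    (hb : b.natDegree ≤ d)
    (h : ∀ ψ : ℝ, ‖aeval (Complex.exp (ψ * Complex.I)) a‖ ^ 2 +
      ‖aeval (Complex.exp (ψ * Complex.I)) b‖ ^ 2 = 1) :
    a.coeff 0 * a.coeff d + b.coeff 0 * b.coeff d = 0 := by
  have h0 : a * reflect d a + b * reflect d b - X ^ d = 0 := by
    refine eq_zero_of_aeval_circle fun ψ => ?_
    have h1 := congrArg (fun x : ℝ => (x : ℂ)) (h ψ)
    simp only [Complex.ofReal_add, Complex.ofReal_pow, Complex.ofReal_one, ← Complex.mul_conj'] at h1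
    rw [map_sub, map_add, map_mul, map_mul, aeval_reflect_circle ha, aeval_reflect_circle hb,
      map_pow, aeval_X]
    linear_combination (Complex.exp (ψ * Complex.I)) ^ d * h1
  have h1 := congrArg (fun p => coeff p 0) h0
  simpa [mul_coeff_zero, coeff_reflect, revAt_zero, hd.symm] using h1

theorem exists_cos_sin_eq {c s : ℝ} (h : c ^ 2 + s ^ 2 = 1) :
    ∃ α : ℝ, Real.cos α = c ∧ Real.sin α = s := by
  have hn : ‖(⟨c, s⟩ : ℂ)‖ = 1 := by
    rw [Complex.norm_def, Complex.normSq_mk, ← sq, ← sq, h, Real.sqrt_one]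
  have := Complex.norm_mul_exp_arg_mul_I ⟨c, s⟩
  rw [hn, Complex.ofReal_one, one_mul] at this
  refine ⟨Complex.arg ⟨c, s⟩, ?_, ?_⟩
  · rw [← Complex.exp_ofReal_mul_I_re, this]
  · rw [← Complex.exp_ofReal_mul_I_im, this]

/-- The direction (cos α, sin α) must be orthogonal to (x, y) and parallel to (u, v). In the plane
the hypothesis makes these compatible, and whichever vector is nonzero determines the direction. -/
theorem exists_rotation {x y u v : ℝ} (h : x * u + y * v = 0) :
    ∃ α : ℝ, Real.cos α * x + Real.sin α * y = 0 ∧ Real.cos α * v - Real.sin α * u = 0 := by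
  have norm_sq : ∀ p q : ℝ, p ^ 2 + q ^ 2 ≠ 0 →
      (p / √(p ^ 2 + q ^ 2)) ^ 2 + (q / √(p ^ 2 + q ^ 2)) ^ 2 = 1 := by
    intro p q hpq
    rw [div_pow, div_pow, Real.sq_sqrt (by positivity), ← add_div, div_self hpq]
  by_cases h1 : y ^ 2 + (-x) ^ 2 = 0
  · have hx : x = 0 := by nlinarith [sq_nonneg x, sq_nonneg y]
    have hy : y = 0 := by nlinarith [sq_nonneg x, sq_nonneg y]
    subst hx hy
    by_cases h2 : u ^ 2 + v ^ 2 = 0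
    · have hu : u = 0 := by nlinarith [sq_nonneg u, sq_nonneg v]
      have hv : v = 0 := by nlinarith [sq_nonneg u, sq_nonneg v]
      exact ⟨0, by simp, by simp [hu, hv]⟩
    · obtain ⟨α, h3, h4⟩ := exists_cos_sin_eq (norm_sq u v h2)
      refine ⟨α, by simp, ?_⟩
      rw [h3, h4]
      ring
  · obtain ⟨α, h3, h4⟩ := exists_cos_sin_eq (norm_sq y (-x) h1)
    refine ⟨α, ?_, ?_⟩
    · rw [h3, h4]
      ring
    · rw [h3, h4]
      linear_combination h / √(y ^ 2 + (-x) ^ 2)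

theorem norm_sq_rotation (α : ℝ) (A B : ℂ) :
    ‖(Real.cos α : ℂ) * A + Real.sin α * B‖ ^ 2 + ‖(Real.cos α : ℂ) * B - Real.sin α * A‖ ^ 2 =
      ‖A‖ ^ 2 + ‖B‖ ^ 2 := by
  have h := Real.sin_sq_add_cos_sq α
  simp only [Complex.sq_norm, Complex.normSq_apply, Complex.add_re, Complex.add_im,
    Complex.sub_re, Complex.sub_im, Complex.re_ofReal_mul, Complex.im_ofReal_mul]
  linear_combination (A.re ^ 2 + A.im ^ 2 + B.re ^ 2 + B.im ^ 2) * h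

/-- Induction on d, removing the last rotation and call. The orthogonality of the extreme
coefficients provides an angle after which both polynomials lose one degree: one is divisible by X,
the other has no top term. -/
theorem exists_qspWord (d : ℕ) (a b : ℝ[X]) (ha : a.natDegree ≤ d) (hb : b.natDegree ≤ d)
    (h : ∀ ψ : ℝ, ‖aeval (Complex.exp (ψ * Complex.I)) a‖ ^ 2 +
      ‖aeval (Complex.exp (ψ * Complex.I)) b‖ ^ 2 = 1) :
    ∃ (α : ℝ) (l : List ℝ), l.length = d ∧ ∀ φ θ : ℝ, qspWord α l (twisted φ θ) =
      su2 φ (Complex.exp (-(θ * Complex.I)) ^ d *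
          aeval (Complex.exp (((2 * θ : ℝ) : ℂ) * Complex.I)) a)
        (Complex.exp (-(θ * Complex.I)) ^ d *
          aeval (Complex.exp (((2 * θ : ℝ) : ℂ) * Complex.I)) b) := by
  induction d generalizing a b with
  | zero =>
    rw [eq_C_of_natDegree_le_zero ha, eq_C_of_natDegree_le_zero hb] at h ⊢
    simp only [aeval_C, Complex.coe_algebraMap, Complex.norm_real, Real.norm_eq_abs, sq_abs,
      forall_const] at h
    obtain ⟨α, h1, h2⟩ := exists_cos_sin_eq h
    refine ⟨α, [], rfl, fun φ θ => ?_⟩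
    rw [qspWord, List.foldl_nil, rotZ_eq_su2' φ, h1, h2]
    simp
  | succ d ih =>
    obtain ⟨α, h1, h2⟩ := exists_rotation (coeff_mul_add_eq_zero d.succ_ne_zero ha hb h)
    set a' := C (Real.cos α) * a + C (Real.sin α) * b with ha'
    set b' := C (Real.cos α) * b - C (Real.sin α) * a with hb'
    have hda' : a'.natDegree ≤ d + 1 :=
      (natDegree_add_le _ _).trans (max_le ((natDegree_C_mul_le _ _).trans ha)
        ((natDegree_C_mul_le _ _).trans hb))
    have hdb' : b'.natDegree ≤ d + 1 :=
      (natDegree_sub_le _ _).trans (max_le ((natDegree_C_mul_le _ _).trans hb)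
        ((natDegree_C_mul_le _ _).trans ha))
    have ha0 : a'.coeff 0 = 0 := by
      rw [ha', coeff_add, coeff_C_mul, coeff_C_mul, h1]
    have hb0 : b'.coeff (d + 1) = 0 := by
      rw [hb', coeff_sub, coeff_C_mul, coeff_C_mul, h2]
    -- Dividing by X absorbs the phase e^{2iθ} between the e^{iθ} on the first component and the
    -- e^{-iθ} on the second.
    have haX : a' = X * a'.divX := by
      conv_lhs => rw [← X_mul_divX_add a', ha0]
      simp
    have hdb : b'.natDegree ≤ d := by
      rw [natDegree_le_iff_coeff_eq_zero] at hdb' ⊢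
      intro N hN
      rcases Nat.lt_or_ge (d + 1) N with hlt | hge
      · exact hdb' N hlt
      · rw [show N = d + 1 by omega, hb0]
    have hrot : ∀ w : ℂ, aeval w a = Real.cos α * aeval w a' - Real.sin α * aeval w b' ∧
        aeval w b = Real.sin α * aeval w a' + Real.cos α * aeval w b' := by
      intro w
      have h3 : (Real.sin α : ℂ) ^ 2 + (Real.cos α : ℂ) ^ 2 = 1 := by
        exact_mod_cast Real.sin_sq_add_cos_sq α
      rw [ha', hb']
      simp only [map_add, map_sub, map_mul, aeval_C, Complex.coe_algebraMap]
      constructor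
      · linear_combination (-aeval w a) * h3
      · linear_combination (-aeval w b) * h3
    obtain ⟨α₀, l, hl, hw⟩ := ih a'.divX b' (by
        rw [natDegree_divX_eq_natDegree_tsub_one]
        omega) hdb (fun ψ => by
        have h3 : ‖aeval (Complex.exp (ψ * Complex.I)) a'.divX‖ =
            ‖aeval (Complex.exp (ψ * Complex.I)) a'‖ := by
          conv_rhs => rw [haX]
          rw [map_mul, aeval_X, norm_mul, Complex.norm_exp_ofReal_mul_I, one_mul]
        rw [h3, ← h ψ, ha', hb']
        simp only [map_add, map_sub, map_mul, aeval_C, Complex.coe_algebraMap]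
        exact norm_sq_rotation α _ _)
    refine ⟨α₀, l ++ [α], by simp [hl], fun φ θ => ?_⟩
    rw [qspWord_append_singleton, hw, mul_assoc, twisted_mul_su2, rotZ_mul_su2]
    have hz := exp_mul_exp_neg (θ * Complex.I)
    have hzz : Complex.exp (((2 * θ : ℝ) : ℂ) * Complex.I) =
        Complex.exp (θ * Complex.I) * Complex.exp (θ * Complex.I) := by
      rw [← Complex.exp_add]
      congr 1
      push_cast
      ring
    obtain ⟨hr1, hr2⟩ := hrot (Complex.exp (((2 * θ : ℝ) : ℂ) * Complex.I))
    have hr3 : aeval (Complex.exp (((2 * θ : ℝ) : ℂ) * Complex.I)) a' =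
        Complex.exp (((2 * θ : ℝ) : ℂ) * Complex.I) *
          aeval (Complex.exp (((2 * θ : ℝ) : ℂ) * Complex.I)) a'.divX := by
      conv_lhs => rw [haX]
      rw [map_mul, aeval_X]
    have hA : Complex.exp (θ * Complex.I) * (Complex.exp (-(θ * Complex.I)) ^ d *
        aeval (Complex.exp (((2 * θ : ℝ) : ℂ) * Complex.I)) a'.divX) =
        Complex.exp (-(θ * Complex.I)) ^ (d + 1) *
          aeval (Complex.exp (((2 * θ : ℝ) : ℂ) * Complex.I)) a' := by
      rw [hr3, pow_succ]
      generalize aeval (Complex.exp (((2 * θ : ℝ) : ℂ) * Complex.I)) a'.divX = t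
      rw [hzz]
      linear_combination (-Complex.exp (θ * Complex.I) * Complex.exp (-(θ * Complex.I)) ^ d * t) * hz
    rw [hA, hr1, hr2]
    congr 1 <;> ring

/-! ### Trigonometric polynomials of fixed parity and their realization by words. -/

/-- Trigonometric polynomials with real coefficients whose frequencies are at most `d` and have
the parity of `d`. -/
def TrigPoly (d : ℕ) (A : ℝ → ℂ) : Prop :=
  ∃ a : ℝ[X], a.natDegree ≤ d ∧ ∀ θ : ℝ, A θ = Complex.exp (-(θ * Complex.I)) ^ d *
    aeval (Complex.exp (((2 * θ : ℝ) : ℂ) * Complex.I)) a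

theorem exp_two_mul_ofReal (θ : ℝ) : Complex.exp (((2 * θ : ℝ) : ℂ) * Complex.I) =
    Complex.exp (θ * Complex.I) * Complex.exp (θ * Complex.I) := by
  rw [← Complex.exp_add]
  congr 1
  push_cast
  ring

theorem trigPoly_const (c : ℝ) : TrigPoly 0 fun _ => (c : ℂ) :=
  ⟨C c, by simp, fun θ => by simp⟩

theorem trigPoly_cos : TrigPoly 1 fun θ => (Real.cos θ : ℂ) := by
  refine ⟨C (1 / 2) * X + C (1 / 2), by compute_degree, fun θ => ?_⟩
  have h := exp_mul_exp_neg (θ * Complex.I)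
  simp only [map_add, map_mul, aeval_C, aeval_X, Complex.coe_algebraMap, pow_one]
  rw [exp_two_mul_ofReal]
  have h2 := exp_ofReal_mul_I_eq θ
  have h3 := exp_neg_ofReal_mul_I_eq θ
  push_cast at h2 h3 ⊢
  linear_combination (-1 / 2) * h2 - (1 / 2) * h3 - (1 / 2) * Complex.exp (θ * Complex.I) * h

theorem trigPoly_I_mul_sin : TrigPoly 1 fun θ => Complex.I * (Real.sin θ : ℂ) := by
  refine ⟨C (1 / 2) * X + C (-1 / 2), by compute_degree, fun θ => ?_⟩
  have h := exp_mul_exp_neg (θ * Complex.I)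
  simp only [map_add, map_mul, aeval_C, aeval_X, Complex.coe_algebraMap, pow_one]
  rw [exp_two_mul_ofReal]
  have h2 := exp_ofReal_mul_I_eq θ
  have h3 := exp_neg_ofReal_mul_I_eq θ
  push_cast at h2 h3 ⊢
  linear_combination (-1 / 2) * h2 + (1 / 2) * h3 - (1 / 2) * Complex.exp (θ * Complex.I) * h

theorem TrigPoly.mul {d e : ℕ} {A B : ℝ → ℂ} (hA : TrigPoly d A) (hB : TrigPoly e B) :
    TrigPoly (d + e) fun θ => A θ * B θ := by
  obtain ⟨a, ha, ha'⟩ := hA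
  obtain ⟨b, hb, hb'⟩ := hB
  refine ⟨a * b, natDegree_mul_le.trans (add_le_add ha hb), fun θ => ?_⟩
  change A θ * B θ = _
  rw [ha', hb', map_mul, pow_add]
  ring

theorem TrigPoly.add {d : ℕ} {A B : ℝ → ℂ} (hA : TrigPoly d A) (hB : TrigPoly d B) :
    TrigPoly d fun θ => A θ + B θ := by
  obtain ⟨a, ha, ha'⟩ := hA
  obtain ⟨b, hb, hb'⟩ := hB
  refine ⟨a + b, (natDegree_add_le _ _).trans (max_le ha hb), fun θ => ?_⟩
  change A θ + B θ = _
  rw [ha', hb', map_add]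
  ring

theorem TrigPoly.const_mul {d : ℕ} {A : ℝ → ℂ} (hA : TrigPoly d A) (c : ℝ) :
    TrigPoly d fun θ => (c : ℂ) * A θ := by
  have := (trigPoly_const c).mul hA
  rwa [Nat.zero_add] at this

/-- Padding the degree only by even amounts preserves the parity of the frequencies; it brings
summands to a common degree. -/
theorem TrigPoly.add_two_mul {d : ℕ} {A : ℝ → ℂ} (hA : TrigPoly d A) (k : ℕ) :
    TrigPoly (d + 2 * k) A := by
  obtain ⟨a, ha, ha'⟩ := hA
  refine ⟨a * X ^ k, natDegree_mul_le.trans ?_, fun θ => ?_⟩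
  · rw [natDegree_X_pow]
    omega
  · have h : (Complex.exp (θ * Complex.I) * Complex.exp (-(θ * Complex.I))) ^ (2 * k) = 1 := by
      rw [exp_mul_exp_neg, one_pow]
    rw [ha', map_mul, map_pow, aeval_X]
    generalize aeval (Complex.exp (((2 * θ : ℝ) : ℂ) * Complex.I)) a = t
    rw [exp_two_mul_ofReal]
    rw [mul_pow, pow_mul, pow_two] at h
    rw [pow_add]
    linear_combination (-Complex.exp (-(θ * Complex.I)) ^ d * t) * h

theorem TrigPoly.pow {d : ℕ} {A : ℝ → ℂ} (hA : TrigPoly d A) (k : ℕ) :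
    TrigPoly (d * k) fun θ => A θ ^ k := by
  induction k with
  | zero => simpa using trigPoly_const 1
  | succ k ih => simpa [pow_succ, Nat.mul_succ] using ih.mul hA

theorem trigPoly_sum {ι : Type*} (s : Finset ι) {d : ℕ} {A : ι → ℝ → ℂ}
    (h : ∀ i ∈ s, TrigPoly d (A i)) : TrigPoly d fun θ => ∑ i ∈ s, A i θ := by
  classical
  induction s using Finset.induction_on with
  | empty => exact ⟨0, by simp, fun θ => by simp⟩
  | insert i s hi ih =>
    simp only [Finset.sum_insert hi]
    exact (h i (Finset.mem_insert_self i s)).add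
      (ih fun j hj => h j (Finset.mem_insert_of_mem hj))

theorem TrigPoly.eval {S : ℝ → ℝ} (hS : TrigPoly 2 fun θ => (S θ : ℂ)) {p : ℝ[X]} {M : ℕ}
    (hp : p.natDegree ≤ M) : TrigPoly (2 * M) fun θ => ((p.eval (S θ) : ℝ) : ℂ) := by
  have h : (fun θ => ((p.eval (S θ) : ℝ) : ℂ)) =
      fun θ => ∑ i ∈ Finset.range (M + 1), (p.coeff i : ℂ) * (S θ : ℂ) ^ i := by
    funext θ
    rw [eval_eq_sum_range' (Nat.lt_succ_of_le hp)]
    push_cast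
    rfl
  rw [h]
  refine trigPoly_sum _ fun i hi => ?_
  have := ((hS.pow i).const_mul (p.coeff i)).add_two_mul (M - i)
  have hi' := Finset.mem_range.1 hi
  rwa [show 2 * i + 2 * (M - i) = 2 * M by omega] at this

theorem trigPoly_cos_sq : TrigPoly 2 fun θ => ((Real.cos θ ^ 2 : ℝ) : ℂ) := by
  have := trigPoly_cos.pow 2
  simpa using this

theorem trigPoly_sin_sq : TrigPoly 2 fun θ => ((Real.sin θ ^ 2 : ℝ) : ℂ) := by
  have := (trigPoly_I_mul_sin.pow 2).const_mul (-1)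
  simpa [mul_pow] using this

/-- Quantum signal processing: a trigonometric polynomial that is bounded by `1` is realized by a
word, up to the component that makes up for its modulus. -/
theorem exists_qspWord_norm_sub {d : ℕ} {A : ℝ → ℂ} (hA : TrigPoly d A) (hA1 : ∀ θ, ‖A θ‖ ≤ 1) :
    ∃ (α : ℝ) (l : List ℝ), l.length = d ∧ ∀ (φ θ : ℝ) (u : ℂ), ‖u‖ = 1 →
      ‖qspWord α l (twisted φ θ) - su2 φ u 0‖ ^ 2 = 2 * (1 - (A θ * (starRingEnd ℂ) u).re) := by
  obtain ⟨a, ha, hAa⟩ := hA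
  have hnorm : ∀ θ : ℝ, ‖A θ‖ = ‖aeval (Complex.exp (((2 * θ : ℝ) : ℂ) * Complex.I)) a‖ := by
    intro θ
    rw [hAa, norm_mul, norm_pow, ← neg_mul, ← Complex.ofReal_neg, Complex.norm_exp_ofReal_mul_I,
      one_pow, one_mul]
  obtain ⟨b, hb, hab⟩ := exists_complement a fun ψ => by
    have := hnorm (ψ / 2)
    rw [mul_div_cancel₀ _ two_ne_zero] at this
    rw [← this]
    exact hA1 _
  obtain ⟨α, l, hl, hw⟩ := exists_qspWord d a b ha (hb.trans ha) hab
  refine ⟨α, l, hl, fun φ θ u hu => ?_⟩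
  have h1 := hab (2 * θ)
  rw [← hnorm] at h1
  rw [hw, ← hAa, su2_sub, norm_su2_sq, sub_zero, norm_mul, norm_pow, ← neg_mul,
    ← Complex.ofReal_neg, Complex.norm_exp_ofReal_mul_I, one_pow, one_mul]
  have h2 : ‖u‖ ^ 2 = 1 := by rw [hu, one_pow]
  simp only [Complex.sq_norm (A θ), Complex.sq_norm u, Complex.sq_norm (A θ - u),
    Complex.normSq_apply, Complex.sub_re, Complex.sub_im, Complex.mul_re, Complex.conj_re,
    Complex.conj_im] at h1 h2 ⊢
  -- With |A|² + |B|² = 1 = |u|², the sum |A - u|² + |B|² collapses to 2 - 2 Re(A ū).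
  linear_combination h1 + h2

end

end Correction

namespace Correction

open Polynomial

set_option linter.unusedSimpArgs false

noncomputable section

/-! ### Polynomial approximation of the sign -/

/-- The recursion is sin(y + 2t) + sin(y - 2t) = 2 cos(2t) sin y, with 2 cos(2t) = 2 - 4 sin² t. It
exhibits the Dirichlet kernel sin((2k+1)t)/sin t as a polynomial in sin² t. -/
theorem exists_sin_odd_mul (k : ℕ) : ∃ e : ℝ[X], e.natDegree ≤ k ∧
    ∀ t : ℝ, Real.sin ((2 * k + 1) * t) = Real.sin t * e.eval (Real.sin t ^ 2) := by
  induction k using Nat.twoStepInduction with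
  | zero => exact ⟨1, by simp, fun t => by simp⟩
  | one =>
    refine ⟨C 3 - C 4 * X, by compute_degree, fun t => ?_⟩
    have : (2 * ((1 : ℕ) : ℝ) + 1) * t = 3 * t := by push_cast; ring
    rw [this, Real.sin_three_mul]
    simp
    ring
  | more k ih1 ih2 =>
    obtain ⟨e, he, he'⟩ := ih1
    obtain ⟨f, hf, hf'⟩ := ih2
    refine ⟨(C 2 - C 4 * X) * f - e, ?_, fun t => ?_⟩
    · refine (natDegree_sub_le _ _).trans (max_le (natDegree_mul_le.trans ?_) (by omega))
      have : (C 2 - C 4 * X : ℝ[X]).natDegree ≤ 1 := by compute_degree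
      omega
    · have h1 : (2 * ((k + 2 : ℕ) : ℝ) + 1) * t = (2 * ((k + 1 : ℕ) : ℝ) + 1) * t + 2 * t := by
        push_cast; ring
      have h2 : (2 * (k : ℝ) + 1) * t = (2 * ((k + 1 : ℕ) : ℝ) + 1) * t - 2 * t := by
        push_cast; ring
      have h3 := he' t
      rw [h2, Real.sin_sub, hf'] at h3
      rw [h1, Real.sin_add, hf', Real.cos_two_mul'] at *
      simp only [eval_sub, eval_mul, eval_C, eval_X]
      have h4 := Real.sin_sq_add_cos_sq t
      linear_combination -h3 + 2 * Real.sin t * eval (Real.sin t ^ 2) f * h4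

/-- An odd primitive of the even function `x ↦ q (x²)`. -/
def oddPrimitive (q : ℝ[X]) : ℝ[X] :=
  ∑ j ∈ Finset.range (q.natDegree + 1), C (q.coeff j / (2 * j + 1)) * X ^ j

theorem natDegree_oddPrimitive_le (q : ℝ[X]) : (oddPrimitive q).natDegree ≤ q.natDegree := by
  refine natDegree_sum_le_of_forall_le _ _ fun j hj => (natDegree_C_mul_X_pow_le _ _).trans ?_
  have := Finset.mem_range.1 hj
  omega

theorem hasDerivAt_oddPrimitive (q : ℝ[X]) (x : ℝ) :
    HasDerivAt (fun x => x * (oddPrimitive q).eval (x ^ 2)) (q.eval (x ^ 2)) x := by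
  have h : (fun x : ℝ => x * (oddPrimitive q).eval (x ^ 2)) = fun x =>
      ∑ j ∈ Finset.range (q.natDegree + 1), q.coeff j / (2 * j + 1) * x ^ (2 * j + 1) := by
    funext x
    rw [oddPrimitive, eval_finsetSum, Finset.mul_sum]
    refine Finset.sum_congr rfl fun j _ => ?_
    rw [eval_mul, eval_C, eval_pow, eval_X]
    ring
  rw [h, eval_eq_sum_range]
  refine HasDerivAt.fun_sum fun j _ => ?_
  have h1 := (hasDerivAt_pow (2 * j + 1) x).const_mul (q.coeff j / (2 * j + 1))
  refine h1.congr_deriv ?_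
  have : (2 * (j : ℝ) + 1) ≠ 0 := by positivity
  push_cast
  rw [pow_mul]
  field_simp

theorem exists_nat_le_two_pow {x : ℝ} (hx : 1 ≤ x) :
    ∃ m : ℕ, x ≤ 2 ^ m ∧ (m : ℝ) ≤ 1 + 2 * Real.log x := by
  have h0 : 0 ≤ Real.log x := Real.log_nonneg hx
  refine ⟨⌈2 * Real.log x⌉₊, ?_, ?_⟩
  · rw [← Real.log_le_log_iff (by linarith) (by positivity), Real.log_pow]
    have h1 := Nat.le_ceil (2 * Real.log x)
    have h2 := Real.log_two_gt_d9
    nlinarith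
  · have := (Nat.ceil_lt_add_one (a := 2 * Real.log x) (by positivity)).le
    linarith

/-- From sin y > y - y³/4 at y = nt, where y² ≤ c because y ≤ c ≤ 1. It bounds the Dirichlet kernel
below near its peak. -/
theorem le_sin_div_sin {n t c : ℝ} (hn : 1 ≤ n) (ht : 0 < t) (hnt : n * t ≤ c) (hc : c ≤ 1) :
    n * Real.sin t * (1 - c / 4) ≤ Real.sin (n * t) := by
  have h0 : 0 < n * t := by positivity
  have h1 := Real.sin_gt_sub_cube h0
  have h6 : 0 < (n * t) ^ 3 := by positivity
  have h2 := Real.sin_lt ht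
  have h3 : (n * t) ^ 2 ≤ c := by nlinarith
  have h4 : n * Real.sin t * (1 - c / 4) ≤ n * t * (1 - c / 4) := by
    apply mul_le_mul_of_nonneg_right _ (by linarith)
    nlinarith
  have h5 : n * t * (1 - c / 4) ≤ n * t - (n * t) ^ 3 / 4 := by
    have : (n * t) ^ 3 = (n * t) * (n * t) ^ 2 := by ring
    rw [this]
    nlinarith
  linarith

theorem log_twenty_le : Real.log 20 ≤ 4 := by
  rw [Real.log_le_iff_le_exp (by norm_num)]
  have h := Real.exp_one_gt_d9
  have h2 : Real.exp 4 = Real.exp 1 ^ 4 := by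
    rw [← Real.exp_nat_mul]; norm_num
  rw [h2]
  calc (20 : ℝ) ≤ 2.7 ^ 4 := by norm_num
    _ ≤ _ := by gcongr; linarith

/-- Odd polynomials that are bounded by `1` on `[-1, 1]` and approximate `1` on `[δ, 1]`. -/
theorem exists_sign_approx {δ η : ℝ} (hδ : 0 < δ) (hδ1 : δ ≤ 1) (hη : 0 < η) (hη1 : η ≤ 1) :
    ∃ (M : ℕ) (g : ℝ[X]), g.natDegree ≤ M ∧
      (2 * M + 1 : ℝ) ≤ 73 * δ⁻¹ * (1 + Real.log (1 / (δ * η))) ∧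
      (∀ x ∈ Set.Icc (-1 : ℝ) 1, |x * g.eval (x ^ 2)| ≤ 1) ∧
      ∀ x ∈ Set.Icc δ 1, 1 - η ≤ x * g.eval (x ^ 2) := by
  have hinv : 1 ≤ δ⁻¹ := (one_le_inv₀ hδ).2 hδ1
  -- The size of k makes nδ ≥ 2, so the normalized kernel is at most 1/2 beyond δ.
  obtain ⟨k, hk1, hk2⟩ : ∃ k : ℕ, δ⁻¹ ≤ k ∧ (k : ℝ) ≤ 2 * δ⁻¹ :=
    ⟨⌈δ⁻¹⌉₊, Nat.le_ceil _, by
      have := (Nat.ceil_lt_add_one (a := δ⁻¹) (by positivity)).le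
      linarith⟩
  set n : ℝ := 2 * k + 1 with hn
  have hn1 : 1 ≤ n := by linarith
  have hnδ : 2 ≤ n * δ := by
    have : δ⁻¹ * δ = 1 := inv_mul_cancel₀ hδ.ne'
    nlinarith
  have hn5 : n ≤ 5 * δ⁻¹ := by linarith
  have hX : 4 ≤ 4 * n / η := by
    rw [le_div_iff₀ hη]
    nlinarith
  -- The target is 4^{-m} ≤ η/(4nm): one factor 2^m beats 4n/η, the other beats m.
  obtain ⟨m, hm1, hm2⟩ := exists_nat_le_two_pow (x := 4 * n / η) (by linarith)
  have hm0 : 1 ≤ m := by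
    by_contra! h
    interval_cases m
    norm_num at hm1
    linarith
  have hm0' : (1 : ℝ) ≤ m := by exact_mod_cast hm0
  obtain ⟨e, he, hes⟩ := exists_sin_odd_mul k
  -- At x = sin t, the value q(x²) is (sin(nt)/(n sin t))^{2m}: nonnegative, close to one near the
  -- origin and tiny beyond δ. Its odd primitive G is thus increasing and nearly constant on [δ, 1],
  -- so G/G(1) approximates the sign.
  set q : ℝ[X] := (C n⁻¹ * e) ^ (2 * m) with hq
  have hqdeg : q.natDegree ≤ 2 * m * k :=
    natDegree_pow_le.trans (Nat.mul_le_mul_left _ ((natDegree_C_mul_le _ _).trans he))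
  have hqev : ∀ y, q.eval y = (n⁻¹ * e.eval y) ^ (2 * m) := by
    intro y
    simp [hq]
  have hq0 : ∀ y, 0 ≤ q.eval y := by
    intro y
    rw [hqev]
    exact (even_two_mul m).pow_nonneg _
  set G : ℝ → ℝ := fun x => x * (oddPrimitive q).eval (x ^ 2) with hG
  have hder : ∀ x, HasDerivAt G (q.eval (x ^ 2)) x := hasDerivAt_oddPrimitive q
  have hdiff : Differentiable ℝ G := fun x => (hder x).differentiableAt
  have hmono : Monotone G :=
    monotone_of_deriv_nonneg hdiff fun x => by
      rw [(hder x).deriv]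
      exact hq0 _
  have hG0 : G 0 = 0 := by simp [hG]
  have hodd : ∀ x, G (-x) = -G x := by
    intro x
    simp [hG]
  -- lower bound near the origin
  set x₀ : ℝ := 1 / (2 * n * m) with hx₀
  have hx₀pos : 0 < x₀ := by positivity
  have hx₀1 : x₀ ≤ 1 / 2 := by
    rw [hx₀, div_le_div_iff₀ (by positivity) (by norm_num)]
    nlinarith
  have hsin : ∀ x : ℝ, 0 < x → x < 1 → 0 < Real.arcsin x ∧ Real.sin (Real.arcsin x) = x ∧
      Real.arcsin x ≤ Real.pi / 2 * x := by
    intro x hx hx1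
    have h1 : Real.sin (Real.arcsin x) = x := Real.sin_arcsin (by linarith) hx1.le
    have h2 := Real.arcsin_pos.2 hx
    refine ⟨h2, h1, ?_⟩
    have h3 := Real.mul_le_sin h2.le (Real.arcsin_le_pi_div_two x)
    rw [h1] at h3
    have hpi := Real.pi_pos
    have h4 : Real.pi / 2 * (2 / Real.pi * Real.arcsin x) = Real.arcsin x := by
      field_simp
    rw [← h4]
    gcongr
  have hnear : ∀ x ∈ Set.Ioo 0 x₀, 1 / 2 ≤ q.eval (x ^ 2) := by
    intro x hx
    obtain ⟨h1, h2, h3⟩ := hsin x hx.1 (by linarith [hx.2])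
    have h4 : n * Real.arcsin x ≤ 1 / m := by
      have h5 : Real.arcsin x ≤ 2 * x₀ := by
        have := Real.pi_le_four
        nlinarith [hx.1, hx.2]
      calc n * Real.arcsin x ≤ n * (2 * x₀) := by gcongr
        _ = 1 / m := by
          rw [hx₀]
          field_simp
    have h5 := le_sin_div_sin hn1 h1 h4 (by rw [div_le_one (by positivity)]; exact hm0')
    rw [hn, hes, h2, ← hn] at h5
    have h6 : 1 - 1 / (m : ℝ) / 4 ≤ n⁻¹ * e.eval (x ^ 2) := by
      rw [le_inv_mul_iff₀ (by positivity)]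
      refine le_of_mul_le_mul_left ?_ hx.1
      linarith
    have h7 : (1 : ℝ) / m ≤ 1 := by rw [div_le_one (by positivity)]; exact hm0'
    rw [hqev]
    have h8 := one_add_mul_le_pow (a := -(1 / (m : ℝ) / 4)) (by linarith) (2 * m)
    calc (1 : ℝ) / 2 = 1 + ((2 * m : ℕ) : ℝ) * -(1 / (m : ℝ) / 4) := by
          push_cast
          field_simp
          norm_num
      _ ≤ (1 + -(1 / (m : ℝ) / 4)) ^ (2 * m) := h8
      _ ≤ _ := by
        apply pow_le_pow_left₀ (by linarith)
        linarith
  have hlow : x₀ / 2 ≤ G x₀ := by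
    have h1 := Convex.mul_sub_le_image_sub_of_le_deriv (convex_Icc 0 x₀)
      hdiff.continuous.continuousOn hdiff.differentiableOn (C := 1 / 2) (fun x hx => by
        rw [interior_Icc] at hx
        rw [(hder x).deriv]
        exact hnear x hx) 0 (by simp [hx₀pos.le]) x₀ (by simp [hx₀pos.le]) hx₀pos.le
    rw [hG0] at h1
    linarith
  have hfar : ∀ x ∈ Set.Ioo δ 1, q.eval (x ^ 2) ≤ (1 / 4) ^ m := by
    intro x hx
    have hx0 : 0 < x := hδ.trans hx.1
    obtain ⟨h1, h2, h3⟩ := hsin x hx0 hx.2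
    have h4 := Real.abs_sin_le_one (n * Real.arcsin x)
    rw [hn, hes, h2, abs_mul, abs_of_pos hx0] at h4
    rw [hqev, pow_mul, show (1 / 4 : ℝ) = (1 / 2) ^ 2 by norm_num]
    refine pow_le_pow_left₀ (sq_nonneg _) ?_ m
    rw [← sq_abs, abs_mul, abs_of_pos (by positivity : 0 < n⁻¹)]
    refine pow_le_pow_left₀ (by positivity) ?_ 2
    rw [inv_mul_le_iff₀ (by positivity)]
    have h5 := abs_nonneg (e.eval (x ^ 2))
    have h6 : δ * |e.eval (x ^ 2)| ≤ 1 := le_trans (by gcongr; exact hx.1.le) h4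
    nlinarith
  have hG1 : x₀ / 2 ≤ G 1 := hlow.trans (hmono (by linarith))
  have hG1pos : 0 < G 1 := by linarith
  have hfar' : G 1 - G δ ≤ (1 / 4) ^ m := by
    have h1 := Convex.image_sub_le_mul_sub_of_deriv_le (convex_Icc δ 1)
      hdiff.continuous.continuousOn hdiff.differentiableOn (C := (1 / 4) ^ m) (fun x hx => by
        rw [interior_Icc] at hx
        rw [(hder x).deriv]
        exact hfar x hx) δ (by simp [hδ1]) 1 (by simp [hδ1]) hδ1
    refine h1.trans ?_
    have : (0 : ℝ) < (1 / 4) ^ m := by positivity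
    nlinarith
  have hsmall : (1 / 4 : ℝ) ^ m ≤ η * G 1 := by
    have h2m : (m : ℝ) ≤ 2 ^ m := by exact_mod_cast Nat.lt_two_pow_self.le
    have h1 : 4 * n * m ≤ η * 4 ^ m := by
      rw [div_le_iff₀ hη] at hm1
      calc 4 * n * m ≤ 2 ^ m * η * 2 ^ m := by gcongr
        _ = η * 4 ^ m := by
          rw [show (4 : ℝ) = 2 * 2 by norm_num, mul_pow]
          ring
    calc (1 / 4 : ℝ) ^ m = 1 / 4 ^ m := by rw [div_pow, one_pow]
      _ ≤ η * (x₀ / 2) := by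
        rw [hx₀, div_le_iff₀ (by positivity)]
        have : η * (1 / (2 * n * m) / 2) * 4 ^ m = (η * 4 ^ m) / (4 * n * m) := by
          field_simp
          norm_num
        rw [this, le_div_iff₀ (by positivity), one_mul]
        exact h1
      _ ≤ _ := by gcongr
  have hev : ∀ x, x * (C (G 1)⁻¹ * oddPrimitive q).eval (x ^ 2) = G x / G 1 := by
    intro x
    rw [eval_mul, eval_C]
    change _ = x * (oddPrimitive q).eval (x ^ 2) / G 1
    field_simp
  refine ⟨2 * m * k, C (G 1)⁻¹ * oddPrimitive q,
    (natDegree_C_mul_le _ _).trans ((natDegree_oddPrimitive_le q).trans hqdeg), ?_, ?_, ?_⟩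
  -- Here n ≤ 5δ⁻¹ and log 20 ≤ 4, whence m ≤ 9 + 2 log(1/(δη)). Since k ≤ 2δ⁻¹, the degree 4mk + 1
  -- has leading constant 8 · 9 + 1 = 73.
  · have h1 : Real.log (4 * n / η) ≤ 4 + Real.log (1 / (δ * η)) := by
      calc Real.log (4 * n / η) ≤ Real.log (20 * (1 / (δ * η))) := by
            apply Real.log_le_log (by positivity)
            rw [div_le_iff₀ hη]
            have : 20 * (1 / (δ * η)) * η = 4 * (5 * δ⁻¹) := by
              field_simp
              norm_num
            rw [this]
            linarith
        _ = Real.log 20 + Real.log (1 / (δ * η)) :=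
            Real.log_mul (by norm_num) (by positivity)
        _ ≤ _ := by linarith [log_twenty_le]
    have h2 : 0 ≤ Real.log (1 / (δ * η)) := by
      apply Real.log_nonneg
      rw [le_div_iff₀ (by positivity)]
      nlinarith
    have h3 : (m : ℝ) ≤ 9 + 2 * Real.log (1 / (δ * η)) := by linarith
    push_cast
    have h4 : 2 * (2 * (m : ℝ) * k) ≤ 4 * (9 + 2 * Real.log (1 / (δ * η))) * (2 * δ⁻¹) := by
      have : 2 * (2 * (m : ℝ) * k) = 4 * m * k := by ring
      rw [this]
      gcongr
    nlinarith
  · intro x hx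
    rw [hev, abs_div, abs_of_pos hG1pos, div_le_one hG1pos, abs_le]
    constructor
    · rw [← hodd]
      exact hmono hx.1
    · exact hmono hx.2
  · intro x hx
    rw [hev, le_div_iff₀ hG1pos]
    have := hmono hx.1
    linarith

end

end Correction

namespace Correction

open Polynomial

set_option linter.unusedSimpArgs false

noncomputable section

/-! ### Polynomial approximation of half-angle functions -/

theorem ring_choose_succ (r : ℝ) (n : ℕ) :
    Ring.choose r (n + 1) = Ring.choose r n * ((r - n) / (n + 1)) := by
  rw [Ring.choose_eq_smul, Ring.choose_eq_smul, descPochhammer_succ_right, smeval_mul,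
    smeval_sub, smeval_X, pow_one, smeval_natCast, Nat.factorial_succ]
  simp only [smul_eq_mul, pow_zero, nsmul_eq_mul, mul_one, Nat.cast_mul, Nat.cast_add, Nat.cast_one]
  have h1 : ((n : ℝ) + 1) ≠ 0 := by positivity
  have h2 : (n.factorial : ℝ) ≠ 0 := by positivity
  field_simp

theorem neg_one_pow_mul_choose_half_nonpos (n : ℕ) :
    (-1 : ℝ) ^ (n + 1) * Ring.choose (1 / 2 : ℝ) (n + 1) ≤ 0 := by
  induction n with
  | zero => simp [Ring.choose_one_right]
  | succ n ih =>
    rw [ring_choose_succ, pow_succ]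
    have h : 0 ≤ -((1 / 2 - ((n + 1 : ℕ) : ℝ)) / (((n + 1 : ℕ) : ℝ) + 1)) := by
      rw [← neg_div]
      apply div_nonneg
      · push_cast
        linarith [n.cast_nonneg (α := ℝ)]
      · positivity
    nlinarith

/-- The series of `1 - √(1 - s)` has nonnegative coefficients. -/
theorem exists_sqrt_series : ∃ b : ℕ → ℝ, (∀ j, 0 ≤ b j) ∧
    ∀ s : ℝ, |s| < 1 → HasSum (fun j => b j * s ^ (j + 1)) (1 - √(1 - s)) := by
  refine ⟨fun j => -((-1) ^ (j + 1) * Ring.choose (1 / 2 : ℝ) (j + 1)),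
    fun j => neg_nonneg.2 (neg_one_pow_mul_choose_half_nonpos j), fun s hs => ?_⟩
  have h := (Real.one_add_rpow_hasFPowerSeriesOnBall_zero (a := 1 / 2)).hasSum (y := -s) (by
    rw [Metric.mem_eball, edist_zero_right, enorm_neg, ← ofReal_norm, Real.norm_eq_abs]
    exact ENNReal.ofReal_lt_one.2 hs)
  have h2 : (fun n : ℕ => (binomialSeries ℝ (1 / 2 : ℝ) n) fun _ => -s) =
      fun n => Ring.choose (1 / 2 : ℝ) n * (-s) ^ n := by
    funext n
    rw [binomialSeries_apply]
    simp
  rw [h2, zero_add, ← sub_eq_add_neg, ← Real.sqrt_eq_rpow] at h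
  rw [← hasSum_nat_add_iff' 1] at h
  have h3 := h.neg
  rw [Finset.sum_range_one, pow_zero, mul_one, Ring.choose_zero_right, neg_sub] at h3
  refine h3.congr_fun ?_
  intro j
  rw [neg_pow s]
  ring

/-- Each finite partial sum is bounded for s < 1 by nonnegativity of the terms; continuity lets s
tend to 1. -/
theorem sum_le_one_of_hasSum {β : ℕ → ℝ} {e : ℕ → ℕ} {T : ℝ → ℝ}
    (h : ∀ s ∈ Set.Ico (0 : ℝ) 1, HasSum (fun i => β i * s ^ e i) (T s) ∧ T s ≤ 1)
    (hβ : ∀ i, 0 ≤ β i) (F : Finset ℕ) : ∑ i ∈ F, β i ≤ 1 := by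
  have hc : Continuous fun s : ℝ => ∑ i ∈ F, β i * s ^ e i := by fun_prop
  have hcl : IsClosed {s : ℝ | ∑ i ∈ F, β i * s ^ e i ≤ 1} := isClosed_le hc continuous_const
  have hsub : Set.Ico (0 : ℝ) 1 ⊆ {s : ℝ | ∑ i ∈ F, β i * s ^ e i ≤ 1} := by
    intro s hs
    obtain ⟨h1, h2⟩ := h s hs
    refine (sum_le_hasSum F (fun i _ => ?_) h1).trans h2
    exact mul_nonneg (hβ i) (pow_nonneg hs.1 _)
  have h1 := closure_minimal hsub hcl
  rw [closure_Ico zero_ne_one] at h1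
  simpa using h1 (Set.right_mem_Icc.2 zero_le_one)

/-- Beyond N every power is at most s^{e N}, and the total coefficient mass left is at most one
minus the mass already used. -/
theorem hasSum_le_sum_add_tail {β : ℕ → ℝ} {e : ℕ → ℕ} {T s : ℝ} (hs : s ∈ Set.Ico (0 : ℝ) 1)
    (h : HasSum (fun i => β i * s ^ e i) T) (hβ : ∀ i, 0 ≤ β i) (he : Monotone e)
    (hF : ∀ F : Finset ℕ, ∑ i ∈ F, β i ≤ 1) (N : ℕ) :
    T ≤ ∑ i ∈ Finset.range N, β i * s ^ e i +
      (1 - ∑ i ∈ Finset.range N, β i) * s ^ e N := by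
  refine hasSum_le_of_sum_le h fun F => ?_
  have h1 : ∑ i ∈ F, β i * s ^ e i ≤ ∑ i ∈ F ∪ Finset.range N, β i * s ^ e i :=
    Finset.sum_le_sum_of_subset_of_nonneg Finset.subset_union_left
      fun i _ _ => mul_nonneg (hβ i) (pow_nonneg hs.1 _)
  have h2 : (F ∪ Finset.range N) = Finset.range N ∪ (F \ Finset.range N) := by
    rw [Finset.union_comm, Finset.union_sdiff_self_eq_union]
  have h3 := hF (Finset.range N ∪ (F \ Finset.range N))
  rw [Finset.sum_union Finset.disjoint_sdiff] at h3
  rw [h2, Finset.sum_union Finset.disjoint_sdiff] at h1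
  have h4 : ∑ i ∈ F \ Finset.range N, β i * s ^ e i ≤
      (∑ i ∈ F \ Finset.range N, β i) * s ^ e N := by
    rw [Finset.sum_mul]
    refine Finset.sum_le_sum fun i hi => mul_le_mul_of_nonneg_left ?_ (hβ i)
    have hiN : N ≤ i := by
      have := (Finset.mem_sdiff.1 hi).2
      simpa using this
    exact pow_le_pow_of_le_one hs.1 hs.2.le (he hiN)
  have h5 : (∑ i ∈ F \ Finset.range N, β i) * s ^ e N ≤
      (1 - ∑ i ∈ Finset.range N, β i) * s ^ e N :=
    mul_le_mul_of_nonneg_right (by linarith) (pow_nonneg hs.1 _)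
  linarith

/-- Polynomial approximation from below of `(√(1 + s) ± √(1 - s)) / 2` on `[0, 1)`. -/
theorem exists_half_angle_poly (N : ℕ) : ∃ p q : ℝ[X], p.natDegree ≤ N + 1 ∧ q.natDegree ≤ N ∧
    ∀ s ∈ Set.Ico (0 : ℝ) 1,
      (0 ≤ p.eval (s ^ 2) ∧ p.eval (s ^ 2) ≤ (√(1 + s) + √(1 - s)) / 2 ∧
        (√(1 + s) + √(1 - s)) / 2 - s ^ (2 * N) ≤ p.eval (s ^ 2)) ∧
      (0 ≤ s * q.eval (s ^ 2) ∧ s * q.eval (s ^ 2) ≤ (√(1 + s) - √(1 - s)) / 2 ∧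
        (√(1 + s) - √(1 - s)) / 2 - s ^ (2 * N) ≤ s * q.eval (s ^ 2)) := by
  obtain ⟨b, hb, hbs⟩ := exists_sqrt_series
  -- Averaging the series at s and -s isolates the even powers, which carry the odd indices because
  -- `b j` multiplies s^{j+1}. The half difference gives the other parity.
  have hodd : ∀ s ∈ Set.Ico (0 : ℝ) 1,
      HasSum (fun i => b (2 * i + 1) * s ^ (2 * i + 2)) (1 - (√(1 + s) + √(1 - s)) / 2) := by
    intro s hs
    have habs : |s| < 1 := by rw [abs_of_nonneg hs.1]; exact hs.2
    have h1 := ((hbs s habs).add (hbs (-s) (by rwa [abs_neg]))).div_const 2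
    have h2 : Function.Injective fun i : ℕ => 2 * i + 1 := fun i j hij => by simpa using hij
    rw [← h2.hasSum_iff] at h1
    · have h3 : (1 - √(1 - s) + (1 - √(1 - -s))) / 2 = 1 - (√(1 + s) + √(1 - s)) / 2 := by
        rw [sub_neg_eq_add]; ring
      rw [h3] at h1
      refine h1.congr_fun ?_
      intro i
      simp only [Function.comp_apply]
      rw [show 2 * i + 1 + 1 = 2 * (i + 1) by ring, Even.neg_pow (even_two_mul _)]
      ring
    · intro j hj
      have hj' : Even j := by
        by_contra hne
        obtain ⟨i, rfl⟩ := Nat.not_even_iff_odd.1 hne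
        exact hj ⟨i, rfl⟩
      rw [Odd.neg_pow hj'.add_one]
      ring
  have heven : ∀ s ∈ Set.Ico (0 : ℝ) 1,
      HasSum (fun i => b (2 * i) * s ^ (2 * i + 1)) ((√(1 + s) - √(1 - s)) / 2) := by
    intro s hs
    have habs : |s| < 1 := by rw [abs_of_nonneg hs.1]; exact hs.2
    have h1 := ((hbs s habs).sub (hbs (-s) (by rwa [abs_neg]))).div_const 2
    have h2 : Function.Injective fun i : ℕ => 2 * i := fun i j hij => by simpa using hij
    rw [← h2.hasSum_iff] at h1
    · have h3 : (1 - √(1 - s) - (1 - √(1 - -s))) / 2 = (√(1 + s) - √(1 - s)) / 2 := by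
        rw [sub_neg_eq_add]; ring
      rw [h3] at h1
      refine h1.congr_fun ?_
      intro i
      simp only [Function.comp_apply]
      rw [Odd.neg_pow (even_two_mul i).add_one]
      ring
    · intro j hj
      have hj' : Odd j := by
        by_contra hne
        obtain ⟨i, rfl⟩ := even_iff_exists_two_mul.1 (Nat.not_odd_iff_even.1 hne)
        exact hj ⟨i, rfl⟩
      rw [Even.neg_pow hj'.add_one]
      ring
  have hle : ∀ s ∈ Set.Ico (0 : ℝ) 1, √(1 + s) ≤ 2 ∧ 0 ≤ √(1 - s) := by
    intro s hs
    refine ⟨?_, Real.sqrt_nonneg _⟩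
    rw [Real.sqrt_le_left (by norm_num)]
    linarith [hs.2]
  have hsum1 : ∀ F : Finset ℕ, ∑ i ∈ F, b (2 * i + 1) ≤ 1 :=
    sum_le_one_of_hasSum (β := fun i => b (2 * i + 1)) (e := fun i => 2 * i + 2)
      (T := fun s => 1 - (√(1 + s) + √(1 - s)) / 2) (fun s hs => ⟨hodd s hs, by
        have := Real.sqrt_nonneg (1 + s)
        linarith [hle s hs]⟩) (fun i => hb _)
  have hsum2 : ∀ F : Finset ℕ, ∑ i ∈ F, b (2 * i) ≤ 1 :=
    sum_le_one_of_hasSum (β := fun i => b (2 * i)) (e := fun i => 2 * i + 1)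
      (T := fun s => (√(1 + s) - √(1 - s)) / 2) (fun s hs => ⟨heven s hs, by
        linarith [hle s hs]⟩) (fun i => hb _)
  -- Since p is one minus a series, truncation would overshoot; subtracting r s^{2N+2}, an upper
  -- bound for the tail, puts p below its target. Truncating the nonnegative series for q needs no
  -- correction.
  set r := 1 - ∑ i ∈ Finset.range N, b (2 * i + 1) with hr
  have hr0 : 0 ≤ r := by linarith [hsum1 (Finset.range N)]
  have hr1 : r ≤ 1 := by
    have := Finset.sum_nonneg (s := Finset.range N) (f := fun i => b (2 * i + 1)) fun i _ => hb _
    linarith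
  refine ⟨C 1 - ∑ i ∈ Finset.range N, C (b (2 * i + 1)) * X ^ (i + 1) - C r * X ^ (N + 1),
    ∑ i ∈ Finset.range N, C (b (2 * i)) * X ^ i, ?_, ?_, fun s hs => ?_⟩
  · refine (natDegree_sub_le _ _).trans (max_le ((natDegree_sub_le _ _).trans
      (max_le (by simp) ?_)) (natDegree_C_mul_X_pow_le _ _))
    refine natDegree_sum_le_of_forall_le _ _ fun i hi => (natDegree_C_mul_X_pow_le _ _).trans ?_
    have := Finset.mem_range.1 hi
    omega
  · refine natDegree_sum_le_of_forall_le _ _ fun i hi => (natDegree_C_mul_X_pow_le _ _).trans ?_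
    have := Finset.mem_range.1 hi
    omega
  · have hp : (C 1 - ∑ i ∈ Finset.range N, C (b (2 * i + 1)) * X ^ (i + 1) -
        C r * X ^ (N + 1)).eval (s ^ 2) =
        1 - ∑ i ∈ Finset.range N, b (2 * i + 1) * s ^ (2 * i + 2) - r * s ^ (2 * N + 2) := by
      rw [eval_sub, eval_sub, eval_C, eval_finsetSum, eval_mul, eval_C, eval_pow, eval_X,
        ← pow_mul, show 2 * (N + 1) = 2 * N + 2 by ring]
      congr 2
      refine Finset.sum_congr rfl fun i _ => ?_
      rw [eval_mul, eval_C, eval_pow, eval_X, ← pow_mul, show 2 * (i + 1) = 2 * i + 2 by ring]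
    have hq : s * (∑ i ∈ Finset.range N, C (b (2 * i)) * X ^ i).eval (s ^ 2) =
        ∑ i ∈ Finset.range N, b (2 * i) * s ^ (2 * i + 1) := by
      rw [eval_finsetSum, Finset.mul_sum]
      refine Finset.sum_congr rfl fun i _ => ?_
      rw [eval_mul, eval_C, eval_pow, eval_X, ← pow_mul]
      ring
    have hpow1 : s ^ (2 * N + 2) ≤ s ^ (2 * N) := pow_le_pow_of_le_one hs.1 hs.2.le (by omega)
    have hpow2 : s ^ (2 * N + 1) ≤ s ^ (2 * N) := pow_le_pow_of_le_one hs.1 hs.2.le (by omega)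
    have hpow0 : 0 ≤ s ^ (2 * N + 2) := pow_nonneg hs.1 _
    have hpow3 : 0 ≤ s ^ (2 * N + 1) := pow_nonneg hs.1 _
    have t1 := hasSum_le_sum_add_tail (β := fun i => b (2 * i + 1)) (e := fun i => 2 * i + 2) hs
      (hodd s hs) (fun i => hb _) (fun i j hij => by dsimp only; omega) hsum1 N
    have t2 := hasSum_le_sum_add_tail (β := fun i => b (2 * i)) (e := fun i => 2 * i + 1) hs
      (heven s hs) (fun i => hb _) (fun i j hij => by dsimp only; omega) hsum2 N
    have u1 := sum_le_hasSum (Finset.range N)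
      (fun i _ => mul_nonneg (hb (2 * i + 1)) (pow_nonneg hs.1 (2 * i + 2))) (hodd s hs)
    have u2 := sum_le_hasSum (Finset.range N)
      (fun i _ => mul_nonneg (hb (2 * i)) (pow_nonneg hs.1 (2 * i + 1))) (heven s hs)
    have v1 : ∑ i ∈ Finset.range N, b (2 * i + 1) * s ^ (2 * i + 2) ≤
        ∑ i ∈ Finset.range N, b (2 * i + 1) := Finset.sum_le_sum fun i _ =>
      mul_le_of_le_one_right (hb _) (pow_le_one₀ hs.1 hs.2.le)
    have v2 : r * s ^ (2 * N + 2) ≤ r := mul_le_of_le_one_right hr0 (pow_le_one₀ hs.1 hs.2.le)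
    have v3 : r * s ^ (2 * N + 2) ≤ s ^ (2 * N + 2) := mul_le_of_le_one_left hpow0 hr1
    have v4 : (1 - ∑ i ∈ Finset.range N, b (2 * i)) * s ^ (2 * N + 1) ≤ s ^ (2 * N + 1) := by
      refine mul_le_of_le_one_left hpow3 ?_
      have := Finset.sum_nonneg (s := Finset.range N) (f := fun i => b (2 * i)) fun i _ => hb _
      linarith
    have v5 : 0 ≤ ∑ i ∈ Finset.range N, b (2 * i) * s ^ (2 * i + 1) := Finset.sum_nonneg
      fun i _ => mul_nonneg (hb _) (pow_nonneg hs.1 _)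
    rw [hp, hq]
    refine ⟨⟨?_, ?_, ?_⟩, ?_, ?_, ?_⟩ <;> linarith

/-- The radicands are the squares of cos(θ/2) ± |sin(θ/2)|; the range of θ makes the difference
nonnegative. -/
theorem sqrt_one_add_abs_sin {θ : ℝ} (hθ : |θ| ≤ Real.pi / 2) :
    √(1 + |Real.sin θ|) = Real.cos (θ / 2) + |Real.sin (θ / 2)| ∧
      √(1 - |Real.sin θ|) = Real.cos (θ / 2) - |Real.sin (θ / 2)| := by
  have hpi := Real.pi_pos
  rw [abs_le] at hθ
  have h1 : 0 ≤ Real.cos (θ / 2) :=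
    Real.cos_nonneg_of_mem_Icc ⟨by linarith [hθ.1], by linarith [hθ.2]⟩
  have h2 : |Real.sin θ| = 2 * |Real.sin (θ / 2)| * Real.cos (θ / 2) := by
    have : Real.sin θ = 2 * Real.sin (θ / 2) * Real.cos (θ / 2) := by
      rw [← Real.sin_two_mul]; congr 1; ring
    rw [this, abs_mul, abs_mul, abs_of_nonneg h1, abs_two]
  have h3 := Real.sin_sq_add_cos_sq (θ / 2)
  have h4 := sq_abs (Real.sin (θ / 2))
  have h5 : |Real.sin (θ / 2)| ≤ Real.cos (θ / 2) := by
    apply abs_le_of_sq_le_sq _ h1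
    have h6 : 0 ≤ Real.cos θ := Real.cos_nonneg_of_mem_Icc ⟨by linarith [hθ.1], by linarith [hθ.2]⟩
    have h7 : Real.cos θ = Real.cos (θ / 2) ^ 2 - Real.sin (θ / 2) ^ 2 := by
      rw [← Real.cos_two_mul']; congr 1; ring
    linarith
  constructor
  · have h6 : 1 + |Real.sin θ| = (Real.cos (θ / 2) + |Real.sin (θ / 2)|) ^ 2 := by
      linear_combination h2 - h3 - h4
    rw [h6, Real.sqrt_sq (by positivity)]
  · have h6 : 1 - |Real.sin θ| = (Real.cos (θ / 2) - |Real.sin (θ / 2)|) ^ 2 := by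
      linear_combination -h2 - h3 - h4
    rw [h6, Real.sqrt_sq (by linarith)]

end

end Correction

namespace Correction

open Polynomial

set_option linter.unusedSimpArgs false

noncomputable section

/-! ### Words near the axis reflection, near the identity, and for the half angle. -/

theorem TrigPoly.congr {d : ℕ} {A B : ℝ → ℂ} (hA : TrigPoly d A) (h : ∀ θ, B θ = A θ) :
    TrigPoly d B := by
  obtain ⟨a, ha, ha'⟩ := hA
  exact ⟨a, ha, fun θ => (h θ).trans (ha' θ)⟩

theorem trigPoly_cos_mul {M : ℕ} {g : ℝ[X]} (hg : g.natDegree ≤ M) :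
    TrigPoly (2 * M + 1) fun θ => ((Real.cos θ * g.eval (Real.cos θ ^ 2) : ℝ) : ℂ) := by
  have h := (trigPoly_cos_sq.eval hg).mul trigPoly_cos
  refine h.congr fun θ => ?_
  push_cast
  ring

theorem trigPoly_I_mul_sin_mul {M : ℕ} {g : ℝ[X]} (hg : g.natDegree ≤ M) :
    TrigPoly (2 * M + 1) fun θ =>
      Complex.I * ((Real.sin θ * g.eval (Real.sin θ ^ 2) : ℝ) : ℂ) := by
  have h := (trigPoly_sin_sq.eval hg).mul trigPoly_I_mul_sin
  refine h.congr fun θ => ?_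
  push_cast
  ring

theorem su2_I (φ : ℝ) : su2 φ Complex.I 0 = Complex.I • axis φ := by
  rw [axis_eq_su2, smul_smul]
  simp

theorem su2_one (φ : ℝ) : su2 φ 1 0 = 1 := by
  ext i j
  fin_cases i <;> fin_cases j <;> simp [su2]

theorem rotX_eq_twisted (θ : ℝ) : rotX θ = twisted 0 θ := by
  have h : rotZ 0 = 1 := by
    rw [rotZ_eq]
    ext i j
    fin_cases i <;> fin_cases j <;> simp
  rw [twisted]
  simp [h]

/-- A word that turns `e^{iθ n}` into `i n`, and a word of the same length that turns it into
`1`. -/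
theorem exists_sign_words {δ e : ℝ} (hδ : 0 < δ) (hδ1 : δ ≤ 1) (he : 0 < e) (he1 : e ≤ 1) :
    ∃ (α : ℝ) (l : List ℝ) (α' : ℝ) (l' : List ℝ), l'.length = l.length ∧
      (l.length : ℝ) ≤ 73 * δ⁻¹ * (1 + Real.log (1 / (δ * (e ^ 2 / 2)))) ∧
      (∀ φ θ : ℝ, δ ≤ Real.sin θ →
        ‖qspWord α l (twisted φ θ) - Complex.I • axis φ‖ ≤ e) ∧
      ∀ φ θ : ℝ, δ ≤ Real.cos θ → ‖qspWord α' l' (twisted φ θ) - 1‖ ≤ e := by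
  -- Since the squared distance is twice the defect of Re(A ū), accuracy e needs defect e²/2. Using
  -- the same g for sine and cosine makes the two words equally long.
  obtain ⟨M, g, hg, hM, hg1, hgδ⟩ := exists_sign_approx hδ hδ1 (η := e ^ 2 / 2)
    (by positivity) (by nlinarith)
  obtain ⟨α, l, hl, hw⟩ := exists_qspWord_norm_sub (trigPoly_I_mul_sin_mul hg) (fun θ => by
    rw [norm_mul, Complex.norm_I, one_mul, Complex.norm_real]
    exact hg1 _ ⟨Real.neg_one_le_sin θ, Real.sin_le_one θ⟩)
  obtain ⟨α', l', hl', hw'⟩ := exists_qspWord_norm_sub (trigPoly_cos_mul hg) (fun θ => by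
    rw [Complex.norm_real]
    exact hg1 _ ⟨Real.neg_one_le_cos θ, Real.cos_le_one θ⟩)
  refine ⟨α, l, α', l', hl'.trans hl.symm, ?_, fun φ θ h => ?_, fun φ θ h => ?_⟩
  · rw [hl]
    exact_mod_cast hM
  · have h1 := hw φ θ Complex.I (by simp)
    have h2 := hgδ _ ⟨h, Real.sin_le_one θ⟩
    rw [su2_I] at h1
    refine (pow_le_pow_iff_left₀ (norm_nonneg _) he.le two_ne_zero).1 ?_
    rw [h1]
    have h3 : (Complex.I * ((Real.sin θ * g.eval (Real.sin θ ^ 2) : ℝ) : ℂ) *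
        (starRingEnd ℂ) Complex.I).re = Real.sin θ * g.eval (Real.sin θ ^ 2) := by
      rw [Complex.conj_I, mul_comm Complex.I, mul_assoc, mul_neg, Complex.I_mul_I, neg_neg, mul_one,
        Complex.ofReal_re]
    rw [h3]
    linarith
  · have h1 := hw' φ θ 1 (by simp)
    have h2 := hgδ _ ⟨h, Real.cos_le_one θ⟩
    rw [su2_one] at h1
    refine (pow_le_pow_iff_left₀ (norm_nonneg _) he.le two_ne_zero).1 ?_
    rw [h1, map_one, mul_one, Complex.ofReal_re]
    linarith

theorem pow_le_of_log_le {γ η x : ℝ} {N : ℕ} (hη : 0 < η) (hx0 : 0 ≤ x) (hx : x ≤ 1 - γ ^ 2)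
    (hN : Real.log (1 / η) ≤ N * γ ^ 2) : x ^ N ≤ η := by
  calc x ^ N ≤ (Real.exp (-γ ^ 2)) ^ N := by
        gcongr
        linarith [Real.add_one_le_exp (-γ ^ 2)]
    _ = Real.exp (-(N * γ ^ 2)) := by
        rw [← Real.exp_nat_mul]
        congr 1
        ring
    _ ≤ Real.exp (-(Real.log (1 / η))) := by
        gcongr
    _ = η := by
        rw [one_div, Real.log_inv, neg_neg, Real.exp_log hη]

/-- On the stated range cos(θ/2) and sin(θ/2) are approximated by p(sin² θ) and sin θ q(sin² θ).
These have opposite frequency parities, so the second is multiplied by a sign approximation at cos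
θ, which is nearly 1 because cos θ ≥ γ and repairs the parity. The truncation converges like (1 -
γ²)^N, hence the factor γ⁻². -/
theorem exists_half_angle_trigPoly {γ η : ℝ} (hγ : 0 < γ) (hγ1 : γ ≤ 1) (hη : 0 < η)
    (hη1 : η ≤ 1) :
    ∃ (d : ℕ) (A : ℝ → ℂ), TrigPoly d A ∧ (∀ θ, ‖A θ‖ ≤ 1) ∧
      (d : ℝ) ≤ 80 * (γ ^ 2)⁻¹ * (1 + Real.log (1 / (γ * η))) ∧
      ∀ θ : ℝ, |θ| ≤ Real.pi / 2 → γ ≤ Real.cos θ →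
        1 - 3 * η ≤ (A θ * (starRingEnd ℂ) (Complex.exp (((θ / 2 : ℝ) : ℂ) * Complex.I))).re := by
  obtain ⟨M, g, hg, hM, hg1, hgγ⟩ := exists_sign_approx hγ hγ1 hη hη1
  have hlog : 0 ≤ Real.log (1 / η) := Real.log_nonneg (by rw [le_div_iff₀ hη]; linarith)
  obtain ⟨N, hN1, hN2⟩ : ∃ N : ℕ, Real.log (1 / η) / γ ^ 2 ≤ N ∧
      (N : ℝ) ≤ 1 + Real.log (1 / η) / γ ^ 2 :=
    ⟨⌈Real.log (1 / η) / γ ^ 2⌉₊, Nat.le_ceil _, by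
      have := (Nat.ceil_lt_add_one (a := Real.log (1 / η) / γ ^ 2) (by positivity)).le
      linarith⟩
  obtain ⟨p, q, hp, hq, hpq⟩ := exists_half_angle_poly N
  -- The targets have squares summing to one, so approximating both from below by nonnegative values
  -- keeps the modulus at most 1; s = 1 follows by closure.
  have hsin : ∀ s ∈ Set.Icc (0 : ℝ) 1, p.eval (s ^ 2) ^ 2 + (s * q.eval (s ^ 2)) ^ 2 ≤ 1 := by
    have hcl : IsClosed {s : ℝ | p.eval (s ^ 2) ^ 2 + (s * q.eval (s ^ 2)) ^ 2 ≤ 1} := by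
      refine isClosed_le ?_ continuous_const
      have hp' := p.continuous.comp (continuous_pow 2 (M := ℝ))
      have hq' := q.continuous.comp (continuous_pow 2 (M := ℝ))
      exact (hp'.pow 2).add ((continuous_id.mul hq').pow 2)
    have hsub : Set.Ico (0 : ℝ) 1 ⊆
        {s : ℝ | p.eval (s ^ 2) ^ 2 + (s * q.eval (s ^ 2)) ^ 2 ≤ 1} := by
      intro s hs
      obtain ⟨⟨h1, h2, -⟩, h3, h4, -⟩ := hpq s hs
      have h5 := pow_le_pow_left₀ h1 h2 2
      have h6 := pow_le_pow_left₀ h3 h4 2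
      have h7 : √(1 + s) ^ 2 = 1 + s := Real.sq_sqrt (by linarith [hs.1])
      have h8 : √(1 - s) ^ 2 = 1 - s := Real.sq_sqrt (by linarith [hs.2])
      change _ ≤ (1 : ℝ)
      linarith
    have h1 := closure_minimal hsub hcl
    rw [closure_Ico zero_ne_one] at h1
    exact h1
  have habs : ∀ θ : ℝ, |Real.sin θ| ∈ Set.Icc (0 : ℝ) 1 :=
    fun θ => ⟨abs_nonneg _, Real.abs_sin_le_one θ⟩
  refine ⟨2 * M + 2 * N + 2, fun θ => ((p.eval (Real.sin θ ^ 2) : ℝ) : ℂ) +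
    ((Real.cos θ * g.eval (Real.cos θ ^ 2) : ℝ) : ℂ) *
      (Complex.I * ((Real.sin θ * q.eval (Real.sin θ ^ 2) : ℝ) : ℂ)), ?_, fun θ => ?_, ?_,
      fun θ hθ hcos => ?_⟩
  · have h1 := (trigPoly_sin_sq.eval hp).add_two_mul M
    have h2 := (trigPoly_cos_mul hg).mul (trigPoly_I_mul_sin_mul hq)
    rw [show 2 * (N + 1) + 2 * M = 2 * M + 2 * N + 2 by ring] at h1
    rw [show 2 * M + 1 + (2 * N + 1) = 2 * M + 2 * N + 2 by ring] at h2
    exact h1.add h2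
  · rw [← abs_of_nonneg (norm_nonneg _), ← sq_le_one_iff_abs_le_one, Complex.sq_norm,
      Complex.normSq_apply]
    have h1 := hsin _ (habs θ)
    rw [mul_pow, sq_abs] at h1
    have h2 := hg1 _ ⟨Real.neg_one_le_cos θ, Real.cos_le_one θ⟩
    rw [← sq_le_one_iff_abs_le_one] at h2
    simp only [Complex.add_re, Complex.add_im, Complex.mul_re, Complex.mul_im, Complex.ofReal_re,
      Complex.ofReal_im, Complex.I_re, Complex.I_im]
    have h3 : (Real.cos θ * g.eval (Real.cos θ ^ 2)) ^ 2 *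
        (Real.sin θ * q.eval (Real.sin θ ^ 2)) ^ 2 ≤
        (Real.sin θ * q.eval (Real.sin θ ^ 2)) ^ 2 := mul_le_of_le_one_left (sq_nonneg _) h2
    generalize Real.cos θ * g.eval (Real.cos θ ^ 2) = G at *
    rw [mul_pow (Real.sin θ)] at h3
    nlinarith
  · have hinv : 1 ≤ γ⁻¹ := (one_le_inv₀ hγ).2 hγ1
    have h1 : γ⁻¹ ≤ (γ ^ 2)⁻¹ := by
      rw [← inv_pow]
      nlinarith
    have h2 : Real.log (1 / η) ≤ Real.log (1 / (γ * η)) := by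
      apply Real.log_le_log (by positivity)
      apply one_div_le_one_div_of_le (by positivity)
      nlinarith
    have h3 : (N : ℝ) ≤ 1 + (γ ^ 2)⁻¹ * Real.log (1 / (γ * η)) := by
      refine hN2.trans ?_
      rw [div_eq_inv_mul]
      gcongr
    have h4 : 73 * γ⁻¹ * (1 + Real.log (1 / (γ * η))) ≤
        73 * (γ ^ 2)⁻¹ * (1 + Real.log (1 / (γ * η))) := by
      have : 0 ≤ 1 + Real.log (1 / (γ * η)) := by linarith
      gcongr
    have h5 : 0 ≤ (γ ^ 2)⁻¹ * Real.log (1 / (γ * η)) := by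
      have : 0 ≤ Real.log (1 / (γ * η)) := by linarith
      positivity
    push_cast
    nlinarith
  · obtain ⟨hu, hv⟩ := sqrt_one_add_abs_sin hθ
    have hc0 : 0 ≤ Real.cos (θ / 2) := by
      rw [abs_le] at hθ
      exact Real.cos_nonneg_of_mem_Icc ⟨by linarith [hθ.1, Real.pi_pos], by linarith [hθ.2, Real.pi_pos]⟩
    have hsc := Real.sin_sq_add_cos_sq θ
    have hlt : |Real.sin θ| < 1 := by
      rw [← sq_lt_one_iff_abs_lt_one]
      nlinarith
    obtain ⟨⟨h1, h2, h3⟩, h4, h5, h6⟩ := hpq |Real.sin θ| ⟨abs_nonneg _, hlt⟩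
    rw [hu, hv, sq_abs] at *
    have hpow : |Real.sin θ| ^ (2 * N) ≤ η := by
      rw [pow_mul, sq_abs]
      refine pow_le_of_log_le (γ := γ) hη (sq_nonneg _) (by nlinarith) ?_
      rwa [← div_le_iff₀ (by positivity)]
    have hgc := hgγ _ ⟨hcos, Real.cos_le_one θ⟩
    have hc1 := Real.cos_le_one (θ / 2)
    have hs1 := Real.abs_sin_le_one (θ / 2)
    have hs0 := abs_nonneg (Real.sin (θ / 2))
    have hhalf := Real.sin_sq_add_cos_sq (θ / 2)
    have hsgn : Real.sin θ * Real.sin (θ / 2) = |Real.sin θ| * |Real.sin (θ / 2)| := by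
      rw [← abs_mul, abs_of_nonneg]
      have : Real.sin θ = 2 * Real.sin (θ / 2) * Real.cos (θ / 2) := by
        rw [← Real.sin_two_mul]; congr 1; ring
      rw [this]
      nlinarith [mul_nonneg (sq_nonneg (Real.sin (θ / 2))) hc0]
    rw [conj_exp_ofReal_mul_I, exp_neg_ofReal_mul_I_eq]
    simp only [Complex.add_re, Complex.add_im, Complex.mul_re, Complex.mul_im, Complex.ofReal_re,
      Complex.ofReal_im, Complex.I_re, Complex.I_im, Complex.sub_re, Complex.sub_im]
    generalize Real.cos θ * g.eval (Real.cos θ ^ 2) = G at *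
    -- Each of the three approximations, of the cosine, of the sine and of the sign, loses at most η
    -- from cos² + sin² = 1.
    have hgoal : (1 : ℝ) - 3 * η ≤ p.eval (Real.sin θ ^ 2) * Real.cos (θ / 2) +
        G * ((|Real.sin θ| * q.eval (Real.sin θ ^ 2)) * |Real.sin (θ / 2)|) := by
      set P := p.eval (Real.sin θ ^ 2)
      set Q := |Real.sin θ| * q.eval (Real.sin θ ^ 2)
      set c := Real.cos (θ / 2)
      set s := |Real.sin (θ / 2)|
      have k0 : s ^ 2 + c ^ 2 = 1 := by rw [sq_abs]; exact hhalf
      have k1 : c - η ≤ P := by linarith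
      have k2 : s - η ≤ Q := by linarith
      have k3 : Q ≤ 1 := by linarith
      have k4 : Q * s ≤ 1 := mul_le_one₀ k3 hs0 hs1
      have k8 : η * c ≤ η := mul_le_of_le_one_right hη.le hc1
      have k9 : η * s ≤ η := mul_le_of_le_one_right hη.le hs1
      have k10 : η * (Q * s) ≤ η := mul_le_of_le_one_right hη.le k4
      have k5 : (c - η) * c ≤ P * c := mul_le_mul_of_nonneg_right k1 hc0
      have k6 : (s - η) * s ≤ Q * s := mul_le_mul_of_nonneg_right k2 hs0
      have k7 : (1 - η) * (Q * s) ≤ G * (Q * s) :=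
        mul_le_mul_of_nonneg_right hgc (mul_nonneg h4 hs0)
      linarith
    have heq : G * ((|Real.sin θ| * q.eval (Real.sin θ ^ 2)) * |Real.sin (θ / 2)|) =
        G * (Real.sin θ * q.eval (Real.sin θ ^ 2) * Real.sin (θ / 2)) := by
      linear_combination (-G * q.eval (Real.sin θ ^ 2)) * hsgn
    rw [heq] at hgoal
    refine hgoal.trans (le_of_eq ?_)
    ring

/-- A word that halves the angle of an `x`-rotation. -/
theorem exists_half_angle_word {γ e : ℝ} (hγ : 0 < γ) (hγ1 : γ ≤ 1) (he : 0 < e) (he1 : e ≤ 1) :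
    ∃ (α : ℝ) (l : List ℝ),
      (l.length : ℝ) ≤ 80 * (γ ^ 2)⁻¹ * (1 + Real.log (1 / (γ * (e ^ 2 / 6)))) ∧
      ∀ θ : ℝ, |θ| ≤ Real.pi / 2 → γ ≤ Real.cos θ →
        ‖qspWord α l (rotX θ) - rotX (θ / 2)‖ ≤ e := by
  -- The defect 3η enters the squared distance twice, so 6η = e².
  obtain ⟨d, A, hA, hA1, hd, hre⟩ := exists_half_angle_trigPoly hγ hγ1 (η := e ^ 2 / 6)
    (by positivity) (by nlinarith)
  obtain ⟨α, l, hl, hw⟩ := exists_qspWord_norm_sub hA hA1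
  refine ⟨α, l, by rwa [hl], fun θ h1 h2 => ?_⟩
  have h3 := hw 0 θ (Complex.exp (((θ / 2 : ℝ) : ℂ) * Complex.I)) (Complex.norm_exp_ofReal_mul_I _)
  rw [← twisted_eq_su2, ← rotX_eq_twisted, ← rotX_eq_twisted] at h3
  refine (pow_le_pow_iff_left₀ (norm_nonneg _) he.le two_ne_zero).1 ?_
  rw [h3]
  linarith [hre θ h1 h2]

end

end Correction

namespace Correction

open Matrix

set_option linter.unusedSimpArgs false

noncomputable section

/-! ### Circuits -/

namespace QueryCircuit

variable {n : ℕ} {Q : Type}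

theorem run_append_singleton (V : unitaryGroup (Register n) ℂ)
    (l : List (Q × unitaryGroup (Register n) ℂ)) (r : Q × unitaryGroup (Register n) ℂ)
    (call : Q → Matrix (Register n) (Register n) ℂ) :
    (⟨V, l ++ [r]⟩ : QueryCircuit n Q).run call =
      (r.2 : Matrix (Register n) (Register n) ℂ) * call r.1 * (⟨V, l⟩ : QueryCircuit n Q).run call := by
  simp [run]

theorem run_mem_unitaryGroup (c : QueryCircuit n Q)
    {call : Q → Matrix (Register n) (Register n) ℂ}
    (h : ∀ q, call q ∈ unitaryGroup (Register n) ℂ) : c.run call ∈ unitaryGroup (Register n) ℂ := by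
  obtain ⟨V, l⟩ := c
  induction l using List.reverseRecOn with
  | nil => exact V.2
  | append_singleton l r ih =>
    rw [run_append_singleton]
    exact mul_mem (mul_mem r.2.2 (h r.1)) ih

end QueryCircuit

theorem norm_le_one_of_mem_unitaryGroup {m : Type*} [Fintype m] [DecidableEq m]
    {A : Matrix m m ℂ} (h : A ∈ unitaryGroup m ℂ) : ‖A‖ ≤ 1 := by
  rcases isEmpty_or_nonempty m with hm | hm
  · rw [Subsingleton.elim A 0, norm_zero]
    exact zero_le_one
  · exact (CStarRing.norm_of_mem_unitary h).le

theorem norm_mul_sub_mul_le {m : Type*} [Fintype m] [DecidableEq m] {A A' B B' : Matrix m m ℂ}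
    {a b : ℝ} (hA : ‖A - A'‖ ≤ a) (hB : ‖B - B'‖ ≤ b) (hA1 : ‖A‖ ≤ 1) (hB1 : ‖B'‖ ≤ 1) :
    ‖A * B - A' * B'‖ ≤ a + b := by
  have h : A * B - A' * B' = (A - A') * B' + A * (B - B') := by noncomm_ring
  rw [h]
  refine (norm_add_le _ _).trans (add_le_add ?_ ?_)
  · exact (norm_mul_le _ _).trans
      ((mul_le_of_le_one_right (norm_nonneg _) hB1).trans hA)
  · exact (norm_mul_le _ _).trans
      ((mul_le_of_le_one_left (norm_nonneg _) hA1).trans hB)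

/-- Telescoping: calls are exchanged one at a time between unitaries, so each contributes at most ν
and errors only add. -/
theorem QueryCircuit.norm_run_sub_le {n : ℕ} {Q : Type} (c : QueryCircuit n Q)
    {call call' : Q → Matrix (Register n) (Register n) ℂ} {ν : ℝ}
    (h : ∀ q, call q ∈ unitaryGroup (Register n) ℂ)
    (h' : ∀ q, call' q ∈ unitaryGroup (Register n) ℂ)
    (hν : ∀ q, ‖call q - call' q‖ ≤ ν) : ‖c.run call - c.run call'‖ ≤ c.calls * ν := by
  obtain ⟨V, l⟩ := c
  induction l using List.reverseRecOn with
  | nil => simp [QueryCircuit.run, QueryCircuit.calls]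
  | append_singleton l r ih =>
    rw [QueryCircuit.run_append_singleton, QueryCircuit.run_append_singleton]
    have h1 : ‖(r.2 : Matrix (Register n) (Register n) ℂ) * call r.1 -
        (r.2 : Matrix (Register n) (Register n) ℂ) * call' r.1‖ ≤ ν := by
      rw [← mul_sub]
      exact (norm_mul_le _ _).trans ((mul_le_of_le_one_left (norm_nonneg _)
        (norm_le_one_of_mem_unitaryGroup r.2.2)).trans (hν r.1))
    have h2 := norm_mul_sub_mul_le h1 ih (norm_le_one_of_mem_unitaryGroup (mul_mem r.2.2 (h r.1)))
      (norm_le_one_of_mem_unitaryGroup (QueryCircuit.run_mem_unitaryGroup ⟨V, l⟩ h'))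
    refine h2.trans (le_of_eq ?_)
    simp only [QueryCircuit.calls, List.length_append, List.length_singleton]
    push_cast
    ring

/-- The operator `F U` is applied by a circuit with exactly `d` calls to `U`. -/
def Realizable {n : ℕ} {Q : Type}
    (call : Matrix (Fin 2) (Fin 2) ℂ → Q → Matrix (Register n) (Register n) ℂ) (d : ℕ)
    (F : Matrix (Fin 2) (Fin 2) ℂ → Matrix (Register n) (Register n) ℂ) : Prop :=
  ∃ c : QueryCircuit n Q, c.calls = d ∧ ∀ U, c.run (call U) = F U

section Realizable

variable {n : ℕ} {Q : Type}
  {call : Matrix (Fin 2) (Fin 2) ℂ → Q → Matrix (Register n) (Register n) ℂ}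
  {F G : Matrix (Fin 2) (Fin 2) ℂ → Matrix (Register n) (Register n) ℂ} {d e : ℕ}

theorem realizable_const {V : Matrix (Register n) (Register n) ℂ}
    (hV : V ∈ unitaryGroup (Register n) ℂ) : Realizable call 0 fun _ => V :=
  ⟨⟨⟨V, hV⟩, []⟩, rfl, fun _ => rfl⟩

theorem realizable_call (q : Q) : Realizable call 1 fun U => call U q :=
  ⟨⟨1, [(q, 1)]⟩, rfl, fun U => by simp [QueryCircuit.run]⟩

theorem Realizable.congr (hF : Realizable call d F) (h : ∀ U, G U = F U) :
    Realizable call d G := by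
  obtain ⟨c, hc, hcF⟩ := hF
  exact ⟨c, hc, fun U => (hcF U).trans (h U).symm⟩

/-- A fixed unitary merges into the last fixed unitary of the circuit and therefore costs no call.
-/
theorem Realizable.const_mul {V : Matrix (Register n) (Register n) ℂ}
    (hV : V ∈ unitaryGroup (Register n) ℂ) (hF : Realizable call d F) :
    Realizable call d fun U => V * F U := by
  obtain ⟨⟨W, l⟩, hc, hcF⟩ := hF
  rcases List.eq_nil_or_concat l with rfl | ⟨l, r, rfl⟩
  · refine ⟨⟨⟨V, hV⟩ * W, []⟩, hc, fun U => ?_⟩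
    change _ = V * F U
    rw [← hcF]
    rfl
  · refine ⟨⟨W, l ++ [(r.1, ⟨V, hV⟩ * r.2)]⟩, by
      rw [← hc]; simp [QueryCircuit.calls], fun U => ?_⟩
    change _ = V * F U
    rw [← hcF, List.concat_eq_append, QueryCircuit.run_append_singleton,
      QueryCircuit.run_append_singleton]
    simp [mul_assoc]

theorem Realizable.mul (hF : Realizable call d F) (hG : Realizable call e G) :
    Realizable call (d + e) fun U => F U * G U := by
  obtain ⟨⟨W, l⟩, hc, hcF⟩ := hF
  have key : Realizable call (l.length + e)
      fun U => (⟨W, l⟩ : QueryCircuit n Q).run (call U) * G U := by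
    clear hc hcF
    induction l using List.reverseRecOn with
    | nil => simpa [QueryCircuit.run] using hG.const_mul W.2
    | append_singleton l r ih =>
      obtain ⟨⟨V, l'⟩, hc, hcF⟩ := ih
      refine ⟨⟨V, l' ++ [r]⟩, ?_, fun U => ?_⟩
      · simp only [QueryCircuit.calls, List.length_append, List.length_singleton] at hc ⊢
        omega
      · change _ = _ * G U
        rw [QueryCircuit.run_append_singleton, hcF, QueryCircuit.run_append_singleton]
        simp only [mul_assoc]
  rw [← hc]
  exact key.congr fun U => by rw [hcF]

end Realizable

/-! ### Gates on a register -/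

/-- Splitting off the coordinate t identifies the gate with U ⊗ 1, from which multiplicativity is
inherited. -/
theorem plainCall_eq_submatrix {n : ℕ} (U : Matrix (Fin 2) (Fin 2) ℂ) (t : Fin n) :
    plainCall U t = (kroneckerMap (· * ·) U (1 : Matrix ({j // j ≠ t} → Fin 2) ({j // j ≠ t} → Fin 2) ℂ)).submatrix
      (Equiv.funSplitAt t (Fin 2)) (Equiv.funSplitAt t (Fin 2)) := by
  ext x y
  have h : (∀ k, k ≠ t → x k = y k) ↔
      (fun j : {j // j ≠ t} => x j) = fun j : {j // j ≠ t} => y j := by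
    rw [funext_iff]
    simp
  simp only [plainCall, of_apply, submatrix_apply, kroneckerMap_apply,
    Equiv.funSplitAt_apply, one_apply, h]
  split_ifs <;> simp

/-- Applying a gate to the qubit `t`, as a homomorphism. -/
def plainHom {n : ℕ} (t : Fin n) :
    Matrix (Fin 2) (Fin 2) ℂ →⋆ₐ[ℂ] Matrix (Register n) (Register n) ℂ where
  toFun U := plainCall U t
  map_one' := by rw [plainCall_eq_submatrix, one_kronecker_one, submatrix_one_equiv]
  map_mul' U V := by
    rw [plainCall_eq_submatrix, plainCall_eq_submatrix, plainCall_eq_submatrix,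
      submatrix_mul_equiv, ← mul_kronecker_mul, one_mul]
  map_zero' := by
    ext x y
    simp [plainCall]
  map_add' U V := by
    ext x y
    simp only [plainCall, of_apply, Matrix.add_apply]
    split_ifs <;> simp
  commutes' c := by
    rw [Algebra.algebraMap_eq_smul_one, Algebra.algebraMap_eq_smul_one]
    have : plainCall (c • (1 : Matrix (Fin 2) (Fin 2) ℂ)) t = c • plainCall 1 t := by
      ext x y
      simp only [plainCall, of_apply, Matrix.smul_apply]
      split_ifs <;> simp
    rw [this, plainCall_eq_submatrix, one_kronecker_one, submatrix_one_equiv]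
  map_star' U := by
    ext x y
    simp only [plainCall, of_apply, star_apply, eq_comm]
    split_ifs <;> simp

theorem plainHom_apply {n : ℕ} (t : Fin n) (U : Matrix (Fin 2) (Fin 2) ℂ) :
    plainHom t U = plainCall U t := rfl

theorem norm_plainHom_le {n : ℕ} (t : Fin n) (U : Matrix (Fin 2) (Fin 2) ℂ) :
    ‖plainHom t U‖ ≤ ‖U‖ :=
  NonUnitalStarAlgHom.norm_apply_le (plainHom t) U

theorem plainHom_mem_unitaryGroup {n : ℕ} (t : Fin n) {U : Matrix (Fin 2) (Fin 2) ℂ}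
    (hU : U ∈ unitaryGroup (Fin 2) ℂ) : plainHom t U ∈ unitaryGroup (Register n) ℂ :=
  Unitary.map_mem (plainHom t) hU

theorem plainHom_mul_plainHom_apply {n : ℕ} {s t : Fin n} (hst : s ≠ t)
    (A B : Matrix (Fin 2) (Fin 2) ℂ) (x y : Register n) :
    (plainHom s A * plainHom t B) x y =
      if ∀ k, k ≠ s → k ≠ t → x k = y k then A (x s) (y s) * B (x t) (y t) else 0 := by
  classical
  rw [mul_apply, Finset.sum_eq_single (Function.update x s (y s))]
  · simp only [plainHom_apply, plainCall, of_apply, Function.update_self,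
      Function.update_of_ne hst.symm]
    have h1 : ∀ k, k ≠ s → x k = Function.update x s (y s) k := fun k hk => by
      rw [Function.update_of_ne hk]
    have h2 : (∀ k, k ≠ t → Function.update x s (y s) k = y k) ↔
        ∀ k, k ≠ s → k ≠ t → x k = y k := by
      constructor
      · intro h k hks hkt
        rw [← h k hkt, Function.update_of_ne hks]
      · intro h k hkt
        by_cases hks : k = s
        · subst hks
          rw [Function.update_self]
        · rw [Function.update_of_ne hks, h k hks hkt]
    rw [if_pos h1]
    simp only [h2]
    split_ifs <;> simp
  · intro z _ hz
    simp only [plainHom_apply, plainCall, of_apply]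
    by_cases h1 : ∀ k, k ≠ s → x k = z k
    · by_cases h2 : ∀ k, k ≠ t → z k = y k
      · exfalso
        apply hz
        funext k
        by_cases hks : k = s
        · subst hks
          rw [Function.update_self, h2 k hst]
        · rw [Function.update_of_ne hks, h1 k hks]
      · rw [if_neg h2, mul_zero]
    · rw [if_neg h1, zero_mul]
  · intro h
    exact absurd (Finset.mem_univ _) h

theorem plainHom_commute {n : ℕ} {s t : Fin n} (hst : s ≠ t) (A B : Matrix (Fin 2) (Fin 2) ℂ) :
    plainHom s A * plainHom t B = plainHom t B * plainHom s A := by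
  ext x y
  rw [plainHom_mul_plainHom_apply hst, plainHom_mul_plainHom_apply hst.symm]
  have : (∀ k, k ≠ s → k ≠ t → x k = y k) ↔ (∀ k, k ≠ t → k ≠ s → x k = y k) :=
    ⟨fun h k h1 h2 => h k h2 h1, fun h k h1 h2 => h k h2 h1⟩
  simp only [this, mul_comm]

/-! ### Gates selected by a control qubit, and the untwisting conjugation. -/

/-- The projection to the basis state `0` of a qubit. -/
def projZero : Matrix (Fin 2) (Fin 2) ℂ := !![1, 0; 0, 0]

/-- The projection to the basis state `1` of a qubit. -/
def projOne : Matrix (Fin 2) (Fin 2) ℂ := !![0, 0; 0, 1]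

/-- Apply `A` or `B` to the qubit `t`, depending on the state of the qubit `s`. -/
def select {n : ℕ} (s t : Fin n) (A B : Matrix (Fin 2) (Fin 2) ℂ) :
    Matrix (Register n) (Register n) ℂ :=
  plainHom s projZero * plainHom t A + plainHom s projOne * plainHom t B

theorem projZero_mul_projZero : projZero * projZero = projZero := by
  ext i j; fin_cases i <;> fin_cases j <;> simp [projZero]

theorem projOne_mul_projOne : projOne * projOne = projOne := by
  ext i j; fin_cases i <;> fin_cases j <;> simp [projOne]

theorem projZero_mul_projOne : projZero * projOne = 0 := by
  ext i j; fin_cases i <;> fin_cases j <;> simp [projZero, projOne]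

theorem projOne_mul_projZero : projOne * projZero = 0 := by
  ext i j; fin_cases i <;> fin_cases j <;> simp [projZero, projOne]

theorem projZero_add_projOne : projZero + projOne = 1 := by
  ext i j; fin_cases i <;> fin_cases j <;> simp [projZero, projOne]

theorem projZero_sub_projOne : projZero - projOne = sigmaZ := by
  ext i j; fin_cases i <;> fin_cases j <;> simp [projZero, projOne, sigmaZ]

theorem projZero_mul_sigmaX : projZero * sigmaX = sigmaX * projOne := by
  ext i j; fin_cases i <;> fin_cases j <;> simp [projZero, projOne, sigmaX]

theorem projOne_mul_sigmaX : projOne * sigmaX = sigmaX * projZero := by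
  ext i j; fin_cases i <;> fin_cases j <;> simp [projZero, projOne, sigmaX]

theorem star_projZero : star projZero = projZero := by
  ext i j; fin_cases i <;> fin_cases j <;> simp [projZero]

theorem star_projOne : star projOne = projOne := by
  ext i j; fin_cases i <;> fin_cases j <;> simp [projOne]

theorem norm_le_one_of_star_eq_of_mul_self {A : Matrix (Fin 2) (Fin 2) ℂ} (h1 : star A = A)
    (h2 : A * A = A) : ‖A‖ ≤ 1 := by
  have h := CStarRing.norm_star_mul_self (x := A)
  rw [h1, h2] at h
  by_contra! hlt
  nlinarith

theorem controlledCall_eq_select {n : ℕ} (U : Matrix (Fin 2) (Fin 2) ℂ) (q : ControlledCall n) :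
    controlledCall U q = select q.1.1 q.1.2 1 U := by
  have key : ∀ i j : Fin 2, ∀ V W : ℂ, (projZero i j * V + projOne i j * W) =
      if i = j then (if i = 1 then W else V) else 0 := by
    intro i j V W
    fin_cases i <;> fin_cases j <;> simp [projZero, projOne]
  ext x y
  rw [select, Matrix.add_apply, plainHom_mul_plainHom_apply q.2, plainHom_mul_plainHom_apply q.2]
  have h : (∀ k, k ≠ q.1.2 → x k = y k) ↔
      (x q.1.1 = y q.1.1 ∧ ∀ k, k ≠ q.1.1 → k ≠ q.1.2 → x k = y k) := by
    constructor
    · exact fun h => ⟨h _ q.2, fun k _ => h k⟩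
    · rintro ⟨h1, h2⟩ k hk
      by_cases hks : k = q.1.1
      · rw [hks, h1]
      · exact h2 k hks hk
  by_cases h2 : ∀ k, k ≠ q.1.1 → k ≠ q.1.2 → x k = y k
  · rw [if_pos h2, if_pos h2, key]
    simp only [controlledCall, of_apply, h, and_iff_left h2]
    split_ifs <;> rfl
  · rw [if_neg h2, if_neg h2]
    simp only [controlledCall, of_apply, h, h2, and_false, if_false, add_zero]

section Select

variable {n : ℕ} {s t : Fin n}

theorem select_self (A : Matrix (Fin 2) (Fin 2) ℂ) : select s t A A = plainHom t A := by
  rw [select, ← add_mul, ← map_add, projZero_add_projOne, map_one, one_mul]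

theorem select_mul (hst : s ≠ t) (A B A' B' : Matrix (Fin 2) (Fin 2) ℂ) :
    select s t A B * select s t A' B' = select s t (A * A') (B * B') := by
  have key : ∀ P Q V W : Matrix (Fin 2) (Fin 2) ℂ,
      plainHom s P * plainHom t V * (plainHom s Q * plainHom t W) =
        plainHom s (P * Q) * plainHom t (V * W) := by
    intro P Q V W
    rw [map_mul, map_mul, mul_assoc, ← mul_assoc (plainHom t V), ← plainHom_commute hst]
    simp only [mul_assoc]
  rw [select, select, add_mul, mul_add, mul_add, key, key, key, key, projZero_mul_projZero,
    projOne_mul_projOne, projZero_mul_projOne, projOne_mul_projZero, map_zero, zero_mul, zero_mul,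
    add_zero, zero_add, select]

theorem select_sub (A B A' B' : Matrix (Fin 2) (Fin 2) ℂ) :
    select s t A B - select s t A' B' = select s t (A - A') (B - B') := by
  rw [select, select, select, map_sub, map_sub]
  noncomm_ring

theorem star_select (hst : s ≠ t) (A B : Matrix (Fin 2) (Fin 2) ℂ) :
    star (select s t A B) = select s t (star A) (star B) := by
  rw [select, select, star_add, star_mul, star_mul, ← map_star, ← map_star, ← map_star,
    ← map_star, star_projZero, star_projOne, plainHom_commute hst, plainHom_commute hst]

theorem select_mem_unitaryGroup (hst : s ≠ t) {A B : Matrix (Fin 2) (Fin 2) ℂ}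
    (hA : A ∈ unitaryGroup (Fin 2) ℂ) (hB : B ∈ unitaryGroup (Fin 2) ℂ) :
    select s t A B ∈ unitaryGroup (Register n) ℂ := by
  rw [mem_unitaryGroup_iff, star_select hst, select_mul hst, mem_unitaryGroup_iff.1 hA,
    mem_unitaryGroup_iff.1 hB, select_self, map_one]

theorem norm_select_le (A B : Matrix (Fin 2) (Fin 2) ℂ) :
    ‖select s t A B‖ ≤ ‖A‖ + ‖B‖ := by
  have h : ∀ P V : Matrix (Fin 2) (Fin 2) ℂ, ‖P‖ ≤ 1 → ‖plainHom s P * plainHom t V‖ ≤ ‖V‖ :=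
    fun P V hP => (norm_mul_le _ _).trans ((mul_le_mul ((norm_plainHom_le s P).trans hP)
      (norm_plainHom_le t V) (norm_nonneg _) zero_le_one).trans (one_mul _).le)
  exact (norm_add_le _ _).trans (add_le_add
    (h _ _ (norm_le_one_of_star_eq_of_mul_self star_projZero projZero_mul_projZero))
    (h _ _ (norm_le_one_of_star_eq_of_mul_self star_projOne projOne_mul_projOne)))

theorem select_mul_sigmaX (hst : s ≠ t) (A B : Matrix (Fin 2) (Fin 2) ℂ) :
    select s t A B * plainHom s sigmaX = plainHom s sigmaX * select s t B A := by
  rw [select, select, add_mul, mul_add, mul_assoc, mul_assoc, ← plainHom_commute hst,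
    ← plainHom_commute hst, ← mul_assoc, ← mul_assoc, ← map_mul, ← map_mul, projZero_mul_sigmaX,
    projOne_mul_sigmaX, map_mul, map_mul, add_comm, mul_assoc, mul_assoc]

theorem select_neg (A : Matrix (Fin 2) (Fin 2) ℂ) :
    select s t A (-A) = plainHom s sigmaZ * plainHom t A := by
  rw [select, map_neg, ← projZero_sub_projOne, map_sub]
  noncomm_ring

/-- The controlled `σ_z` gate with the control in the eigenbasis of `σ_x`. -/
def parityGate (s t : Fin n) : Matrix (Register n) (Register n) ℂ :=
  plainHom s hadamard * select s t 1 sigmaZ * plainHom s hadamard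

theorem plainHom_hadamard_mul_self (s : Fin n) :
    plainHom s hadamard * plainHom s hadamard = 1 := by
  rw [← map_mul, hadamard_mul_self, map_one]

theorem parityGate_mul_self (hst : s ≠ t) : parityGate s t * parityGate s t = 1 := by
  have h := plainHom_hadamard_mul_self s
  calc parityGate s t * parityGate s t = plainHom s hadamard * select s t 1 sigmaZ *
        (plainHom s hadamard * plainHom s hadamard) * select s t 1 sigmaZ * plainHom s hadamard := by
        simp only [parityGate, mul_assoc]
    _ = 1 := by
        rw [h, mul_one, mul_assoc (plainHom s hadamard), select_mul hst, one_mul, sigmaZ_mul_self,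
          select_self, map_one, mul_one, h]

/-- The axis reflection anticommutes with σ_z, so conjugation by the controlled σ_z attaches a sign
to the branch 1, that is, a σ_z on the control. The Hadamard gates turn it into σ_x. -/
theorem parityGate_mul_axis (hst : s ≠ t) (φ : ℝ) :
    parityGate s t * plainHom t (axis φ) * parityGate s t =
      plainHom s sigmaX * plainHom t (axis φ) := by
  have h := plainHom_hadamard_mul_self s
  have hz : sigmaZ * axis φ * sigmaZ = -axis φ := by
    rw [sigmaZ_mul_axis, neg_mul, mul_assoc, sigmaZ_mul_self, mul_one]
  calc parityGate s t * plainHom t (axis φ) * parityGate s t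
      = plainHom s hadamard * select s t 1 sigmaZ * (plainHom s hadamard *
        plainHom t (axis φ)) * plainHom s hadamard * select s t 1 sigmaZ *
          plainHom s hadamard := by simp only [parityGate, mul_assoc]
    _ = plainHom s hadamard * (select s t 1 sigmaZ * select s t (axis φ) (axis φ) *
          select s t 1 sigmaZ) * plainHom s hadamard := by
        rw [plainHom_commute hst, select_self]
        simp only [mul_assoc]
        rw [← mul_assoc (plainHom s hadamard) (plainHom s hadamard), h, one_mul]
    _ = plainHom s hadamard * (plainHom s sigmaZ * plainHom t (axis φ)) *
          plainHom s hadamard := by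
        rw [select_mul hst, select_mul hst, one_mul, mul_one, hz, select_neg]
    _ = plainHom s (hadamard * sigmaZ * hadamard) * plainHom t (axis φ) := by
        rw [map_mul, map_mul]
        simp only [mul_assoc]
        rw [plainHom_commute hst]
    _ = _ := by rw [hadamard_sigmaZ_hadamard]

/-- The conjugation that moves the action of a twisted unitary on the qubit `t` to the action of
its untwisted version on the qubit `s`. -/
theorem select_axis_conj (hst : s ≠ t) (φ θ : ℝ) :
    select s t 1 (axis φ) * parityGate s t * plainHom t (twisted φ θ) * parityGate s t *
      select s t 1 (axis φ) = plainHom s (rotX θ) := by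
  have h1 : select s t 1 (axis φ) * parityGate s t * plainHom t 1 * parityGate s t *
      select s t 1 (axis φ) = 1 := by
    rw [map_one, mul_one, mul_assoc (select s t 1 (axis φ)), parityGate_mul_self hst, mul_one,
      select_mul hst, axis_mul_self, one_mul, select_self, map_one]
  -- Moving σ_x through the control swaps the two branches. They then contribute n·n·1 and 1·n·n,
  -- both the identity, and only σ_x on s remains; the claim for the twisted unitary follows by
  -- linearity in 1 and n.
  have h2 : select s t 1 (axis φ) * parityGate s t * plainHom t (axis φ) * parityGate s t *
      select s t 1 (axis φ) = plainHom s sigmaX := by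
    have h3 : select s t 1 (axis φ) * parityGate s t * plainHom t (axis φ) * parityGate s t =
        select s t 1 (axis φ) *
          (parityGate s t * plainHom t (axis φ) * parityGate s t) := by
      simp only [mul_assoc]
    rw [h3, parityGate_mul_axis hst, ← mul_assoc, select_mul_sigmaX hst, ← select_self (s := s) (axis φ),
      mul_assoc, mul_assoc, select_mul hst, select_mul hst, axis_mul_self, one_mul, mul_one,
      axis_mul_self, select_self, map_one, mul_one]
  rw [twisted_eq, rotX_eq_smul, map_add, map_add, map_smul, map_smul, map_smul, map_smul, mul_add,
    add_mul, add_mul]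
  simp only [mul_smul_comm, smul_mul_assoc]
  rw [h1, h2, map_one]

theorem parityGate_mem_unitaryGroup (hst : s ≠ t) :
    parityGate s t ∈ unitaryGroup (Register n) ℂ := by
  have hH := plainHom_mem_unitaryGroup s
    (mem_unitary_of_star_eq_of_mul_self star_hadamard hadamard_mul_self)
  exact mul_mem (mul_mem hH (select_mem_unitaryGroup hst (one_mem _)
    (mem_unitary_of_star_eq_of_mul_self star_sigmaZ sigmaZ_mul_self))) hH

end Select

end

end Correction

namespace Correction

open Matrix

set_option linter.unusedSimpArgs false

noncomputable section

/-! ### Output of a circuit -/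

/-- The isometry that adjoins ancillas in the state `0`. -/
def adjoinZeros (a : ℕ) : Matrix (Register (a + 1)) (Fin 2) ℂ :=
  Matrix.of fun x i => if x = Fin.cons (α := fun _ => Fin 2) i (fun _ => 0) then 1 else 0

/-- The compression of an operator of the register to the system qubit. -/
def compress {a : ℕ} (M : Matrix (Register (a + 1)) (Register (a + 1)) ℂ) :
    Matrix (Fin 2) (Fin 2) ℂ :=
  Matrix.of fun i j => M (Fin.cons (α := fun _ => Fin 2) i fun _ => 0)
    (Fin.cons (α := fun _ => Fin 2) j fun _ => 0)

theorem cons_zero_injective (a : ℕ) : Function.Injective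
    fun i : Fin 2 => (Fin.cons (α := fun _ => Fin 2) i (fun _ => 0) : Register (a + 1)) := by
  intro i j h
  have := congrFun h 0
  simpa using this

theorem mul_adjoinZeros_apply {a : ℕ} {m : Type*} (M : Matrix m (Register (a + 1)) ℂ) (x : m)
    (j : Fin 2) : (M * adjoinZeros a) x j = M x (Fin.cons (α := fun _ => Fin 2) j fun _ => 0) := by
  simp [mul_apply, adjoinZeros]

theorem conjTranspose_adjoinZeros_mul_apply {a : ℕ} {m : Type*}
    (M : Matrix (Register (a + 1)) m ℂ) (i : Fin 2) (y : m) :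
    ((adjoinZeros a)ᴴ * M) i y = M (Fin.cons (α := fun _ => Fin 2) i fun _ => 0) y := by
  simp only [mul_apply, conjTranspose_apply, adjoinZeros, of_apply]
  rw [Finset.sum_eq_single (Fin.cons (α := fun _ => Fin 2) i fun _ => 0)]
  · simp
  · intro x _ hx
    rw [if_neg hx]
    simp
  · intro h
    exact absurd (Finset.mem_univ _) h

theorem compress_eq {a : ℕ} (M : Matrix (Register (a + 1)) (Register (a + 1)) ℂ) :
    compress M = (adjoinZeros a)ᴴ * M * adjoinZeros a := by
  ext i j
  rw [mul_adjoinZeros_apply, conjTranspose_adjoinZeros_mul_apply]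
  rfl

theorem adjoinZeros_isometry (a : ℕ) : (adjoinZeros a)ᴴ * adjoinZeros a = 1 := by
  ext i j
  rw [mul_adjoinZeros_apply]
  simp only [conjTranspose_apply, adjoinZeros, of_apply, one_apply, (cons_zero_injective a).eq_iff]
  by_cases h : i = j
  · simp [h]
  · simp [h, Ne.symm h]

theorem norm_adjoinZeros (a : ℕ) : ‖adjoinZeros a‖ = 1 := by
  have h := l2_opNorm_conjTranspose_mul_self (adjoinZeros a)
  rw [adjoinZeros_isometry, norm_one] at h
  nlinarith [norm_nonneg (adjoinZeros a)]

theorem plainCall_mul_adjoinZeros {a : ℕ} (W : Matrix (Fin 2) (Fin 2) ℂ) :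
    plainCall W (0 : Fin (a + 1)) * adjoinZeros a = adjoinZeros a * W := by
  ext x j
  rw [mul_adjoinZeros_apply]
  simp only [plainCall, of_apply, Fin.cons_zero, mul_apply, adjoinZeros]
  have h : ∀ i : Fin 2, x = Fin.cons (α := fun _ => Fin 2) i (fun _ => 0) ↔
      x 0 = i ∧ ∀ k, k ≠ 0 → x k = (Fin.cons (α := fun _ => Fin 2) j (fun _ => 0) : Register (a + 1)) k := by
    intro i
    constructor
    · rintro rfl
      refine ⟨rfl, fun k hk => ?_⟩
      obtain ⟨k, rfl⟩ := Fin.exists_succ_eq.2 hk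
      simp
    · rintro ⟨h1, h2⟩
      funext k
      refine Fin.cases ?_ (fun k => ?_) k
      · simpa using h1
      · rw [h2 _ (Fin.succ_ne_zero k)]
        simp
  simp only [h]
  split_ifs with h1
  · simp only [and_iff_left h1]
    simp
  · simp only [h1, and_false, if_false, zero_mul, Finset.sum_const_zero]

theorem compress_plainHom {a : ℕ} (W : Matrix (Fin 2) (Fin 2) ℂ) :
    compress (plainHom (0 : Fin (a + 1)) W) = W := by
  rw [compress_eq, plainHom_apply, Matrix.mul_assoc, plainCall_mul_adjoinZeros, ← Matrix.mul_assoc,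
    adjoinZeros_isometry, Matrix.one_mul]

theorem norm_compress_le {a : ℕ} (M : Matrix (Register (a + 1)) (Register (a + 1)) ℂ) :
    ‖compress M‖ ≤ ‖M‖ := by
  rw [compress_eq]
  refine (l2_opNorm_mul _ _).trans ?_
  rw [norm_adjoinZeros, mul_one]
  refine (l2_opNorm_mul _ _).trans ?_
  rw [l2_opNorm_conjTranspose, norm_adjoinZeros, one_mul]

theorem compress_sub {a : ℕ} (M N : Matrix (Register (a + 1)) (Register (a + 1)) ℂ) :
    compress (M - N) = compress M - compress N := rfl

theorem norm_branch_le (K : Matrix (Fin 2) (Fin 2) ℂ) (ψ : EuclideanSpace ℂ (Fin 2)) :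
    ‖branch K ψ‖ ≤ ‖K‖ * ‖ψ‖ := by
  rw [branch, ← l2_opNorm_toEuclideanCLM K]
  exact ContinuousLinearMap.le_opNorm _ _

theorem inner_branch_star_mul (A B : Matrix (Fin 2) (Fin 2) ℂ) (ψ : EuclideanSpace ℂ (Fin 2)) :
    inner ℂ ψ (branch (star A * B) ψ) = inner ℂ (branch A ψ) (branch B ψ) := by
  rw [branch, branch, branch, map_mul, map_star, ContinuousLinearMap.star_eq_adjoint,
    mul_apply_eq_comp, ContinuousLinearMap.adjoint_inner_right]

theorem norm_branch_of_mem_unitaryGroup {W : Matrix (Fin 2) (Fin 2) ℂ}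
    (hW : W ∈ unitaryGroup (Fin 2) ℂ) (ψ : EuclideanSpace ℂ (Fin 2)) : ‖branch W ψ‖ = ‖ψ‖ := by
  have h := inner_branch_star_mul W W ψ
  rw [mem_unitaryGroup_iff'.1 hW] at h
  have h1 : branch 1 ψ = ψ := by simp [branch]
  rw [h1, inner_self_eq_norm_sq_to_K, inner_self_eq_norm_sq_to_K] at h
  have h2 : ‖ψ‖ ^ 2 = ‖branch W ψ‖ ^ 2 := by exact_mod_cast h
  exact ((pow_left_inj₀ (norm_nonneg _) (norm_nonneg _) two_ne_zero).1 h2).symm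

/-- Normalizing a subnormalized vector moves it closer to a unit vector with which it has a
positive overlap. -/
theorem norm_normalize_sub_le {u v : EuclideanSpace ℂ (Fin 2)} {η : ℝ} (hu : ‖u‖ = 1)
    (hv : ‖v‖ ≤ 1) (hη0 : 0 ≤ η) (hη : η ≤ 1) (h : 2 - 2 * (inner ℂ u v).re ≤ η ^ 2) :
    ‖((‖v‖⁻¹ : ℝ) : ℂ) • v - u‖ ≤ η := by
  have hre : 1 / 2 ≤ (inner ℂ u v).re := by nlinarith
  have hv0 : 0 < ‖v‖ := by
    rw [norm_pos_iff]
    rintro rfl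
    simp at hre
    norm_num at hre
  have hinv : 1 ≤ ‖v‖⁻¹ := (one_le_inv₀ hv0).2 hv
  refine (pow_le_pow_iff_left₀ (norm_nonneg _) hη0 two_ne_zero).1 ?_
  have h1 : ‖((‖v‖⁻¹ : ℝ) : ℂ) • v‖ = 1 := by
    rw [norm_smul, Complex.norm_real, Real.norm_eq_abs, abs_of_nonneg (by positivity),
      inv_mul_cancel₀ hv0.ne']
  have h2 : (inner ℂ (((‖v‖⁻¹ : ℝ) : ℂ) • v) u).re = ‖v‖⁻¹ * (inner ℂ u v).re := by
    rw [inner_smul_left, Complex.conj_ofReal, Complex.re_ofReal_mul, ← inner_conj_symm v u,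
      Complex.conj_re]
  have h3 := norm_sub_sq (𝕜 := ℂ) (((‖v‖⁻¹ : ℝ) : ℂ) • v) u
  rw [h1, hu] at h3
  have h4 : RCLike.re (inner ℂ (((‖v‖⁻¹ : ℝ) : ℂ) • v) u) = ‖v‖⁻¹ * (inner ℂ u v).re := h2
  rw [h4] at h3
  rw [h3]
  nlinarith

/-- Both M and W ⊗ 1, restricted to zero ancillas, are isometries. The square of their difference
therefore expands to 2 - 2 Re⟨Wψ, Kψ⟩ on a unit vector, with K the compression; this overlap bound
survives normalization without loss, which closeness of K to W alone would not ensure. -/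
theorem implements_of_norm_sub_le {a : ℕ} {M : Matrix (Register (a + 1)) (Register (a + 1)) ℂ}
    {W : Matrix (Fin 2) (Fin 2) ℂ} {η : ℝ} (hM : M ∈ unitaryGroup (Register (a + 1)) ℂ)
    (hW : W ∈ unitaryGroup (Fin 2) ℂ) (h : ‖M - plainHom 0 W‖ ≤ η) :
    Implements (compress M) W η := by
  have hη0 : 0 ≤ η := (norm_nonneg _).trans h
  have hKW : ‖compress M - W‖ ≤ η := by
    have := norm_compress_le (M - plainHom 0 W)
    rw [compress_sub, compress_plainHom] at this
    exact this.trans h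
  refine ⟨hKW, fun hη ψ hψ => ?_⟩
  have hu : ‖branch W ψ‖ = 1 := by rw [norm_branch_of_mem_unitaryGroup hW, hψ]
  have hv : ‖branch (compress M) ψ‖ ≤ 1 := by
    refine (norm_branch_le _ _).trans ?_
    rw [hψ, mul_one]
    exact (norm_compress_le M).trans (norm_le_one_of_mem_unitaryGroup hM)
  constructor
  · have h1 : ‖branch W ψ - branch (compress M) ψ‖ ≤ η := by
      rw [norm_sub_rev]
      have h2 : branch (compress M) ψ - branch W ψ = branch (compress M - W) ψ := by
        simp [branch]
      rw [h2]
      refine (norm_branch_le _ _).trans ?_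
      rw [hψ, mul_one]
      exact hKW
    have h3 := norm_sub_norm_le (branch W ψ) (branch (compress M) ψ)
    rw [hu] at h3
    exact pow_le_pow_left₀ (by linarith) (by linarith) 2
  · refine norm_normalize_sub_le hu hv hη0 hη ?_
    set S : Matrix (Register (a + 1)) (Register (a + 1)) ℂ := plainHom (0 : Fin (a + 1)) W with hS
    set D := (M - S) * adjoinZeros a with hD
    have hDn : ‖D‖ ≤ η := by
      refine (l2_opNorm_mul _ _).trans ?_
      rw [norm_adjoinZeros, mul_one]
      exact h
    have hDD : Dᴴ * D = star (1 : Matrix (Fin 2) (Fin 2) ℂ) * 1 + star (1 : Matrix (Fin 2) (Fin 2) ℂ) * 1 -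
        star W * compress M - star (compress M) * W := by
      have hSJ : S * adjoinZeros a = adjoinZeros a * W := plainCall_mul_adjoinZeros W
      have hM1 : Mᴴ * M = 1 := mem_unitaryGroup_iff'.1 hM
      have hW1 : Wᴴ * W = 1 := mem_unitaryGroup_iff'.1 hW
      have hJ := adjoinZeros_isometry a
      have hD' : D = M * adjoinZeros a - adjoinZeros a * W := by
        rw [hD, Matrix.sub_mul, hSJ]
      have e1 : (adjoinZeros a)ᴴ * Mᴴ * (M * adjoinZeros a) = 1 := by
        rw [Matrix.mul_assoc, ← Matrix.mul_assoc Mᴴ, hM1, Matrix.one_mul, hJ]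
      have e2 : Wᴴ * (adjoinZeros a)ᴴ * (adjoinZeros a * W) = 1 := by
        rw [Matrix.mul_assoc, ← Matrix.mul_assoc (adjoinZeros a)ᴴ, hJ, Matrix.one_mul, hW1]
      rw [hD', conjTranspose_sub, conjTranspose_mul, conjTranspose_mul, Matrix.sub_mul,
        Matrix.mul_sub, Matrix.mul_sub, e1, e2, compress_eq, star_eq_conjTranspose,
        star_eq_conjTranspose, star_eq_conjTranspose, conjTranspose_mul, conjTranspose_mul,
        conjTranspose_conjTranspose, conjTranspose_one, Matrix.one_mul]
      simp only [Matrix.mul_assoc]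
      abel
    have hDDn : ‖Dᴴ * D‖ ≤ η ^ 2 := by
      rw [l2_opNorm_conjTranspose_mul_self, ← sq]
      exact pow_le_pow_left₀ (norm_nonneg _) hDn 2
    have h1 : (inner ℂ ψ (branch (Dᴴ * D) ψ)).re ≤ η ^ 2 := by
      refine (Complex.re_le_norm _).trans ((norm_inner_le_norm _ _).trans ?_)
      rw [hψ, one_mul]
      refine (norm_branch_le _ _).trans ?_
      rw [hψ, mul_one]
      exact hDDn
    have hadd : ∀ A B : Matrix (Fin 2) (Fin 2) ℂ, branch (A + B) ψ = branch A ψ + branch B ψ := by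
      intro A B
      simp [branch]
    have hsub : ∀ A B : Matrix (Fin 2) (Fin 2) ℂ, branch (A - B) ψ = branch A ψ - branch B ψ := by
      intro A B
      simp [branch]
    rw [hDD, hsub, hsub, hadd, inner_sub_right, inner_sub_right, inner_add_right,
      inner_branch_star_mul, inner_branch_star_mul, inner_branch_star_mul,
      ← inner_conj_symm (branch (compress M) ψ)] at h1
    have h2 : branch 1 ψ = ψ := by simp [branch]
    rw [h2, inner_self_eq_norm_sq_to_K, hψ] at h1
    simp only [Complex.sub_re, Complex.add_re, Complex.conj_re] at h1
    norm_num at h1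
    linarith

/-! ### Words as circuits -/

theorem qspWord_mem_unitaryGroup (α : ℝ) (l : List ℝ) {M : Matrix (Fin 2) (Fin 2) ℂ}
    (hM : M ∈ unitaryGroup (Fin 2) ℂ) : qspWord α l M ∈ unitaryGroup (Fin 2) ℂ := by
  induction l using List.reverseRecOn with
  | nil => exact rotZ_mem_unitaryGroup α
  | append_singleton l β ih =>
    rw [qspWord_append_singleton]
    exact mul_mem (mul_mem (rotZ_mem_unitaryGroup β) hM) ih

theorem norm_qspWord_sub_le (α : ℝ) (l : List ℝ) {M N : Matrix (Fin 2) (Fin 2) ℂ}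
    (hM : M ∈ unitaryGroup (Fin 2) ℂ) (hN : N ∈ unitaryGroup (Fin 2) ℂ) {e : ℝ}
    (h : ‖M - N‖ ≤ e) : ‖qspWord α l M - qspWord α l N‖ ≤ l.length * e := by
  induction l using List.reverseRecOn with
  | nil => simp [qspWord]
  | append_singleton l β ih =>
    rw [qspWord_append_singleton, qspWord_append_singleton]
    have hβ := rotZ_mem_unitaryGroup β
    have h0 : ‖rotZ β - rotZ β‖ ≤ 0 := by simp
    have h1 := norm_mul_sub_mul_le h0 h (norm_le_one_of_mem_unitaryGroup hβ)
      (norm_le_one_of_mem_unitaryGroup hN)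
    have h2 := norm_mul_sub_mul_le h1 ih (norm_le_one_of_mem_unitaryGroup (mul_mem hβ hM))
      (norm_le_one_of_mem_unitaryGroup (qspWord_mem_unitaryGroup α l hN))
    refine h2.trans (le_of_eq ?_)
    simp only [List.length_append, List.length_singleton]
    push_cast
    ring

theorem realizable_select_one_qspWord {n : ℕ} {s t : Fin n} (hst : s ≠ t) (α : ℝ) (l : List ℝ) :
    Realizable (controlledCall (n := n)) l.length fun U => select s t 1 (qspWord α l U) := by
  induction l using List.reverseRecOn with
  | nil =>
    exact realizable_const (select_mem_unitaryGroup hst (one_mem _) (rotZ_mem_unitaryGroup α))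
  | append_singleton l β ih =>
    have h := (((realizable_call (call := controlledCall (n := n)) ⟨(s, t), hst⟩).const_mul
      (select_mem_unitaryGroup hst (one_mem _) (rotZ_mem_unitaryGroup β))).mul ih)
    rw [List.length_append, List.length_singleton, add_comm l.length]
    refine h.congr fun U => ?_
    rw [controlledCall_eq_select, select_mul hst, select_mul hst, one_mul, one_mul,
      qspWord_append_singleton]

/-- A plain call acts identically on both branches, so only the z-rotations need a control. The
words must have equal length to share their calls. -/
theorem realizable_select_qspWord {n : ℕ} {s t : Fin n} (hst : s ≠ t) (α α' : ℝ)
    (l l' : List ℝ) (hl : l.length = l'.length) :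
    Realizable (plainCall (n := n)) l.length
      fun U => select s t (qspWord α l U) (qspWord α' l' U) := by
  induction l using List.reverseRecOn generalizing l' with
  | nil =>
    rw [List.length_nil, eq_comm, List.length_eq_zero_iff] at hl
    subst hl
    exact realizable_const (select_mem_unitaryGroup hst (rotZ_mem_unitaryGroup α)
      (rotZ_mem_unitaryGroup α'))
  | append_singleton l β ih =>
    rcases List.eq_nil_or_concat l' with rfl | ⟨l', β', rfl⟩
    · simp at hl
    rw [List.concat_eq_append] at hl ⊢
    have h := (((realizable_call (call := plainCall (n := n)) t).const_mul
      (select_mem_unitaryGroup hst (rotZ_mem_unitaryGroup β) (rotZ_mem_unitaryGroup β'))).mul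
        (ih l' (by simpa using hl)))
    rw [List.length_append, List.length_singleton, add_comm l.length]
    refine h.congr fun U => ?_
    rw [← plainHom_apply, ← select_self (s := s), select_mul hst, select_mul hst,
      qspWord_append_singleton, qspWord_append_singleton]

/-- Here the letter of the word is itself realized by d calls, so nesting multiplies the counts. -/
theorem realizable_qspWord {n : ℕ} {t : Fin n} {d : ℕ}
    {S : Matrix (Fin 2) (Fin 2) ℂ → Matrix (Fin 2) (Fin 2) ℂ}
    (hS : Realizable (plainCall (n := n)) d fun U => plainHom t (S U)) (α : ℝ) (l : List ℝ) :
    Realizable (plainCall (n := n)) (l.length * d) fun U => plainHom t (qspWord α l (S U)) := by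
  induction l using List.reverseRecOn with
  | nil =>
    rw [List.length_nil, zero_mul]
    exact realizable_const (plainHom_mem_unitaryGroup t (rotZ_mem_unitaryGroup α))
  | append_singleton l β ih =>
    have h := (hS.const_mul (plainHom_mem_unitaryGroup t (rotZ_mem_unitaryGroup β))).mul ih
    rw [List.length_append, List.length_singleton, add_mul, one_mul, add_comm]
    refine h.congr fun U => ?_
    rw [qspWord_append_singleton, map_mul, map_mul]

theorem plainCall_mem_unitaryGroup {n : ℕ} {U : Matrix (Fin 2) (Fin 2) ℂ}
    (hU : U ∈ unitaryGroup (Fin 2) ℂ) (q : PlainCall n) :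
    plainCall U q ∈ unitaryGroup (Register n) ℂ :=
  plainHom_mem_unitaryGroup q hU

theorem controlledCall_mem_unitaryGroup {n : ℕ} {U : Matrix (Fin 2) (Fin 2) ℂ}
    (hU : U ∈ unitaryGroup (Fin 2) ℂ) (q : ControlledCall n) :
    controlledCall U q ∈ unitaryGroup (Register n) ℂ := by
  rw [controlledCall_eq_select]
  exact select_mem_unitaryGroup q.2 (one_mem _) hU

theorem norm_plainCall_sub_le {n : ℕ} (U V : Matrix (Fin 2) (Fin 2) ℂ) (q : PlainCall n) :
    ‖plainCall U q - plainCall V q‖ ≤ ‖U - V‖ := by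
  rw [← plainHom_apply, ← plainHom_apply, ← map_sub]
  exact norm_plainHom_le q _

theorem norm_controlledCall_sub_le {n : ℕ} (U V : Matrix (Fin 2) (Fin 2) ℂ)
    (q : ControlledCall n) : ‖controlledCall U q - controlledCall V q‖ ≤ ‖U - V‖ := by
  rw [controlledCall_eq_select, controlledCall_eq_select, select_sub, sub_self]
  refine (norm_select_le _ _).trans ?_
  rw [norm_zero, zero_add]

theorem norm_conj_sub_le {m : Type*} [Fintype m] [DecidableEq m] {T T' P M : Matrix m m ℂ}
    (hT : T ∈ unitaryGroup m ℂ) (hT' : T' ∈ unitaryGroup m ℂ) (hP : P ∈ unitaryGroup m ℂ)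
    (hM : M ∈ unitaryGroup m ℂ) {e : ℝ} (h : ‖T - T'‖ ≤ e) :
    ‖T * P * M * P * T - T' * P * M * P * T'‖ ≤ 2 * e := by
  have step : ∀ {A A' B : Matrix m m ℂ} {r : ℝ}, ‖A - A'‖ ≤ r → B ∈ unitaryGroup m ℂ →
      ‖A * B - A' * B‖ ≤ r := by
    intro A A' B r h1 h2
    rw [← sub_mul]
    exact (norm_mul_le _ _).trans ((mul_le_of_le_one_right (norm_nonneg _)
      (norm_le_one_of_mem_unitaryGroup h2)).trans h1)
  have h1 := step (step (step h hP) hM) hP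
  have h2 := norm_mul_sub_mul_le h1 h
    (norm_le_one_of_mem_unitaryGroup (mul_mem (mul_mem (mul_mem hT hP) hM) hP))
    (norm_le_one_of_mem_unitaryGroup hT')
  linarith

theorem rotX_mem_unitaryGroup (θ : ℝ) : rotX θ ∈ unitaryGroup (Fin 2) ℂ := by
  rw [rotX_eq_twisted]
  exact twisted_mem_unitaryGroup 0 θ

/-- A circuit that is accurate on twisted unitaries is accurate on unitaries close to them. -/
theorem implements_output {a : ℕ} {Q : Type}
    {call : Matrix (Fin 2) (Fin 2) ℂ → Q →
      Matrix (Register (a + 1)) (Register (a + 1)) ℂ}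
    (hcall : ∀ U ∈ unitaryGroup (Fin 2) ℂ, ∀ q, call U q ∈ unitaryGroup (Register (a + 1)) ℂ)
    (hsub : ∀ U V q, ‖call U q - call V q‖ ≤ ‖U - V‖) (c : QueryCircuit (a + 1) Q)
    {U : Matrix (Fin 2) (Fin 2) ℂ} (hU : U ∈ unitaryGroup (Fin 2) ℂ) {ν θ φ ε : ℝ}
    (hν : ‖U - twisted φ θ‖ ≤ ν)
    (hc : ‖c.run (call (twisted φ θ)) - plainHom 0 (rotX θ)‖ ≤ ε) :
    Implements (c.output (call U)) (rotX θ) (c.calls * ν + ε) := by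
  have h1 := c.norm_run_sub_le (hcall U hU) (hcall _ (twisted_mem_unitaryGroup φ θ))
    (fun q => (hsub _ _ q).trans hν)
  refine implements_of_norm_sub_le (M := c.run (call U)) (c.run_mem_unitaryGroup (hcall U hU))
    (rotX_mem_unitaryGroup θ) ?_
  refine (norm_sub_le_norm_sub_add_norm_sub _ (c.run (call (twisted φ θ))) _).trans
    (add_le_add h1 hc)

end

end Correction

namespace Correction

open Matrix

set_option linter.unusedSimpArgs false

noncomputable section

/-! ### Query counts -/

theorem log_one_div_sq_mul_sqrt {δ ε : ℝ} (hδ : 0 < δ) (hε : 0 < ε) :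
    Real.log (1 / (ε ^ 2 * √δ)) = -(2 * Real.log ε) - Real.log δ / 2 := by
  rw [one_div, Real.log_inv, Real.log_mul (by positivity) (by positivity), Real.log_pow,
    Real.log_sqrt hδ.le]
  push_cast
  ring

/-- Up to constants, -log δ - 2 log ε is twice the target logarithm plus 2 log ε; the latter is
bounded because ε ≤ 2. -/
theorem sign_budget {δ ε : ℝ} (hδ : 0 < δ) (hε : 0 < ε) (hε2 : ε ≤ 2) :
    1 + Real.log (1 / (δ * ((ε / 4) ^ 2 / 2))) ≤ 8 * max 1 (Real.log (1 / (ε ^ 2 * √δ))) := by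
  have h1 : Real.log (1 / (δ * ((ε / 4) ^ 2 / 2))) =
      5 * Real.log 2 - Real.log δ - 2 * Real.log ε := by
    have : 1 / (δ * ((ε / 4) ^ 2 / 2)) = 2 ^ 5 / (δ * ε ^ 2) := by
      field_simp
      norm_num
    rw [this, Real.log_div (by norm_num) (by positivity), Real.log_mul (by positivity)
      (by positivity), Real.log_pow, Real.log_pow]
    push_cast
    ring
  have h2 := log_one_div_sq_mul_sqrt hδ hε
  have h3 := le_max_left 1 (Real.log (1 / (ε ^ 2 * √δ)))
  have h4 := le_max_right 1 (Real.log (1 / (ε ^ 2 * √δ)))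
  have h5 := Real.log_le_log hε hε2
  have h6 := Real.log_two_lt_d9
  linarith

theorem log_one_div_pow_mul_sq_mul_sqrt {δ γ ε : ℝ} (hδ : 0 < δ) (hγ : 0 < γ) (hε : 0 < ε) :
    Real.log (1 / (γ ^ 4 * ε ^ 2 * √δ)) =
      -(4 * Real.log γ) - 2 * Real.log ε - Real.log δ / 2 := by
  rw [one_div, Real.log_inv, Real.log_mul (by positivity) (by positivity),
    Real.log_mul (by positivity) (by positivity), Real.log_pow, Real.log_pow, Real.log_sqrt hδ.le]
  push_cast
  ring

theorem half_angle_budget {δ γ ε : ℝ} (hδ : 0 < δ) (hδ1 : δ ≤ 1) (hγ : 0 < γ) (hγ1 : γ ≤ 1)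
    (hε : 0 < ε) :
    1 + Real.log (1 / (γ * ((ε / 4) ^ 2 / 6))) ≤
      7 * max 1 (Real.log (1 / (γ ^ 4 * ε ^ 2 * √δ))) := by
  have h1 : Real.log (1 / (γ * ((ε / 4) ^ 2 / 6))) ≤
      7 * Real.log 2 - Real.log γ - 2 * Real.log ε := by
    have : 1 / (γ * ((ε / 4) ^ 2 / 6)) = 96 / (γ * ε ^ 2) := by
      field_simp
      norm_num
    rw [this, Real.log_div (by norm_num) (by positivity), Real.log_mul (by positivity)
      (by positivity), Real.log_pow]
    have h2 : Real.log 96 ≤ Real.log (2 ^ 7) := Real.log_le_log (by norm_num) (by norm_num)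
    rw [Real.log_pow] at h2
    push_cast at h2 ⊢
    linarith
  have h2 := log_one_div_pow_mul_sq_mul_sqrt hδ hγ hε
  have h3 := le_max_left 1 (Real.log (1 / (γ ^ 4 * ε ^ 2 * √δ)))
  have h4 := le_max_right 1 (Real.log (1 / (γ ^ 4 * ε ^ 2 * √δ)))
  have h5 := Real.log_nonpos hγ.le hγ1
  have h6 := Real.log_nonpos hδ.le hδ1
  have h7 := Real.log_two_lt_d9
  linarith

/-- The inner accuracy depends on the outer length n, but log(n + 1) adds only multiples of -log γ
and of log L, and log L ≤ L - 1. -/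
theorem composed_sign_budget {δ γ ε L n : ℝ} (hδ : 0 < δ) (hγ : 0 < γ) (hγ1 : γ ≤ 1)
    (hε : 0 < ε) (hε2 : ε ≤ 2) (hL : L = max 1 (Real.log (1 / (γ ^ 4 * ε ^ 2 * √δ))))
    (hn0 : 0 ≤ n) (hn : n ≤ 560 * (γ ^ 2)⁻¹ * L) :
    1 + Real.log (1 / (δ * ((ε / (4 * (n + 1))) ^ 2 / 2))) ≤ 25 * L := by
  have h3 := le_max_left 1 (Real.log (1 / (γ ^ 4 * ε ^ 2 * √δ)))
  have h4 := le_max_right 1 (Real.log (1 / (γ ^ 4 * ε ^ 2 * √δ)))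
  rw [← hL] at h3 h4
  have h1 : Real.log (1 / (δ * ((ε / (4 * (n + 1))) ^ 2 / 2))) =
      5 * Real.log 2 + 2 * Real.log (n + 1) - Real.log δ - 2 * Real.log ε := by
    have : 1 / (δ * ((ε / (4 * (n + 1))) ^ 2 / 2)) = 2 ^ 5 * (n + 1) ^ 2 / (δ * ε ^ 2) := by
      field_simp
      norm_num
    rw [this, Real.log_div (by positivity) (by positivity), Real.log_mul (by positivity)
      (by positivity), Real.log_mul (by positivity) (by positivity), Real.log_pow, Real.log_pow,
      Real.log_pow]
    push_cast
    ring
  have hγi : 1 ≤ (γ ^ 2)⁻¹ := (one_le_inv₀ (by positivity)).2 (pow_le_one₀ hγ.le hγ1)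
  have h5 : n + 1 ≤ 2 ^ 10 * (γ ^ 2)⁻¹ * L := by
    have : 1 ≤ (γ ^ 2)⁻¹ * L := one_le_mul_of_one_le_of_one_le hγi h3
    linarith
  have h6 : Real.log (n + 1) ≤ 10 * Real.log 2 - 2 * Real.log γ + (L - 1) := by
    refine (Real.log_le_log (by linarith) h5).trans ?_
    rw [Real.log_mul (by positivity) (by positivity), Real.log_mul (by positivity)
      (by positivity), Real.log_inv, Real.log_pow, Real.log_pow]
    have := Real.log_le_sub_one_of_pos (x := L) (by linarith)
    push_cast
    linarith
  have h2 := log_one_div_pow_mul_sq_mul_sqrt hδ hγ hε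
  have h7 := Real.log_le_log hε hε2
  have h8 := Real.log_two_lt_d9
  have h9 := Real.log_nonpos hγ.le hγ1
  linarith

/-! ### The trivial circuit -/

theorem norm_one_sub_rotX_le (θ : ℝ) : ‖(1 : Matrix (Fin 2) (Fin 2) ℂ) - rotX θ‖ ≤ 2 := by
  refine (norm_sub_le _ _).trans ?_
  rw [norm_one]
  linarith [norm_le_one_of_mem_unitaryGroup (rotX_mem_unitaryGroup θ)]

theorem output_nil {a : ℕ} {Q : Type}
    (call : Q → Matrix (Register (a + 1)) (Register (a + 1)) ℂ) :
    (⟨1, []⟩ : QueryCircuit (a + 1) Q).output call = 1 := by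
  have h := compress_plainHom (a := a) 1
  rw [map_one] at h
  exact h

theorem implements_nil {a : ℕ} {Q : Type}
    (call : Q → Matrix (Register (a + 1)) (Register (a + 1)) ℂ) {ε : ℝ} (hε : 2 ≤ ε) (ν θ : ℝ) :
    Implements ((⟨1, []⟩ : QueryCircuit (a + 1) Q).output call) (rotX θ)
      ((⟨1, []⟩ : QueryCircuit (a + 1) Q).calls * ν + ε) := by
  have h : (((⟨1, []⟩ : QueryCircuit (a + 1) Q).calls : ℕ) : ℝ) * ν + ε = ε := by
    simp [QueryCircuit.calls]
  rw [output_nil, h]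
  exact ⟨(norm_one_sub_rotX_le θ).trans hε, fun h1 => by linarith⟩

/-! ### The three corrections -/

theorem le_sin_of_cos_sq_le {δ θ : ℝ} (hδ0 : 0 < δ) (hδ1 : δ ≤ 1) (hθ : θ ∈ Set.Icc 0 Real.pi)
    (h : Real.cos θ ^ 2 ≤ (1 - δ) ^ 2) : δ ≤ Real.sin θ := by
  refine le_of_sq_le_sq ?_ (Real.sin_nonneg_of_mem_Icc hθ)
  nlinarith [Real.sin_sq_add_cos_sq θ]

theorem neg_I_mem_unitaryGroup :
    (-Complex.I) • (1 : Matrix (Fin 2) (Fin 2) ℂ) ∈ unitaryGroup (Fin 2) ℂ := by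
  rw [mem_unitaryGroup_iff, star_smul, star_one, smul_mul_smul_comm]
  simp

theorem norm_neg_I_smul_sub_axis (M : Matrix (Fin 2) (Fin 2) ℂ) (φ : ℝ) :
    ‖(-Complex.I) • M - axis φ‖ = ‖M - Complex.I • axis φ‖ := by
  have : (-Complex.I) • M - axis φ = (-Complex.I) • (M - Complex.I • axis φ) := by
    rw [smul_sub, smul_smul]
    simp
  rw [this, norm_smul]
  simp

theorem axis_mem_unitaryGroup (φ : ℝ) : axis φ ∈ unitaryGroup (Fin 2) ℂ :=
  mem_unitary_of_star_eq_of_mul_self (star_axis φ) (axis_mul_self φ)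

/-- `select_axis_conj` with qubit 0 as control and the ancilla as target, controlled n being
replaced by a controlled word near i n. -/
theorem controlled_correction : ∃ C : ℝ, 0 < C ∧ ∀ δ ε : ℝ, 0 < δ → 0 < ε →
    ∃ c : QueryCircuit 2 (ControlledCall 2),
      (c.calls : ℝ) ≤ C * δ⁻¹ * max 1 (Real.log (1 / (ε ^ 2 * √δ))) ∧
      ∀ U ∈ unitaryGroup (Fin 2) ℂ, ∀ ν θ φ : ℝ,
        θ ∈ Set.Icc 0 Real.pi → φ ∈ Set.Icc (-Real.pi) Real.pi →
        ‖U - twisted φ θ‖ ≤ ν →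
        Real.cos θ ∈ Set.Icc (-1 + δ) (1 - δ) →
        Implements (c.output (controlledCall U)) (rotX θ) (c.calls * ν + ε) := by
  -- Two words of length at most 73 · 8 δ⁻¹L and two further calls: 2 · 584 + 2.
  refine ⟨1170, by norm_num, fun δ ε hδ hε => ?_⟩
  have hL := le_max_left 1 (Real.log (1 / (ε ^ 2 * √δ)))
  set L := max 1 (Real.log (1 / (ε ^ 2 * √δ))) with hLdef
  -- For δ > 1 no θ is admissible, and for ε ≥ 2 the identity is accurate enough; the empty circuit
  -- handles both.
  by_cases hδ1 : δ ≤ 1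
  swap
  · refine ⟨⟨1, []⟩, ?_, fun U _ ν θ φ _ _ _ h => ?_⟩
    · simp only [QueryCircuit.calls, List.length_nil, Nat.cast_zero]
      positivity
    · linarith [h.1, h.2]
  by_cases hε2 : ε < 2
  swap
  · refine ⟨⟨1, []⟩, ?_, fun U _ ν θ φ _ _ _ h => implements_nil _ (not_lt.1 hε2) ν θ⟩
    simp only [QueryCircuit.calls, List.length_nil, Nat.cast_zero]
    positivity
  obtain ⟨α, l, -, -, -, hl, hw, -⟩ := exists_sign_words hδ hδ1 (e := ε / 4) (by positivity)
    (by linarith)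
  have hst : (0 : Fin 2) ≠ 1 := by decide
  -- The word gives i n on one branch only, so the factor i is a relative phase and needs a
  -- controlled correction.
  have hIu := select_mem_unitaryGroup hst (one_mem _) neg_I_mem_unitaryGroup
  have hX := plainHom_mem_unitaryGroup (0 : Fin 2)
    (mem_unitary_of_star_eq_of_mul_self star_sigmaX sigmaX_mul_self)
  have hP := parityGate_mem_unitaryGroup hst
  have hT := (realizable_select_one_qspWord hst α l).const_mul hIu
  have hcall := realizable_call (call := controlledCall (n := 2)) ⟨(0, 1), hst⟩
  -- The central plain call on the ancilla is assembled from two controlled calls, one for each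
  -- value of the control.
  have hU := ((hcall.const_mul hX).mul (realizable_const hX)).mul hcall
  obtain ⟨c, hc, hrun⟩ := (((hT.mul (realizable_const hP)).mul hU).mul (realizable_const hP)).mul hT
  have hplain : ∀ U, plainHom 0 sigmaX * controlledCall U (⟨(0, 1), hst⟩ : ControlledCall 2) *
      plainHom 0 sigmaX * controlledCall U (⟨(0, 1), hst⟩ : ControlledCall 2) = plainHom 1 U := by
    intro U
    rw [controlledCall_eq_select, mul_assoc (plainHom 0 sigmaX), select_mul_sigmaX hst,
      ← mul_assoc, ← map_mul, sigmaX_mul_self, map_one, one_mul, select_mul hst, one_mul, mul_one,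
      select_self]
  refine ⟨c, ?_, fun U hU ν θ φ hθ hφ hν hcos => ?_⟩
  · rw [hc]
    have h1 : (l.length : ℝ) ≤ 73 * δ⁻¹ * (8 * L) :=
      hl.trans (mul_le_mul_of_nonneg_left (sign_budget hδ hε hε2.le) (by positivity))
    have h2 : 1 ≤ δ⁻¹ * L := one_le_mul_of_one_le_of_one_le ((one_le_inv₀ hδ).2 hδ1) hL
    push_cast
    linarith
  · refine implements_output (fun U hU q => controlledCall_mem_unitaryGroup hU q)
      norm_controlledCall_sub_le c hU hν ?_
    have hU' := twisted_mem_unitaryGroup φ θ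
    have hsin : δ ≤ Real.sin θ := by
      refine le_sin_of_cos_sq_le hδ hδ1 hθ ?_
      nlinarith [hcos.1, hcos.2]
    rw [hrun]
    dsimp only
    rw [hplain, ← select_axis_conj hst φ θ, select_mul hst, one_mul, smul_mul_assoc, one_mul]
    have hneg : (-Complex.I) • qspWord α l (twisted φ θ) ∈ unitaryGroup (Fin 2) ℂ := by
      have := mul_mem neg_I_mem_unitaryGroup (qspWord_mem_unitaryGroup α l hU')
      rwa [smul_mul_assoc, one_mul] at this
    refine (norm_conj_sub_le (e := ε / 4) (select_mem_unitaryGroup hst (one_mem _) hneg)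
      (select_mem_unitaryGroup hst (one_mem _) (axis_mem_unitaryGroup φ)) hP
      (plainHom_mem_unitaryGroup _ hU') ?_).trans (by linarith)
    rw [select_sub, sub_self]
    refine (norm_select_le _ _).trans ?_
    rw [norm_zero, zero_add, norm_neg_I_smul_sub_axis]
    exact hw φ θ hsin

/-- As in `controlled_correction`, but the idle branch runs a word near 1, available since cos θ ≥
δ, and the central call is plain already. -/
theorem uncontrolled_correction : ∃ C : ℝ, 0 < C ∧ ∀ δ ε : ℝ, 0 < δ → 0 < ε →
    ∃ c : QueryCircuit 3 (PlainCall 3),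
      (c.calls : ℝ) ≤ C * δ⁻¹ * max 1 (Real.log (1 / (ε ^ 2 * √δ))) ∧
      ∀ U ∈ unitaryGroup (Fin 2) ℂ, ∀ ν θ φ : ℝ,
        θ ∈ Set.Icc 0 Real.pi → φ ∈ Set.Icc (-Real.pi) Real.pi →
        ‖U - twisted φ θ‖ ≤ ν →
        Real.cos θ ∈ Set.Icc δ (1 - δ) →
        Implements (c.output (plainCall U)) (rotX θ) (c.calls * ν + ε) := by
  refine ⟨1170, by norm_num, fun δ ε hδ hε => ?_⟩
  have hL := le_max_left 1 (Real.log (1 / (ε ^ 2 * √δ)))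
  set L := max 1 (Real.log (1 / (ε ^ 2 * √δ))) with hLdef
  by_cases hδ1 : δ ≤ 1
  swap
  · refine ⟨⟨1, []⟩, ?_, fun U _ ν θ φ _ _ _ h => ?_⟩
    · simp only [QueryCircuit.calls, List.length_nil, Nat.cast_zero]
      positivity
    · linarith [h.1, h.2]
  by_cases hε2 : ε < 2
  swap
  · refine ⟨⟨1, []⟩, ?_, fun U _ ν θ φ _ _ _ h => implements_nil _ (not_lt.1 hε2) ν θ⟩
    simp only [QueryCircuit.calls, List.length_nil, Nat.cast_zero]
    positivity
  obtain ⟨α, l, α', l', hll, hl, hw, hw'⟩ := exists_sign_words hδ hδ1 (e := ε / 4)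
    (by positivity) (by linarith)
  -- Qubits 0 and 1 suffice; qubit 2 stays idle in |0⟩.
  have hst : (0 : Fin 3) ≠ 1 := by decide
  have hIu := select_mem_unitaryGroup hst (one_mem _) neg_I_mem_unitaryGroup
  have hP := parityGate_mem_unitaryGroup hst
  have hT := (realizable_select_qspWord hst α' α l' l hll).const_mul hIu
  have hcall := realizable_call (call := plainCall (n := 3)) 1
  obtain ⟨c, hc, hrun⟩ :=
    (((hT.mul (realizable_const hP)).mul hcall).mul (realizable_const hP)).mul hT
  refine ⟨c, ?_, fun U hU ν θ φ hθ hφ hν hcos => ?_⟩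
  · rw [hc, hll]
    have h1 : (l.length : ℝ) ≤ 73 * δ⁻¹ * (8 * L) :=
      hl.trans (mul_le_mul_of_nonneg_left (sign_budget hδ hε hε2.le) (by positivity))
    have h2 : 1 ≤ δ⁻¹ * L := one_le_mul_of_one_le_of_one_le ((one_le_inv₀ hδ).2 hδ1) hL
    push_cast
    linarith
  · refine implements_output (fun U hU q => plainCall_mem_unitaryGroup hU q)
      norm_plainCall_sub_le c hU hν ?_
    have hU' := twisted_mem_unitaryGroup φ θ
    have hsin : δ ≤ Real.sin θ := by
      refine le_sin_of_cos_sq_le hδ hδ1 hθ ?_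
      nlinarith [hcos.1, hcos.2]
    rw [hrun]
    dsimp only
    rw [← plainHom_apply, ← select_axis_conj hst φ θ, select_mul hst, one_mul, smul_mul_assoc,
      one_mul]
    have hneg : (-Complex.I) • qspWord α l (twisted φ θ) ∈ unitaryGroup (Fin 2) ℂ := by
      have := mul_mem neg_I_mem_unitaryGroup (qspWord_mem_unitaryGroup α l hU')
      rwa [smul_mul_assoc, one_mul] at this
    refine (norm_conj_sub_le (e := ε / 4 + ε / 4)
      (select_mem_unitaryGroup hst (qspWord_mem_unitaryGroup α' l' hU') hneg)
      (select_mem_unitaryGroup hst (one_mem _) (axis_mem_unitaryGroup φ)) hP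
      (plainHom_mem_unitaryGroup _ hU') ?_).trans (by linarith)
    rw [select_sub]
    refine (norm_select_le _ _).trans (add_le_add (hw' φ θ hcos.1) ?_)
    rw [norm_neg_I_smul_sub_axis]
    exact hw φ θ hsin

/-! ### The deterministic correction on a single qubit. -/

theorem sigmaX_mul_axis (φ : ℝ) : sigmaX * axis φ = rotZ (-φ) := by
  rw [rotZ_eq, sigmaX, axis]
  ext i j
  fin_cases i <;> fin_cases j <;> simp [mul_apply, Fin.sum_univ_two]

theorem sigmaX_rotZ_sigmaX (t : ℝ) : sigmaX * rotZ t * sigmaX = rotZ (-t) := by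
  rw [rotZ_eq, rotZ_eq, sigmaX]
  ext i j
  fin_cases i <;> fin_cases j <;> simp [mul_apply, Fin.sum_univ_two]

theorem hadamard_rotX_hadamard (t : ℝ) : hadamard * rotX t * hadamard = rotZ t := by
  rw [← hadamard_rotZ_hadamard]
  simp only [mul_assoc]
  rw [hadamard_mul_self, mul_one, ← mul_assoc, hadamard_mul_self, one_mul]

theorem rotZ_mul_rotZ (s t : ℝ) : rotZ s * rotZ t = rotZ (s + t) := by
  rw [rotZ_eq, rotZ_eq, rotZ_eq]
  ext i j
  fin_cases i <;> fin_cases j <;> simp [mul_apply, Fin.sum_univ_two, ← Complex.exp_add] <;>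
    congr 1 <;> ring

theorem rotZ_zero : rotZ 0 = 1 := by
  rw [rotZ_eq]
  ext i j
  fin_cases i <;> fin_cases j <;> simp

theorem rotZ_twisted_rotZ (φ θ : ℝ) :
    rotZ (-(φ / 2)) * twisted φ θ * rotZ (φ / 2) = rotX θ := by
  have h1 : rotZ (-(φ / 2)) * rotZ (φ / 2) = 1 := by
    rw [rotZ_mul_rotZ, neg_add_cancel, rotZ_zero]
  calc rotZ (-(φ / 2)) * twisted φ θ * rotZ (φ / 2) =
        (rotZ (-(φ / 2)) * rotZ (φ / 2)) * rotX θ * (rotZ (-(φ / 2)) * rotZ (φ / 2)) := by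
        simp only [twisted, mul_assoc]
    _ = rotX θ := by rw [h1, one_mul, mul_one]

/-- Jordan's inequality gives sin 2γ ≥ 4γ/π, and π ≤ 4. -/
theorem le_cos_of_abs_le {γ φ : ℝ} (hγ : 0 < γ) (h : |φ| ≤ Real.pi / 2 - 2 * γ) :
    γ ≤ Real.cos φ := by
  have hpi := Real.pi_pos
  have h0 := abs_nonneg φ
  have h1 : Real.cos (Real.pi / 2 - 2 * γ) ≤ Real.cos |φ| :=
    Real.cos_le_cos_of_nonneg_of_le_pi h0 (by linarith) h
  rw [Real.cos_abs, Real.cos_pi_div_two_sub] at h1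
  have h2 := Real.mul_le_sin (x := 2 * γ) (by linarith) (by linarith)
  have h3 : γ ≤ 2 / Real.pi * (2 * γ) := by
    have := Real.pi_le_four
    rw [div_mul_eq_mul_div, le_div_iff₀ hpi]
    nlinarith
  linarith

theorem norm_mul_mul_sub_le {m : Type*} [Fintype m] [DecidableEq m] {V W A B : Matrix m m ℂ}
    (hV : V ∈ unitaryGroup m ℂ) (hW : W ∈ unitaryGroup m ℂ) {e : ℝ} (h : ‖A - B‖ ≤ e) :
    ‖V * A * W - V * B * W‖ ≤ e := by
  rw [← sub_mul, ← mul_sub]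
  refine (norm_mul_le _ _).trans ((mul_le_of_le_one_right (norm_nonneg _)
    (norm_le_one_of_mem_unitaryGroup hW)).trans ((norm_mul_le _ _).trans
      ((mul_le_of_le_one_left (norm_nonneg _) (norm_le_one_of_mem_unitaryGroup hV)).trans h)))

/-- The inner word yields n, and σ_x n is a z-rotation by -φ. Between Hadamard gates it becomes an
x-rotation, which the outer word halves; converted back, this is V ≈ e^{-iφσ_z/2}, while σ_x V σ_x
approximates the inverse. The product V U σ_x V σ_x is then untwisted. -/
theorem deterministic_correction : ∃ C : ℝ, 0 < C ∧ ∀ δ γ ε : ℝ, 0 < δ → 0 < γ → 0 < ε →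
    ∃ c : QueryCircuit 1 (PlainCall 1),
      (c.calls : ℝ) ≤
        C * δ⁻¹ * (γ ^ 2)⁻¹ * (max 1 (Real.log (1 / (γ ^ 4 * ε ^ 2 * √δ)))) ^ 2 ∧
      ∀ U ∈ unitaryGroup (Fin 2) ℂ, ∀ ν θ φ : ℝ,
        θ ∈ Set.Icc 0 Real.pi → φ ∈ Set.Icc (-(Real.pi / 2)) (Real.pi / 2) →
        ‖U - twisted φ θ‖ ≤ ν →
        Real.cos θ ∈ Set.Icc (-1 + δ) (1 - δ) →
        (Real.cos φ ∈ Set.Icc γ √(1 - γ ^ 2) ∨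
          φ ∈ Set.Icc (-(Real.pi / 2) + 2 * γ) (-(2 * γ)) ∪
            Set.Icc (2 * γ) (Real.pi / 2 - 2 * γ)) →
        c.output (plainCall U) ∈ unitaryGroup (Fin 2) ℂ ∧
        ‖c.output (plainCall U) - rotX θ‖ ≤ c.calls * ν + ε := by
  -- The circuit makes 2|m||l| + 1 calls, with |m| ≤ 560γ⁻²L and |l| ≤ 1825δ⁻¹L.
  refine ⟨2100000, by norm_num, fun δ γ ε hδ hγ hε => ?_⟩
  have hL := le_max_left 1 (Real.log (1 / (γ ^ 4 * ε ^ 2 * √δ)))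
  set L := max 1 (Real.log (1 / (γ ^ 4 * ε ^ 2 * √δ))) with hLdef
  by_cases hε2 : ε < 2
  swap
  · refine ⟨⟨1, []⟩, ?_, fun U _ ν θ φ _ _ _ h _ => ?_⟩
    · simp only [QueryCircuit.calls, List.length_nil, Nat.cast_zero]
      positivity
    · rw [output_nil]
      refine ⟨one_mem _, (norm_one_sub_rotX_le θ).trans ?_⟩
      simp only [QueryCircuit.calls, List.length_nil, Nat.cast_zero, zero_mul, zero_add]
      exact not_lt.1 hε2
  have hcosγ : ∀ φ : ℝ, (Real.cos φ ∈ Set.Icc γ √(1 - γ ^ 2) ∨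
      φ ∈ Set.Icc (-(Real.pi / 2) + 2 * γ) (-(2 * γ)) ∪
        Set.Icc (2 * γ) (Real.pi / 2 - 2 * γ)) → γ ≤ Real.cos φ := by
    rintro φ (h | h | h)
    · exact h.1
    · refine le_cos_of_abs_le hγ (abs_le.2 ⟨?_, ?_⟩) <;> linarith [h.1, h.2]
    · refine le_cos_of_abs_le hγ (abs_le.2 ⟨?_, ?_⟩) <;> linarith [h.1, h.2]
  by_cases hδγ : δ ≤ 1 ∧ γ ≤ 1
  swap
  · refine ⟨⟨1, []⟩, ?_, fun U _ ν θ φ _ _ _ h h' => ?_⟩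
    · simp only [QueryCircuit.calls, List.length_nil, Nat.cast_zero]
      positivity
    · exact absurd ⟨by linarith [h.1, h.2], (hcosγ φ h').trans (Real.cos_le_one φ)⟩ hδγ
  obtain ⟨hδ1, hγ1⟩ := hδγ
  obtain ⟨β, m, hm, hhalf⟩ := exists_half_angle_word hγ hγ1 (e := ε / 4) (by positivity)
    (by linarith)
  have hmL : (m.length : ℝ) ≤ 560 * (γ ^ 2)⁻¹ * L := by
    refine hm.trans ?_
    have := half_angle_budget hδ hδ1 hγ hγ1 hε
    rw [← hLdef] at this
    calc _ ≤ 80 * (γ ^ 2)⁻¹ * (7 * L) := by gcongr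
      _ = _ := by ring
  have hm0 : (0 : ℝ) ≤ m.length := Nat.cast_nonneg _
  -- The outer word uses the inner one |m| times, so this accuracy costs at most ε/4 in total; the
  -- added 1 keeps the denominator positive.
  set e := ε / (4 * ((m.length : ℝ) + 1)) with he
  have he0 : 0 < e := by positivity
  have he1 : e ≤ 1 := by
    rw [he, div_le_one (by positivity)]
    linarith
  obtain ⟨α, l, -, -, -, hl, hw, -⟩ := exists_sign_words hδ hδ1 he0 he1
  have hlL : (l.length : ℝ) ≤ 1825 * δ⁻¹ * L := by
    refine hl.trans ?_
    have := composed_sign_budget hδ hγ hγ1 hε hε2.le hLdef hm0 hmL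
    rw [← he] at this
    calc _ ≤ 73 * δ⁻¹ * (25 * L) := by gcongr
      _ = _ := by ring
  have hXu : sigmaX ∈ unitaryGroup (Fin 2) ℂ :=
    mem_unitary_of_star_eq_of_mul_self star_sigmaX sigmaX_mul_self
  have hHu : hadamard ∈ unitaryGroup (Fin 2) ℂ :=
    mem_unitary_of_star_eq_of_mul_self star_hadamard hadamard_mul_self
  have hHXu : hadamard * ((-Complex.I) • 1 * sigmaX) ∈ unitaryGroup (Fin 2) ℂ :=
    mul_mem hHu (mul_mem neg_I_mem_unitaryGroup hXu)
  have hcallt := realizable_call (call := plainCall (n := 1)) 0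
  have hid : Realizable (plainCall (n := 1)) 1 fun U => plainHom 0 U := hcallt
  have hS := ((realizable_qspWord hid α l).const_mul (plainHom_mem_unitaryGroup 0 hHXu)).mul
    (realizable_const (plainHom_mem_unitaryGroup 0 hHu))
  let S : Matrix (Fin 2) (Fin 2) ℂ → Matrix (Fin 2) (Fin 2) ℂ := fun U =>
    hadamard * ((-Complex.I) • 1 * sigmaX) * qspWord α l U * hadamard
  let V : Matrix (Fin 2) (Fin 2) ℂ → Matrix (Fin 2) (Fin 2) ℂ := fun U =>
    hadamard * qspWord β m (S U) * hadamard
  have hS' : Realizable (plainCall (n := 1)) l.length fun U => plainHom 0 (S U) := by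
    rw [mul_one, add_zero] at hS
    refine hS.congr fun U => ?_
    rw [← map_mul, ← map_mul]
  have hV : Realizable (plainCall (n := 1)) (m.length * l.length) fun U => plainHom 0 (V U) := by
    have h := ((realizable_qspWord hS' β m).const_mul (plainHom_mem_unitaryGroup 0 hHu)).mul
      (realizable_const (plainHom_mem_unitaryGroup 0 hHu))
    rw [add_zero] at h
    refine h.congr fun U => ?_
    rw [← map_mul, ← map_mul]
  have hF : Realizable (plainCall (n := 1)) (m.length * l.length + 1 + m.length * l.length)
      fun U => plainHom 0 (V U * U * (sigmaX * V U * sigmaX)) := by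
    have h := (hV.mul hid).mul ((hV.const_mul (plainHom_mem_unitaryGroup 0 hXu)).mul
      (realizable_const (plainHom_mem_unitaryGroup 0 hXu)))
    rw [add_zero] at h
    refine h.congr fun U => ?_
    rw [← map_mul, ← map_mul, ← map_mul, ← map_mul]
  have hSu : ∀ U ∈ unitaryGroup (Fin 2) ℂ, S U ∈ unitaryGroup (Fin 2) ℂ := fun U hU =>
    mul_mem (mul_mem hHXu (qspWord_mem_unitaryGroup α l hU)) hHu
  have hVu : ∀ U ∈ unitaryGroup (Fin 2) ℂ, V U ∈ unitaryGroup (Fin 2) ℂ := fun U hU =>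
    mul_mem (mul_mem hHu (qspWord_mem_unitaryGroup β m (hSu U hU))) hHu
  obtain ⟨c, hc, hrun⟩ := hF
  have hout : ∀ U, c.output (plainCall U) = V U * U * (sigmaX * V U * sigmaX) := by
    intro U
    change compress (c.run (plainCall U)) = _
    rw [hrun, compress_plainHom]
  refine ⟨c, ?_, fun U hU ν θ φ hθ hφ hν hcos hφγ => ⟨?_, ?_⟩⟩
  · rw [hc]
    have hγi : 1 ≤ (γ ^ 2)⁻¹ := (one_le_inv₀ (by positivity)).2 (pow_le_one₀ hγ.le hγ1)
    have hδi : 1 ≤ δ⁻¹ := (one_le_inv₀ hδ).2 hδ1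
    have h1 : (m.length : ℝ) * l.length ≤ 560 * (γ ^ 2)⁻¹ * L * (1825 * δ⁻¹ * L) :=
      mul_le_mul hmL hlL (Nat.cast_nonneg _) (by positivity)
    have h2 : 1 ≤ δ⁻¹ * (γ ^ 2)⁻¹ * L ^ 2 := one_le_mul_of_one_le_of_one_le
      (one_le_mul_of_one_le_of_one_le hδi hγi) (one_le_pow₀ hL)
    push_cast
    nlinarith
  · rw [hout]
    exact mul_mem (mul_mem (hVu U hU) hU) (mul_mem (mul_mem hXu (hVu U hU)) hXu)
  · have hU' := twisted_mem_unitaryGroup φ θ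
    have hsin : δ ≤ Real.sin θ := by
      refine le_sin_of_cos_sq_le hδ hδ1 hθ ?_
      nlinarith [hcos.1, hcos.2]
    have hrunsub := c.norm_run_sub_le (fun q => plainCall_mem_unitaryGroup hU q)
      (fun q => plainCall_mem_unitaryGroup hU' q)
      (fun q => (norm_plainCall_sub_le _ _ q).trans hν)
    have h1 : ‖c.output (plainCall U) - c.output (plainCall (twisted φ θ))‖ ≤ c.calls * ν := by
      refine le_trans ?_ hrunsub
      exact norm_compress_le (c.run (plainCall U) - c.run (plainCall (twisted φ θ)))
    refine (norm_sub_le_norm_sub_add_norm_sub _ (c.output (plainCall (twisted φ θ))) _).trans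
      (add_le_add h1 ?_)
    rw [hout]
    -- the inner word
    have hSerr : ‖S (twisted φ θ) - rotX (-φ)‖ ≤ e := by
      have h2 : rotX (-φ) = hadamard * ((-Complex.I) • 1 * sigmaX) * (Complex.I • axis φ) *
          hadamard := by
        rw [← hadamard_rotZ_hadamard, ← sigmaX_mul_axis, mul_assoc hadamard _ (Complex.I • axis φ),
          mul_smul_comm, smul_mul_assoc, one_mul, smul_mul_assoc, smul_smul]
        simp
      rw [h2]
      exact norm_mul_mul_sub_le hHXu hHu (hw φ θ hsin)
    -- Inner errors accumulated over the outer word, plus the half-angle error; two copies of V then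
    -- use up ε.
    have hVerr : ‖V (twisted φ θ) - rotZ (-(φ / 2))‖ ≤ m.length * e + ε / 4 := by
      have h2 : rotZ (-(φ / 2)) = hadamard * rotX (-φ / 2) * hadamard := by
        rw [hadamard_rotX_hadamard, neg_div]
      rw [h2]
      refine norm_mul_mul_sub_le hHu hHu ?_
      refine (norm_sub_le_norm_sub_add_norm_sub _ (qspWord β m (rotX (-φ))) _).trans
        (add_le_add (norm_qspWord_sub_le β m (hSu _ hU') (rotX_mem_unitaryGroup _) hSerr) ?_)
      refine hhalf (-φ) ?_ ?_
      · rw [abs_neg, abs_le]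
        exact hφ
      · rw [Real.cos_neg]
        exact hcosγ φ hφγ
    have hXV : ‖sigmaX * V (twisted φ θ) * sigmaX - rotZ (φ / 2)‖ ≤ m.length * e + ε / 4 := by
      have h2 : rotZ (φ / 2) = sigmaX * rotZ (-(φ / 2)) * sigmaX := by
        rw [sigmaX_rotZ_sigmaX, neg_neg]
      rw [h2]
      exact norm_mul_mul_sub_le hXu hXu hVerr
    have hme : (m.length : ℝ) * e ≤ ε / 4 := by
      rw [he, mul_div_assoc', div_le_div_iff₀ (by positivity) (by norm_num)]
      nlinarith
    rw [← rotZ_twisted_rotZ φ θ]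
    have h3 : ‖V (twisted φ θ) * twisted φ θ - rotZ (-(φ / 2)) * twisted φ θ‖ ≤
        m.length * e + ε / 4 := by
      have := norm_mul_mul_sub_le (one_mem _) hU' hVerr
      rwa [one_mul, one_mul] at this
    have h4 := norm_mul_sub_mul_le h3 hXV
      (norm_le_one_of_mem_unitaryGroup (mul_mem (hVu _ hU') hU'))
      (norm_le_one_of_mem_unitaryGroup (rotZ_mem_unitaryGroup _))
    linarith

end

end Correction

theorem mainTheorem4 :
    -- one ancilla, calls to controlled-`U`
    (∃ C : ℝ, 0 < C ∧ ∀ δ ε : ℝ, 0 < δ → 0 < ε →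
      ∃ c : Correction.QueryCircuit 2 (Correction.ControlledCall 2),
        (c.calls : ℝ) ≤ C * δ⁻¹ * max 1 (Real.log (1 / (ε ^ 2 * √δ))) ∧
        ∀ U ∈ Matrix.unitaryGroup (Fin 2) ℂ, ∀ ν θ φ : ℝ,
          θ ∈ Set.Icc 0 Real.pi → φ ∈ Set.Icc (-Real.pi) Real.pi →
          ‖U - Correction.twisted φ θ‖ ≤ ν →
          Real.cos θ ∈ Set.Icc (-1 + δ) (1 - δ) →
          Correction.Implements (c.output (Correction.controlledCall U)) (Correction.rotX θ)
            (c.calls * ν + ε)) ∧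
    -- two ancillas, uncontrolled calls
    (∃ C : ℝ, 0 < C ∧ ∀ δ ε : ℝ, 0 < δ → 0 < ε →
      ∃ c : Correction.QueryCircuit 3 (Correction.PlainCall 3),
        (c.calls : ℝ) ≤ C * δ⁻¹ * max 1 (Real.log (1 / (ε ^ 2 * √δ))) ∧
        ∀ U ∈ Matrix.unitaryGroup (Fin 2) ℂ, ∀ ν θ φ : ℝ,
          θ ∈ Set.Icc 0 Real.pi → φ ∈ Set.Icc (-Real.pi) Real.pi →
          ‖U - Correction.twisted φ θ‖ ≤ ν →
          Real.cos θ ∈ Set.Icc δ (1 - δ) →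
          Correction.Implements (c.output (Correction.plainCall U)) (Correction.rotX θ)
            (c.calls * ν + ε)) ∧
    -- no ancilla, uncontrolled calls, deterministic
    (∃ C : ℝ, 0 < C ∧ ∀ δ γ ε : ℝ, 0 < δ → 0 < γ → 0 < ε →
      ∃ c : Correction.QueryCircuit 1 (Correction.PlainCall 1),
        (c.calls : ℝ) ≤
          C * δ⁻¹ * (γ ^ 2)⁻¹ * (max 1 (Real.log (1 / (γ ^ 4 * ε ^ 2 * √δ)))) ^ 2 ∧
        ∀ U ∈ Matrix.unitaryGroup (Fin 2) ℂ, ∀ ν θ φ : ℝ,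
          θ ∈ Set.Icc 0 Real.pi → φ ∈ Set.Icc (-(Real.pi / 2)) (Real.pi / 2) →
          ‖U - Correction.twisted φ θ‖ ≤ ν →
          Real.cos θ ∈ Set.Icc (-1 + δ) (1 - δ) →
          (Real.cos φ ∈ Set.Icc γ √(1 - γ ^ 2) ∨
            φ ∈ Set.Icc (-(Real.pi / 2) + 2 * γ) (-(2 * γ)) ∪
              Set.Icc (2 * γ) (Real.pi / 2 - 2 * γ)) →
          c.output (Correction.plainCall U) ∈ Matrix.unitaryGroup (Fin 2) ℂ ∧
          ‖c.output (Correction.plainCall U) - Correction.rotX θ‖ ≤ c.calls * ν + ε) := by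
  exact ⟨Correction.controlled_correction, Correction.uncontrolled_correction,
    Correction.deterministic_correction⟩
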